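/- Let $(M,\omega)$ be a symplectic manifold and $\mathcal{T}$ a smooth manifold (both finite-dimensional, Hausdorff, second countable, without boundary). Write $C^\infty(M)$ for the complex valued smooth functions on $M$. A \emph{natural star product} on $M$ is an associative $\mathbb{C}[[h]]$-bilinear product $f\star g=\sum_k c^k(f,g)h^k$ on $C^\infty(M)[[h]]$ with unit $1$ such that $c^0(f,g)=fg$, $c^1(f,g)-c^1(g,f)=i\{f,g\}$, and $c^k$ is a differential operator of order at most $k$ in each argument. Let $\{\star_\sigma\}_{\sigma\in\mathcal{T}}$ be a smooth family of natural star products on $M$. A \emph{formal connection} is an operator $$D_Vf=V[f]+A(V)(f)$$ for smooth vector fields $V$ on $\mathcal{T}$ and smooth sections $f$ of $\mathcal{T}\times C^\infty(M)[[h]]\to\mathcal{T}$, where $A=\sum_{k\ge1}A^kh^k$ is a smooth $1$-form on $\mathcal{T}$ with values in formal differential operators on $M$ that vanish modulo $h$, with $A^k$ of order at most $k$. It is \emph{compatible} with the family if $D_V(f\star_\sigma g)=D_V(f)\star_\sigma g+f\star_\sigma D_V(g)$ for all $V$ and all smooth sections $f,g$. Let $\mathcal{F}(M,\star_\sigma)$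 be the set of compatible formal connections. Let $\mathrm{Der}_0(M,\star_\sigma)$ be the space of $\mathbb{C}[[h]]$-linear derivations of $\star_\sigma$ that vanish modulo $h$, let $\Gamma_{\mathrm{sym}}(M)$ be the space of smooth complex vector fields $Y$ on $M$ for which $\iota_Y\omega$ is closed, and let $\tilde C^\infty_h(M)=C^\infty(M)[[h]]/\mathbb{C}[[h]]$. Denote by $X_b$ the Hamiltonian vector field of $b$, $X_b(f)=\{b,f\}$. (1) For every $D_0\in\mathcal{F}(M,\star_\sigma)$, $$\mathcal{F}(M,\star_\sigma)=D_0+\Omega^1(\mathcal{T},\mathrm{Der}_0(M,\star_\sigma)),$$ that is, the map $\beta\mapsto D_0+\beta$ is a bijection from the smooth $1$-forms $\beta$ on $\mathcal{T}$ with $\beta_\sigma(v)\in\mathrm{Der}_0(M,\star_\sigma)$ onto $\mathcal{F}(M,\star_\sigma)$. (2) For every $\sigma$ there is a linear isomorphism $\varphi_\sigma\colon h\Gamma_{\mathrm{sym}}(M)[[h]]\to\mathrm{Der}_0(M,\star_\sigma)$ such that, whenever $b=\sum_k b_kh^k$ is a formal function with $Y_k=X_{b_k}$ for all $k$ on an open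 set $U\subset M$, the derivation $B=\varphi_\sigma(\sum_kY_kh^k)$ satisfies $B(f)|_U=\frac1h(b\star_\sigma f-f\star_\sigma b)|_U$ for all $f$; every point of $M$ has a neighbourhood on which there is such a $b$. Applied pointwise, these isomorphisms induce a linear isomorphism $\Omega^1(\mathcal{T},h\Gamma_{\mathrm{sym}}(M)[[h]])\cong\Omega^1(\mathcal{T},\mathrm{Der}_0(M,\star_\sigma))$, and through it, for every $D_0\in\mathcal{F}(M,\star_\sigma)$, $$\mathcal{F}(M,\star_\sigma)=D_0+\Omega^1(\mathcal{T},h\Gamma_{\mathrm{sym}}(M)[[h]]),$$ each connection being obtained from exactly one $1$-form. (3) If moreover $M$ is connected and $H^1(M;\mathbb{R})=0$, then for every $\sigma$ the map $[b]\mapsto\frac1h(b\star_\sigma\cdot-\cdot\star_\sigma b)$ is a linear isomorphism $h\tilde C^\infty_h(M)\to\mathrm{Der}_0(M,\star_\sigma)$. These isomorphisms induce a linear isomorphism $\Omega^1(\mathcal{T},h\tilde C^\infty_h(M))\cong\Omega^1(\mathcal{T},\mathrm{Der}_0(M,\star_\sigma))$, and through it, for every $D_0\in\mathcal{F}(M,\star_\sigma)$,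 $$\mathcal{F}(M,\star_\sigma)=D_0+\Omega^1(\mathcal{T},h\tilde C^\infty_h(M)),$$ each connection being obtained from exactly one $1$-form. -/

import Mathlib

open scoped Manifold ContDiff TensorProduct PowerSeries

noncomputable section

namespace FormalConnections

/-! ## Smooth functions, differential forms, first de Rham cohomology

Manifolds are finite-dimensional, without boundary, modelled on a normed space `E`. -/

section Manifold

variable (E : Type*) [NormedAddCommGroup E] [NormedSpace ℝ E]
  (M : Type*) [TopologicalSpace M] [ChartedSpace E M]

/-- The algebra `C^∞(M)` of complex valued smooth functions on `M`. -/
def SmoothFn : Subalgebra ℂ (M → ℂ) where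
  carrier := {f | ContMDiff 𝓘(ℝ, E) 𝓘(ℝ, ℂ) ∞ f}
  mul_mem' {f g} hf hg := by
    have h : ContDiff ℝ ∞ (fun p : ℂ × ℂ => p.1 * p.2) := contDiff_mul
    exact h.comp_contMDiff (hf.prodMk_space hg)
  add_mem' {f g} hf hg := ContMDiff.add hf hg
  algebraMap_mem' _ := contMDiff_const

/-- Differential `k`-forms on `M` with values in `G`, without regularity. -/
abbrev Form (G : Type*) [NormedAddCommGroup G] [NormedSpace ℝ G] (k : ℕ) : Type _ :=
  (x : M) → TangentSpace 𝓘(ℝ, E) x [⋀^Fin k]→L[ℝ] G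

variable {E M} {G : Type*} [NormedAddCommGroup G] [NormedSpace ℝ G] {k : ℕ}

/-- The expression of a form in the preferred chart at `x₀`: its pullback under the inverse of the
chart. It is meaningful on the target of the chart. -/
def Form.inChart (α : Form E M G k) (x₀ : M) (y : E) : E [⋀^Fin k]→L[ℝ] G :=
  (α ((extChartAt 𝓘(ℝ, E) x₀).symm y)).compContinuousLinearMap
    (mfderiv 𝓘(ℝ, E) 𝓘(ℝ, E) (extChartAt 𝓘(ℝ, E) x₀).symm y)

/-- A form is smooth if it is smooth in every chart. -/
def Form.IsSmooth (α : Form E M G k) : Prop :=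
  ∀ x₀ : M, ContDiffOn ℝ ∞ (α.inChart x₀) (extChartAt 𝓘(ℝ, E) x₀).target

/-- A form is closed if its exterior derivative vanishes in every chart. -/
def Form.IsClosed (α : Form E M G k) : Prop :=
  ∀ x₀ : M, ∀ y ∈ (extChartAt 𝓘(ℝ, E) x₀).target, extDeriv (α.inChart x₀) y = 0

/-- A linear functional on every tangent space, seen as a `1`-form. -/
def oneForm (α : (x : M) → TangentSpace 𝓘(ℝ, E) x →L[ℝ] G) : Form E M G 1 :=
  fun x => ContinuousAlternatingMap.ofSubsingleton ℝ (TangentSpace 𝓘(ℝ, E) x) G (0 : Fin 1) (α x)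

/-- The differential `df` of a function, as a `1`-form. -/
def differential (f : M → G) : Form E M G 1 :=
  oneForm fun x => mfderiv 𝓘(ℝ, E) 𝓘(ℝ, G) f x

theorem Form.IsSmooth.differentiableAt {α : Form E M G k} (h : α.IsSmooth) {x₀ : M} {y : E}
    (hy : y ∈ (extChartAt 𝓘(ℝ, E) x₀).target) : DifferentiableAt ℝ (α.inChart x₀) y :=
  ((h x₀).contDiffAt ((isOpen_extChartAt_target (I := 𝓘(ℝ, E)) x₀).mem_nhds hy)).differentiableAt
    (by simp)

theorem Form.zero_mem : (0 : Form E M G k).IsSmooth ∧ (0 : Form E M G k).IsClosed := by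
  have h (x₀ : M) : (0 : Form E M G k).inChart x₀ = (0 : ℝ) • fun _ : E => 0 := by
    funext y
    ext v
    simp only [Form.inChart, zero_smul]
    rfl
  refine ⟨fun x₀ => ?_, fun x₀ y _ => ?_⟩
  · rw [h, zero_smul]
    exact contDiffOn_const
  · rw [h, extDeriv_smul, zero_smul]

theorem Form.add_mem {α β : Form E M G k} (hα : α.IsSmooth ∧ α.IsClosed)
    (hβ : β.IsSmooth ∧ β.IsClosed) : (α + β).IsSmooth ∧ (α + β).IsClosed := by
  have h (x₀ : M) : (α + β).inChart x₀ = α.inChart x₀ + β.inChart x₀ := rfl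
  refine ⟨fun x₀ => ?_, fun x₀ y hy => ?_⟩
  · rw [h]
    exact (hα.1 x₀).add (hβ.1 x₀)
  · rw [h, extDeriv_add (hα.1.differentiableAt hy) (hβ.1.differentiableAt hy), hα.2 x₀ y hy,
      hβ.2 x₀ y hy, add_zero]

theorem Form.smul_mem {𝕜 : Type*} [NormedField 𝕜] [NormedSpace 𝕜 G] [SMulCommClass ℝ 𝕜 G] (c : 𝕜)
    {α : Form E M G k} (hα : α.IsSmooth ∧ α.IsClosed) : (c • α).IsSmooth ∧ (c • α).IsClosed := by
  have h (x₀ : M) : (c • α).inChart x₀ = c • α.inChart x₀ := rfl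
  refine ⟨fun x₀ => ?_, fun x₀ y hy => ?_⟩
  · rw [h]
    exact (hα.1 x₀).const_smul c
  · have h' := hα.2 x₀ y hy
    simp only [extDeriv] at h' ⊢
    rw [h, fderiv_const_smul (hα.1.differentiableAt hy),
      ContinuousAlternatingMap.alternatizeUncurryFin_smul, h', smul_zero]

variable (E M)

/-- The space `Z¹(M)` of smooth closed real `1`-forms. -/
def closedOneForms : Submodule ℝ (Form E M ℝ 1) where
  carrier := {α | α.IsSmooth ∧ α.IsClosed}
  zero_mem' := Form.zero_mem
  add_mem' := Form.add_mem
  smul_mem' := Form.smul_mem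

/-- The space `B¹(M)` of differentials of smooth real functions. -/
def exactOneForms : Submodule ℝ (Form E M ℝ 1) where
  carrier := {α | ∃ f : M → ℝ, ContMDiff 𝓘(ℝ, E) 𝓘(ℝ, ℝ) ∞ f ∧ differential f = α}
  zero_mem' := ⟨fun _ => 0, contMDiff_const, by
    funext x; simp [differential, oneForm, mfderiv_const]; rfl⟩
  add_mem' := by
    rintro _ _ ⟨f, hf, rfl⟩ ⟨g, hg, rfl⟩
    refine ⟨f + g, hf.add hg, ?_⟩
    funext x
    simp only [differential, oneForm, Pi.add_apply]
    rw [mfderiv_add (hf.mdifferentiable (by simp) x) (hg.mdifferentiable (by simp) x)]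
    rfl
  smul_mem' := by
    rintro c _ ⟨f, hf, rfl⟩
    refine ⟨c • f, (contDiff_const_smul c).comp_contMDiff hf, ?_⟩
    funext x
    simp only [differential, oneForm, Pi.smul_apply]
    rw [const_smul_mfderiv (hf.mdifferentiable (by simp) x)]
    rfl

/-- The first de Rham cohomology `H¹(M; ℝ)`. -/
abbrev DeRhamH1 : Type _ := closedOneForms E M ⧸ (exactOneForms E M).submoduleOf (closedOneForms E M)

end Manifold

/-! ## Symplectic forms, complex vector fields, Poisson bracket -/

section Symplectic

variable (E : Type*) [NormedAddCommGroup E] [NormedSpace ℝ E]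
  (M : Type*) [TopologicalSpace M] [ChartedSpace E M]

variable {E} in
/-- The linear map `v ↦ α(v, ·)` of an alternating bilinear form `α`. -/
def interior (α : E [⋀^Fin 2]→L[ℝ] ℝ) : E →ₗ[ℝ] (E →L[ℝ] ℝ) where
  toFun v := (ContinuousAlternatingMap.ofSubsingleton ℝ E ℝ (0 : Fin 1)).symm (α.curryLeft v)
  map_add' v w := by rw [map_add]; rfl
  map_smul' c v := by rw [map_smul]; rfl

/-- A symplectic form on `M`: a smooth, closed, nondegenerate real `2`-form. -/
structure SymplecticForm where
  toForm : Form E M ℝ 2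
  smooth : toForm.IsSmooth
  closed : toForm.IsClosed
  nondegenerate : ∀ (x : M) (v : TangentSpace 𝓘(ℝ, E) x),
    (∀ w : TangentSpace 𝓘(ℝ, E) x, toForm x ![v, w] = 0) → v = 0

/-- Complex tangent vectors at `x`: the complexification of the tangent space. -/
abbrev ComplexTangent {M : Type*} [TopologicalSpace M] [ChartedSpace E M] (x : M) : Type _ :=
  ℂ ⊗[ℝ] TangentSpace 𝓘(ℝ, E) x

variable {E M}

/-- The derivative `Y(f)` of a complex valued function along a complex tangent vector `Y` at `x`,
that is, the complex linear extension of `df` evaluated at `Y`. -/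
def ComplexTangent.deriv {x : M} (Y : ComplexTangent E x) (f : M → ℂ) : ℂ :=
  let df : TangentSpace 𝓘(ℝ, E) x →L[ℝ] ℂ := mfderiv 𝓘(ℝ, E) 𝓘(ℝ, ℂ) f x
  df.toLinearMap.liftBaseChange ℂ Y

namespace SymplecticForm

variable (Ω : SymplecticForm E M)

/-- The map `v ↦ Ω(v, ·)` from tangent vectors to cotangent vectors. -/
def flat (x : M) : TangentSpace 𝓘(ℝ, E) x →ₗ[ℝ] (TangentSpace 𝓘(ℝ, E) x →L[ℝ] ℝ) :=
  interior (E := E) (Ω.toForm x)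

theorem flat_apply (x : M) (v w : TangentSpace 𝓘(ℝ, E) x) :
    Ω.flat x v w = Ω.toForm x ![v, w] := by
  change Ω.toForm x _ = _
  congr 1
  funext i
  fin_cases i <;> rfl

theorem flat_injective (x : M) : Function.Injective (Ω.flat x) := by
  rw [← LinearMap.ker_eq_bot, LinearMap.ker_eq_bot']
  intro v hv
  refine Ω.nondegenerate x v fun w => ?_
  rw [← Ω.flat_apply, hv]
  rfl

/-- The complex linear extension of `v ↦ Ω(v, ·)`. -/
def flatComplex (x : M) : ComplexTangent E x →ₗ[ℂ] (TangentSpace 𝓘(ℝ, E) x →L[ℝ] ℂ) :=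
  LinearMap.liftBaseChange ℂ
    ({ toFun := fun v => Complex.ofRealCLM.comp (Ω.flat x v)
       map_add' := fun v w => by rw [map_add]; exact ContinuousLinearMap.comp_add _ _ _
       map_smul' := fun c v => by rw [map_smul]; exact ContinuousLinearMap.comp_smul _ _ _ } :
      TangentSpace 𝓘(ℝ, E) x →ₗ[ℝ] (TangentSpace 𝓘(ℝ, E) x →L[ℝ] ℂ))

/-- The contraction `ι_Y Ω` of `Ω` with a complex vector field. -/
def contract (Y : (x : M) → ComplexTangent E x) : Form E M ℂ 1 :=
  oneForm fun x => Ω.flatComplex x (Y x)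

/-- Smooth complex symplectic vector fields: smooth vector fields `Y` (they map smooth functions to
smooth functions) such that `ι_Y Ω` is a closed `1`-form. -/
def symplecticFields : Submodule ℂ ((x : M) → ComplexTangent E x) where
  carrier := {Y | (∀ f ∈ SmoothFn E M, (fun x => (Y x).deriv f) ∈ SmoothFn E M) ∧
    (Ω.contract Y).IsSmooth ∧ (Ω.contract Y).IsClosed}
  zero_mem' := by
    have h : Ω.contract 0 = 0 := by
      funext x
      simp only [contract, oneForm, Pi.zero_apply, map_zero]
      rfl
    rw [Set.mem_ofPred_eq, h]
    refine ⟨fun f _ => ?_, Form.zero_mem⟩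
    convert (SmoothFn E M).zero_mem using 1
    funext x
    simp [ComplexTangent.deriv]
  add_mem' {Y Z} hY hZ := by
    have h : Ω.contract (Y + Z) = Ω.contract Y + Ω.contract Z := by
      funext x
      simp only [contract, oneForm, Pi.add_apply, map_add]
      rfl
    rw [Set.mem_ofPred_eq, h]
    refine ⟨fun f hf => ?_, Form.add_mem hY.2 hZ.2⟩
    convert (SmoothFn E M).add_mem (hY.1 f hf) (hZ.1 f hf) using 1
    funext x
    simp [ComplexTangent.deriv]
  smul_mem' c Y hY := by
    have h : Ω.contract (c • Y) = c • Ω.contract Y := by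
      funext x
      simp only [contract, oneForm, Pi.smul_apply, map_smul]
      rfl
    rw [Set.mem_ofPred_eq, h]
    refine ⟨fun f hf => ?_, Form.smul_mem c hY.2⟩
    convert (SmoothFn E M).smul_mem (hY.1 f hf) c using 1
    funext x
    simp [ComplexTangent.deriv]

variable [FiniteDimensional ℝ E]

/-- The isomorphism `v ↦ Ω(v, ·)` between tangent and cotangent vectors. -/
def flatEquiv (x : M) : TangentSpace 𝓘(ℝ, E) x ≃ₗ[ℝ] (TangentSpace 𝓘(ℝ, E) x →L[ℝ] ℝ) :=
  LinearEquiv.ofBijective (Ω.flat x) <| by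
    have e : E ≃ₗ[ℝ] (E →L[ℝ] ℝ) := LinearEquiv.ofFinrankEq _ _ <| by
      rw [← (LinearMap.toContinuousLinearMap (𝕜 := ℝ) (E := E) (F' := ℝ)).finrank_eq]
      exact Subspace.dual_finrank_eq.symm
    have h : Function.Injective (interior (E := E) (Ω.toForm x)) := Ω.flat_injective x
    exact (LinearMap.linearEquivOfInjective _ h e.finrank_eq).bijective

/-- The Hamiltonian vector field `X_f` of a complex valued function, determined by
`ι_{X_f} Ω = df`. -/
def hamiltonianField (f : M → ℂ) (x : M) : ComplexTangent E x :=
  let df : TangentSpace 𝓘(ℝ, E) x →L[ℝ] ℂ := mfderiv 𝓘(ℝ, E) 𝓘(ℝ, ℂ) f x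
  (1 : ℂ) ⊗ₜ[ℝ] (Ω.flatEquiv x).symm (Complex.reCLM.comp df) +
    Complex.I ⊗ₜ[ℝ] (Ω.flatEquiv x).symm (Complex.imCLM.comp df)

theorem flatComplex_hamiltonianField (f : M → ℂ) (x : M) :
    Ω.flatComplex x (Ω.hamiltonianField f x) = mfderiv 𝓘(ℝ, E) 𝓘(ℝ, ℂ) f x := by
  have h (α : TangentSpace 𝓘(ℝ, E) x →L[ℝ] ℝ) : Ω.flat x ((Ω.flatEquiv x).symm α) = α :=
    (Ω.flatEquiv x).apply_symm_apply α
  simp only [hamiltonianField, flatComplex, map_add, LinearMap.liftBaseChange_tmul,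
    LinearMap.coe_mk, AddHom.coe_mk, h, one_smul]
  apply ContinuousLinearMap.ext
  intro v
  exact (congrArg _ (mul_comm _ _)).trans (Complex.re_add_im _)

/-- The Poisson bracket `{f, g} = X_f(g)`. -/
def poisson (f g : M → ℂ) (x : M) : ℂ := (Ω.hamiltonianField f x).deriv g

end SymplecticForm

end Symplectic

/-! ## Formal functions, formal differential operators, star products -/

section Star

variable (E : Type*) [NormedAddCommGroup E] [NormedSpace ℝ E]
  (M : Type*) [TopologicalSpace M] [ChartedSpace E M]

/-- Formal functions: the `ℂ⟦h⟧`-algebra `C^∞(M)⟦h⟧`. The formal parameter `h` is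
`PowerSeries.X`. -/
abbrev FormalFn : Type _ := (SmoothFn E M)⟦X⟧

instance : IsScalarTower ℂ ℂ⟦X⟧ (FormalFn E M) where
  smul_assoc a p f := by
    have h : PowerSeries.map (algebraMap ℂ (SmoothFn E M)) (a • p)
        = a • PowerSeries.map (algebraMap ℂ (SmoothFn E M)) p := by
      ext n : 1
      rw [PowerSeries.coeff_map, PowerSeries.coeff_smul, PowerSeries.coeff_smul,
        PowerSeries.coeff_map, smul_eq_mul, map_mul, Algebra.smul_def]
    change PowerSeries.map (algebraMap ℂ (SmoothFn E M)) (a • p) * f =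
      a • (PowerSeries.map (algebraMap ℂ (SmoothFn E M)) p * f)
    rw [h, smul_mul_assoc]

instance : IsScalarTower ℝ ℂ⟦X⟧ (FormalFn E M) where
  smul_assoc a p f := by
    have h (q : FormalFn E M) : a • q = (a : ℂ) • q := by
      ext n x
      rw [PowerSeries.coeff_smul, PowerSeries.coeff_smul]
      exact Complex.real_smul
    have h' : a • p = (a : ℂ) • p := by
      ext n
      rw [PowerSeries.coeff_smul, PowerSeries.coeff_smul]
      exact Complex.real_smul
    rw [h, h', smul_assoc]

/-- `ℂ⟦h⟧`-linear operators on formal functions. -/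
abbrev FormalOp : Type _ := FormalFn E M →ₗ[ℂ⟦X⟧] FormalFn E M

variable {E M}

/-- The `h^k`-coefficient `B_k : C^∞(M) → C^∞(M)` of a formal operator `B = ∑ B_k h^k`. -/
def FormalOp.coeff (B : FormalOp E M) (k : ℕ) : SmoothFn E M →ₗ[ℂ] SmoothFn E M where
  toFun f := PowerSeries.coeff k (B (PowerSeries.C f))
  map_add' f g := by rw [map_add, map_add, map_add]
  map_smul' c f := by
    have h : (PowerSeries.C (c • f) : FormalFn E M) = (c • (1 : ℂ⟦X⟧)) • PowerSeries.C f := by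
      rw [smul_assoc, one_smul]
      ext n : 1
      rw [PowerSeries.coeff_smul, PowerSeries.coeff_C, PowerSeries.coeff_C]
      split_ifs <;> simp
    rw [h, map_smul, smul_assoc, one_smul, PowerSeries.coeff_smul, RingHom.id_apply]

/-- The commutator of an operator with the multiplication by `g`. -/
def commutatorMul (P : SmoothFn E M →ₗ[ℂ] SmoothFn E M) (g : SmoothFn E M) :
    SmoothFn E M →ₗ[ℂ] SmoothFn E M :=
  P ∘ₗ LinearMap.mulLeft ℂ g - LinearMap.mulLeft ℂ g ∘ₗ P

/-- `P` is a (linear) differential operator on `M` of order at most `k`: all `(k+1)`-fold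
commutators with multiplications by smooth functions vanish. -/
def IsDiffOp : ℕ → (SmoothFn E M →ₗ[ℂ] SmoothFn E M) → Prop
  | 0, P => ∀ g, commutatorMul P g = 0
  | k + 1, P => ∀ g, IsDiffOp k (commutatorMul P g)

/-- Natural formal differential operators: `B_k` is a differential operator of order at most `k`. -/
def FormalOp.IsNatural (B : FormalOp E M) : Prop := ∀ k, IsDiffOp k (B.coeff k)

/-- `B = 0` modulo `h`. -/
def FormalOp.VanishesModH (B : FormalOp E M) : Prop := ∀ f, PowerSeries.coeff 0 (B f) = 0

variable [FiniteDimensional ℝ E] (Ω : SymplecticForm E M)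

/-- Natural star products on the symplectic manifold `(M, Ω)`. -/
structure StarProduct where
  mul : FormalFn E M →ₗ[ℂ⟦X⟧] FormalFn E M →ₗ[ℂ⟦X⟧] FormalFn E M
  mul_assoc : ∀ f g k, mul (mul f g) k = mul f (mul g k)
  one_mul : ∀ f, mul 1 f = f
  mul_one : ∀ f, mul f 1 = f
  coeff_zero : ∀ f g : SmoothFn E M,
    PowerSeries.coeff 0 (mul (PowerSeries.C f) (PowerSeries.C g)) = f * g
  coeff_one : ∀ (f g : SmoothFn E M) (x : M),
    (PowerSeries.coeff 1 (mul (PowerSeries.C f) (PowerSeries.C g)) -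
      PowerSeries.coeff 1 (mul (PowerSeries.C g) (PowerSeries.C f)) : SmoothFn E M).1 x
      = Complex.I * Ω.poisson f g x
  natural : ∀ f : SmoothFn E M, FormalOp.IsNatural (mul (PowerSeries.C f)) ∧
    FormalOp.IsNatural (mul.flip (PowerSeries.C f))

variable {Ω}

/-- `Der₀(M, ⋆)`: the (`ℂ⟦h⟧`-linear) derivations of a star product that vanish modulo `h`. -/
def StarProduct.derivations (S : StarProduct Ω) : Submodule ℂ (FormalOp E M) where
  carrier := {B | (∀ f g, B (S.mul f g) = S.mul (B f) g + S.mul f (B g)) ∧ B.VanishesModH}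
  zero_mem' := ⟨fun f g => by simp, fun f => by simp⟩
  add_mem' {A B} hA hB := ⟨fun f g => by
    simp only [LinearMap.add_apply, hA.1, hB.1, map_add]
    abel, fun f => by
    rw [LinearMap.add_apply, map_add, hA.2, hB.2, add_zero]⟩
  smul_mem' c A hA := ⟨fun f g => by
    have h (p : FormalFn E M) : c • p = (c • (1 : ℂ⟦X⟧)) • p := by rw [smul_assoc, one_smul]
    simp only [LinearMap.smul_apply, hA.1, h, map_smul, smul_add], fun f => by
    rw [LinearMap.smul_apply, PowerSeries.coeff_smul, hA.2, smul_zero]⟩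

instance (S : StarProduct Ω) : AddCommGroup S.derivations :=
  @Submodule.addCommGroup ℂ (FormalOp E M) _ _ _ S.derivations

variable (Ω)

/-- `h Γ_sym(M)⟦h⟧`: formal symplectic vector fields `∑ Y_k h^k` with `Y_0 = 0`. -/
def formalSymplecticFields : Submodule ℂ (ℕ → Ω.symplecticFields) where
  carrier := {Y | Y 0 = 0}
  zero_mem' := rfl
  add_mem' {Y Z} hY hZ := by
    rw [Set.mem_ofPred_eq] at hY hZ ⊢
    rw [Pi.add_apply, hY, hZ, add_zero]
  smul_mem' c Y hY := by
    rw [Set.mem_ofPred_eq] at hY ⊢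
    rw [Pi.smul_apply, hY, smul_zero]

variable {Ω}

/-- On `U`, the formal vector field `Y` is the Hamiltonian vector field of the formal
function `b`. -/
def IsHamiltonianOn (Y : ℕ → Ω.symplecticFields) (b : FormalFn E M) (U : Set M) : Prop :=
  ∀ k, ∀ x ∈ U, (Y k).1 x = Ω.hamiltonianField (PowerSeries.coeff k b : SmoothFn E M).1 x

/-- The operator `B` corresponds to the formal symplectic vector field `Y`: wherever
`Y = X_b`, one has `B(f) = h⁻¹ (b ⋆ f - f ⋆ b)`; and locally there are such `b`. -/
def StarProduct.Corresponds (S : StarProduct Ω) (B : FormalOp E M)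
    (Y : ℕ → Ω.symplecticFields) : Prop :=
  (∀ x : M, ∃ U : Set M, IsOpen U ∧ x ∈ U ∧ ∃ b, IsHamiltonianOn Y b U) ∧
  ∀ (U : Set M) (b : FormalFn E M), IsOpen U → IsHamiltonianOn Y b U →
    ∀ (f : FormalFn E M) (k : ℕ), ∀ x ∈ U,
      (PowerSeries.coeff k (PowerSeries.X * B f) : SmoothFn E M).1 x =
        (PowerSeries.coeff k (S.mul b f - S.mul f b) : SmoothFn E M).1 x

variable (E M)

/-- Formal functions modulo constants, `C^∞(M)⟦h⟧ / ℂ⟦h⟧`. -/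
abbrev FormalFnModConst : Type _ :=
  FormalFn E M ⧸ LinearMap.range (Algebra.linearMap ℂ⟦X⟧ (FormalFn E M))

/-- The multiples of `h` among the formal functions modulo constants. -/
abbrev hFormalFnModConst : Submodule ℂ⟦X⟧ (FormalFnModConst E M) :=
  LinearMap.range (LinearMap.lsmul ℂ⟦X⟧ (FormalFnModConst E M) PowerSeries.X)

end Star

/-! ## Families of star products, formal connections, one-forms on the parameter space -/

section Connections

variable (E : Type*) [NormedAddCommGroup E] [NormedSpace ℝ E]
  (M : Type*) [TopologicalSpace M] [ChartedSpace E M]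
  (F : Type*) [NormedAddCommGroup F] [NormedSpace ℝ F]
  (T : Type*) [TopologicalSpace T] [ChartedSpace F T]

/-- Smooth sections of the trivial bundle `T × C^∞(M)⟦h⟧ → T`: families of formal functions whose
coefficients are smooth on `T × M`. -/
def Sections : Submodule ℂ (T → FormalFn E M) where
  carrier := {f | ∀ k, ContMDiff (𝓘(ℝ, F).prod 𝓘(ℝ, E)) 𝓘(ℝ, ℂ) ∞
    (fun p : T × M => (PowerSeries.coeff k (f p.1) : SmoothFn E M).1 p.2)}
  zero_mem' _ := contMDiff_const
  add_mem' hf hg k := (hf k).add (hg k)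
  smul_mem' c _ hf k := (contDiff_const_smul c).comp_contMDiff (hf k)

variable [IsManifold 𝓘(ℝ, E) ∞ M] [IsManifold 𝓘(ℝ, F) ∞ T]

/-- Smooth vector fields on `T`. -/
abbrev VectorFields : Type _ := Cₛ^∞⟮𝓘(ℝ, F); F, (TangentSpace 𝓘(ℝ, F) : T → Type _)⟯

/-- Pointwise linear `1`-forms on `T` with values in the vector spaces `N σ`, without regularity. -/
abbrev RawOneForm (N : T → Type*) [∀ σ, AddCommMonoid (N σ)] [∀ σ, Module ℝ (N σ)] : Type _ :=
  (σ : T) → TangentSpace 𝓘(ℝ, F) σ →ₗ[ℝ] N σ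

variable {E M F T}

theorem contMDiff_alongDeriv (V : VectorFields F T) {g : T × M → ℂ}
    (hg : ContMDiff (𝓘(ℝ, F).prod 𝓘(ℝ, E)) 𝓘(ℝ, ℂ) ∞ g) :
    ContMDiff (𝓘(ℝ, F).prod 𝓘(ℝ, E)) 𝓘(ℝ, ℂ) ∞
      (fun p : T × M => (mfderiv 𝓘(ℝ, F) 𝓘(ℝ, ℂ) (fun τ => g (τ, p.2)) p.1 (V p.1) : ℂ)) := by
  have hV : ContMDiff (𝓘(ℝ, F).prod 𝓘(ℝ, E)) (𝓘(ℝ, F).prod 𝓘(ℝ, E)).tangent ∞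
      (fun p : T × M => (equivTangentBundleProd 𝓘(ℝ, F) T 𝓘(ℝ, E) M).symm
        ((⟨p.1, V p.1⟩ : TangentBundle 𝓘(ℝ, F) T),
          Bundle.zeroSection E (TangentSpace 𝓘(ℝ, E) : M → Type _) p.2)) :=
    contMDiff_equivTangentBundleProd_symm.comp
      ((V.contMDiff.comp contMDiff_fst).prodMk
        ((Bundle.contMDiff_zeroSection ℝ (TangentSpace 𝓘(ℝ, E) : M → Type _)).comp contMDiff_snd))
  have h := (contMDiff_snd_tangentBundle_modelSpace ℂ 𝓘(ℝ, ℂ) (n := ∞)).comp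
    ((hg.contMDiff_tangentMap (m := ∞) (by simp)).comp hV)
  refine h.congr fun p => ?_
  have h1 : mfderiv 𝓘(ℝ, F) 𝓘(ℝ, ℂ) (fun τ => g (τ, p.2)) p.1 =
      (mfderiv (𝓘(ℝ, F).prod 𝓘(ℝ, E)) 𝓘(ℝ, ℂ) g p).comp
        (mfderiv 𝓘(ℝ, F) (𝓘(ℝ, F).prod 𝓘(ℝ, E)) (fun τ => (τ, p.2)) p.1) :=
    mfderiv_comp (I' := 𝓘(ℝ, F).prod 𝓘(ℝ, E)) p.1 (g := g) (f := fun τ => (τ, p.2))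
      (hg.mdifferentiable (by simp) _)
      (mdifferentiableAt_id.prodMk mdifferentiableAt_const)
  rw [h1, mfderiv_prod_left]
  rfl

/-- The derivative `V[f]` of a section along a vector field on `T`, coefficient by coefficient and
at each point of `M`. -/
def alongDeriv (V : VectorFields F T) (f : Sections E M F T) : Sections E M F T :=
  ⟨fun σ => PowerSeries.mk fun k =>
    ⟨fun x => mfderiv 𝓘(ℝ, F) 𝓘(ℝ, ℂ)
      (fun τ : T => (PowerSeries.coeff k (f.1 τ) : SmoothFn E M).1 x) σ (V σ),
      (contMDiff_alongDeriv V (f.2 k)).comp (contMDiff_const.prodMk contMDiff_id)⟩,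
    fun k => by
      simp only [PowerSeries.coeff_mk]
      exact contMDiff_alongDeriv V (f.2 k)⟩

/-- A `1`-form on `T` with values in formal operators is smooth if it maps smooth vector fields and
smooth sections to smooth sections. -/
def IsSmoothOperatorForm (A : RawOneForm F T fun _ => FormalOp E M) : Prop :=
  ∀ (V : VectorFields F T) (f : Sections E M F T), (fun σ => A σ (V σ) (f.1 σ)) ∈ Sections E M F T

/-- Operators `(V, f) ↦ D_V f` from vector fields and sections to sections. -/
abbrev CovariantOp (E M F T : Type*) [NormedAddCommGroup E] [NormedSpace ℝ E]
    [TopologicalSpace M] [ChartedSpace E M] [NormedAddCommGroup F] [NormedSpace ℝ F]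
    [TopologicalSpace T] [ChartedSpace F T] [IsManifold 𝓘(ℝ, F) ∞ T] : Type _ :=
  VectorFields F T → Sections E M F T → Sections E M F T

/-- The operator `(V, f) ↦ A(V)(f)` of a smooth operator valued `1`-form. -/
def IsSmoothOperatorForm.toOp {A : RawOneForm F T fun _ => FormalOp E M}
    (hA : IsSmoothOperatorForm A) : CovariantOp E M F T :=
  fun V f => ⟨fun σ => A σ (V σ) (f.1 σ), hA V f⟩

/-- Formal connections `D_V f = V[f] + A(V)(f)`, with `A` a smooth `1`-form on `T` with values in
natural formal differential operators and `A = 0` modulo `h`. -/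
def IsFormalConnection (D : CovariantOp E M F T) : Prop :=
  ∃ (A : RawOneForm F T fun _ => FormalOp E M) (hA : IsSmoothOperatorForm A),
    (∀ σ v, FormalOp.IsNatural (A σ v) ∧ FormalOp.VanishesModH (A σ v)) ∧
    ∀ V f, D V f = alongDeriv V f + hA.toOp V f

variable [FiniteDimensional ℝ E]

variable (F T) in
/-- Smooth families of natural star products on `(M, Ω)` parametrized by `T`: the product of smooth
sections is a smooth section. -/
structure StarFamily (Ω : SymplecticForm E M) where
  star : T → StarProduct Ω
  smooth : ∀ f g : Sections E M F T, (fun σ => (star σ).mul (f.1 σ) (g.1 σ)) ∈ Sections E M F T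

namespace StarFamily

variable {Ω : SymplecticForm E M} (S : StarFamily F T Ω)

/-- The product `f ⋆ g` of sections. -/
def mul (f g : Sections E M F T) : Sections E M F T := ⟨_, S.smooth f g⟩

/-- The space `ℱ(M, ⋆_σ)` of formal connections that are compatible with the family. -/
def compatibleConnections : Set (CovariantOp E M F T) :=
  {D | IsFormalConnection D ∧
    ∀ V f g, D V (S.mul f g) = S.mul (D V f) g + S.mul f (D V g)}

/-- `Ω¹(T, Der₀(M, ⋆_σ))`: smooth `1`-forms on `T` with values at `σ` in the derivations of `⋆_σ`
that vanish modulo `h`. -/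
def derivationForms : Submodule ℂ (RawOneForm F T fun σ => (S.star σ).derivations) where
  carrier := {β | IsSmoothOperatorForm fun σ => ((S.star σ).derivations.subtype.restrictScalars ℝ) ∘ₗ β σ}
  zero_mem' _ _ := (Sections E M F T).zero_mem
  add_mem' hα hβ V f := (Sections E M F T).add_mem (hα V f) (hβ V f)
  smul_mem' c _ hα V f := (Sections E M F T).smul_mem c (hα V f)

/-- The operator `(V, f) ↦ β(V)(f)` of a `1`-form with values in derivations. -/
def toOp (β : S.derivationForms) : CovariantOp E M F T :=
  IsSmoothOperatorForm.toOp β.2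

end StarFamily

variable (F T) in
/-- `Ω¹(T, h Γ_sym(M)⟦h⟧)`: smooth `1`-forms on `T` with values in the formal symplectic vector
fields that vanish modulo `h`. Smoothness means that the coefficients of `Y(V)` map smooth functions
on `M` to smooth functions on `T × M`, for every smooth vector field `V`. -/
def symplecticForms (Ω : SymplecticForm E M) :
    Submodule ℂ (RawOneForm F T fun _ => formalSymplecticFields Ω) where
  carrier := {Y | ∀ (V : VectorFields F T) (f : SmoothFn E M) (k : ℕ),
    ContMDiff (𝓘(ℝ, F).prod 𝓘(ℝ, E)) 𝓘(ℝ, ℂ) ∞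
      (fun p : T × M => (((Y p.1 (V p.1)).1 k).1 p.2).deriv f.1)}
  zero_mem' V f k := by
    convert (contMDiff_const (c := (0 : ℂ))) using 1
    funext p
    exact map_zero (LinearMap.liftBaseChange ℂ _)
  add_mem' {Y Z} hY hZ V f k := by
    convert (hY V f k).add (hZ V f k) using 1
    funext p
    exact map_add (LinearMap.liftBaseChange ℂ _) _ _
  smul_mem' c Y hY V f k := by
    convert (contDiff_const_smul c).comp_contMDiff (hY V f k) using 1
    funext p
    exact map_smul (LinearMap.liftBaseChange ℂ _) _ _

variable (E M F T) in
/-- `Ω¹(T, h C^∞(M)⟦h⟧ / ℂ⟦h⟧)`: smooth `1`-forms on `T` with values in formal functions modulo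
constants that are multiples of `h`. Smoothness means that `β(V)` lifts to a smooth section of
`T × C^∞(M)⟦h⟧` for every smooth vector field `V`. -/
def functionForms : Submodule ℂ (RawOneForm F T fun _ => hFormalFnModConst E M) where
  carrier := {β | ∀ V : VectorFields F T, ∃ g : Sections E M F T,
    ∀ σ, (β σ (V σ)).1 = Submodule.Quotient.mk (g.1 σ)}
  zero_mem' _ := ⟨0, fun _ => rfl⟩
  add_mem' {α β} hα hβ V := by
    obtain ⟨f, hf⟩ := hα V
    obtain ⟨g, hg⟩ := hβ V
    exact ⟨f + g, fun σ => congrArg₂ (· + ·) (hf σ) (hg σ)⟩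
  smul_mem' c α hα V := by
    obtain ⟨f, hf⟩ := hα V
    exact ⟨c • f, fun σ => congrArg (c • ·) (hf σ)⟩

end Connections
end FormalConnections
end

/-!
Two compatible connections differ by a `C^∞`-linear operator-valued one-form with values in the
derivations of the star products. Conversely, adding such a form to a compatible connection gives
an operator satisfying the Leibniz rule, and what has to be seen is that derivations of a natural
star product are natural themselves.

Every derivation vanishing modulo `h` is locally of the form `h⁻¹ (b ⋆ · - · ⋆ b)`: its leading
coefficient is a derivation of `C^∞(M)`, hence a vector field, and it preserves the Poisson bracket,
hence is symplectic and locally Hamiltonian. The quasi-inner derivations of the local Hamiltonians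
do not depend on their additive constants, so they glue; subtracting them raises the power of `h`,
and the correspondence follows by induction on this power.

Smooth dependence on the parameter is preserved because the local Hamiltonians can be chosen as
integrals along segments in a chart. When `M` is connected and `H¹(M; ℝ) = 0`, the Hamiltonians are
global and unique up to constants; normalizing them to vanish at a point makes them smooth in the
parameter.
-/

open scoped Manifold ContDiff TensorProduct PowerSeries

noncomputable section

namespace FormalConnections

section ParametricIntegral

open Set MeasureTheory

theorem continuousOn_prodMk_of_prod_subset {X Y Z : Type*} [TopologicalSpace X]
    [TopologicalSpace Y] [TopologicalSpace Z] {s : Set X} {t : Set Y} {O : Set (X × Y)}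
    {φ : X × Y → Z} (hφ : ContinuousOn φ O) (hstO : s ×ˢ t ⊆ O) {x : X} (hx : x ∈ s) :
    ContinuousOn (fun y => φ (x, y)) t :=
  hφ.comp (by fun_prop) fun _ hy => hstO ⟨hx, hy⟩

variable {P : Type*} [NormedAddCommGroup P] [NormedSpace ℝ P]
  {G : Type*} [NormedAddCommGroup G] [NormedSpace ℝ G]
  {s : Set P} {O : Set (P × ℝ)} {φ : P × ℝ → G} {a b : ℝ} {p : P}

theorem continuousOn_fderiv_comp_inl (hO : IsOpen O) (hφ : ContDiffOn ℝ 1 φ O) :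
    ContinuousOn (fun z => (fderiv ℝ φ z).comp (.inl ℝ P ℝ)) O :=
  (hφ.continuousOn_fderiv_of_isOpen hO le_rfl).clm_comp continuousOn_const

theorem hasFDerivAt_intervalIntegral_of_contDiffOn [FiniteDimensional ℝ P] (hs : IsOpen s)
    (hO : IsOpen O) (hsO : s ×ˢ uIcc a b ⊆ O) (hφ : ContDiffOn ℝ 1 φ O) (hp : p ∈ s) :
    HasFDerivAt (fun q => ∫ t in a..b, φ (q, t))
      (∫ t in a..b, (fderiv ℝ φ (p, t)).comp (.inl ℝ P ℝ)) p := by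
  obtain ⟨ε, hε, hεs⟩ := Metric.nhds_basis_closedBall.mem_iff.1 (hs.mem_nhds hp)
  have hsub : Metric.closedBall p ε ×ˢ uIcc a b ⊆ O := (prod_mono_left hεs).trans hsO
  have hφ' := continuousOn_fderiv_comp_inl hO hφ
  obtain ⟨C, hC⟩ := ((isCompact_closedBall p ε).prod isCompact_uIcc).exists_bound_of_continuousOn
    (hφ'.mono hsub)
  have hint {q : P} (hq : q ∈ s) : IntervalIntegrable (fun t => φ (q, t)) volume a b :=
    (continuousOn_prodMk_of_prod_subset hφ.continuousOn hsO hq).intervalIntegrable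
  have hint' : IntervalIntegrable (fun t => (fderiv ℝ φ (p, t)).comp (.inl ℝ P ℝ)) volume a b :=
    (continuousOn_prodMk_of_prod_subset hφ' hsO hp).intervalIntegrable
  have hball {q : P} {t : ℝ} (hq : q ∈ Metric.ball p ε) (ht : t ∈ uIoc a b) :
      (q, t) ∈ Metric.closedBall p ε ×ˢ uIcc a b :=
    ⟨Metric.ball_subset_closedBall hq, uIoc_subset_uIcc ht⟩
  refine intervalIntegral.hasFDerivAt_integral_of_dominated_of_fderiv_le
    (F := fun q t => φ (q, t)) (F' := fun q t => (fderiv ℝ φ (q, t)).comp (.inl ℝ P ℝ))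
    (Metric.ball_mem_nhds p hε) ?_ (hint hp) (intervalIntegrable_iff.1 hint').aestronglyMeasurable
    (.of_forall fun t ht q hq => hC (q, t) (hball hq ht)) intervalIntegrable_const
    (.of_forall fun t ht q hq => ?_)
  · filter_upwards [hs.mem_nhds hp] with q hq
    exact (intervalIntegrable_iff.1 (hint hq)).aestronglyMeasurable
  · have hd : HasFDerivAt φ (fderiv ℝ φ (q, t)) (q, t) :=
      ((hφ.contDiffAt (hO.mem_nhds (hsub (hball hq ht)))).differentiableAt one_ne_zero).hasFDerivAt
    exact hd.comp q (hasFDerivAt_prodMk_left q t)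

theorem contDiffOn_intervalIntegral [FiniteDimensional ℝ P] (hs : IsOpen s)
    (hO : IsOpen O) (hsO : s ×ˢ uIcc a b ⊆ O) (hφ : ContDiffOn ℝ ∞ φ O) :
    ContDiffOn ℝ ∞ (fun q => ∫ t in a..b, φ (q, t)) s := by
  rw [contDiffOn_infty]
  intro n
  induction n generalizing φ with
  | zero =>
    exact contDiffOn_zero.2 fun p hp => (hasFDerivAt_intervalIntegral_of_contDiffOn hs hO hsO
      (hφ.of_le (mod_cast le_top)) hp).continuousAt.continuousWithinAt
  | succ n ih =>
    have hφ₁ : ContDiffOn ℝ 1 φ O := hφ.of_le (mod_cast le_top)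
    have hderiv {p : P} (hp : p ∈ s) := hasFDerivAt_intervalIntegral_of_contDiffOn hs hO hsO hφ₁ hp
    refine contDiffOn_succ_of_fderiv_apply (n := (n : ℕ))
      (fun p hp => (hderiv hp).differentiableAt.differentiableWithinAt) nofun fun v => ?_
    have hv : ContDiffOn ℝ ∞ (fun z => fderiv ℝ φ z (v, 0)) O :=
      (hφ.fderiv_of_isOpen hO (m := ∞) (by simp)).clm_apply contDiffOn_const
    refine (ih hv).congr fun p hp => ?_
    rw [(hderiv hp).hasFDerivWithinAt.fderivWithin (hs.uniqueDiffOn p hp),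
      ContinuousLinearMap.intervalIntegral_apply (continuousOn_prodMk_of_prod_subset
        (continuousOn_fderiv_comp_inl hO hφ₁) hsO hp).intervalIntegrable]
    rfl

theorem contDiffOn_intervalIntegral_comp [FiniteDimensional ℝ P] (hs : IsOpen s)
    {Q : Type*} [NormedAddCommGroup Q] [NormedSpace ℝ Q] {r : Set Q} (hr : IsOpen r)
    {ψ : Q → G} (hψ : ContDiffOn ℝ ∞ ψ r) {h : P × ℝ → Q} (hh : ContDiff ℝ ∞ h)
    (hmaps : MapsTo h (s ×ˢ uIcc a b) r) :
    ContDiffOn ℝ ∞ (fun p => ∫ t in a..b, ψ (h (p, t))) s :=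
  contDiffOn_intervalIntegral hs (hr.preimage hh.continuous) hmaps
    (φ := ψ ∘ h) (hψ.comp hh.contDiffOn fun _ hz => hz)

theorem sub_eq_intervalIntegral_of_hasFDerivAt [CompleteSpace G] (hs : Convex ℝ s)
    {g : P → G} {α : P → P →L[ℝ] G} (hα : ContinuousOn α s)
    (hg : ∀ p ∈ s, HasFDerivAt g (α p) p) {p q : P} (hp : p ∈ s) (hq : q ∈ s) :
    g q - g p = ∫ t in (0 : ℝ)..1, α (p + t • (q - p)) (q - p) := by
  have hmem : ∀ t ∈ uIcc (0 : ℝ) 1, p + t • (q - p) ∈ s := fun t ht =>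
    hs.add_smul_sub_mem hp hq (by rwa [uIcc_of_le zero_le_one] at ht)
  have hc : ContinuousOn (fun t : ℝ => α (p + t • (q - p)) (q - p)) (uIcc 0 1) :=
    (hα.comp (f := fun t : ℝ => p + t • (q - p)) (by fun_prop) hmem).clm_apply continuousOn_const
  have hd (t : ℝ) (ht : t ∈ uIcc (0 : ℝ) 1) : HasDerivAt (fun t : ℝ => g (p + t • (q - p)))
      (α (p + t • (q - p)) (q - p)) t :=
    (hg _ (hmem t ht)).comp_hasDerivAt t
      (by simpa using ((hasDerivAt_id t).smul_const (q - p)).const_add p)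
  rw [intervalIntegral.integral_eq_sub_of_hasDerivAt hd hc.intervalIntegrable]
  simp

theorem exists_hadamard_expansion_of_convex [CompleteSpace G] [FiniteDimensional ℝ P]
    {ι : Type*} [Fintype ι] (b : Module.Basis ι ℝ P) (hs : IsOpen s) (hconv : Convex ℝ s)
    {f : P → G} (hf : ContDiffOn ℝ ∞ f s) {p : P} (hp : p ∈ s) :
    ∃ g : ι → P → G, (∀ i, ContDiffOn ℝ ∞ (g i) s) ∧
      ∀ q ∈ s, f q = f p + ∑ i, b.coord i (q - p) • g i q := by
  have hderiv (i : ι) : ContDiffOn ℝ ∞ (fun q => fderiv ℝ f q (b i)) s :=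
    (hf.fderiv_of_isOpen hs (m := ∞) (by simp)).clm_apply contDiffOn_const
  have hmaps : MapsTo (fun z : P × ℝ => p + z.2 • (z.1 - p)) (s ×ˢ uIcc 0 1) s := fun z hz =>
    hconv.add_smul_sub_mem hp hz.1 (by simpa only [uIcc_of_le zero_le_one] using hz.2)
  have hint {q : P} (hq : q ∈ s) (i : ι) :
      IntervalIntegrable (fun t : ℝ => fderiv ℝ f (p + t • (q - p)) (b i)) volume 0 1 :=
    ((hderiv i).continuousOn.comp (f := fun t : ℝ => p + t • (q - p)) (by fun_prop)
      fun _ ht => hmaps (mk_mem_prod hq ht)).intervalIntegrable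
  refine ⟨fun i q => ∫ t in (0 : ℝ)..1, fderiv ℝ f (p + t • (q - p)) (b i),
    fun i => contDiffOn_intervalIntegral_comp hs hs (hderiv i) (by fun_prop) hmaps,
    fun q hq => ?_⟩
  rw [← sub_eq_iff_eq_add', sub_eq_intervalIntegral_of_hasFDerivAt hconv
    (hf.continuousOn_fderiv_of_isOpen hs (by simp)) (fun z hz =>
      ((hf.contDiffAt (hs.mem_nhds hz)).differentiableAt (by simp)).hasFDerivAt) hp hq]
  have hbasis (L : P →L[ℝ] G) : L (q - p) = ∑ i, b.coord i (q - p) • L (b i) := by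
    conv_lhs => rw [← b.sum_repr (q - p), map_sum]
    simp only [map_smul, Module.Basis.coord_apply]
  simp only [hbasis, ← intervalIntegral.integral_smul]
  exact intervalIntegral.integral_finsetSum fun i _ => (hint hq i).smul _

end ParametricIntegral

/-! ## One-forms in charts -/

section Charts

variable {E : Type*} [NormedAddCommGroup E] [NormedSpace ℝ E]
  {M : Type*} [TopologicalSpace M] [ChartedSpace E M]
  {G : Type*} [NormedAddCommGroup G] [NormedSpace ℝ G]

/-- The derivative of the inverse of the preferred chart at `x₀`; its values at the vectors of a
basis of `E` are the coordinate vector fields of the chart. -/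
def chartDeriv (x₀ : M) (y : E) :
    E →L[ℝ] TangentSpace 𝓘(ℝ, E) ((extChartAt 𝓘(ℝ, E) x₀).symm y) :=
  mfderiv 𝓘(ℝ, E) 𝓘(ℝ, E) (extChartAt 𝓘(ℝ, E) x₀).symm y

/-- A field of linear functionals on the tangent spaces, read in the preferred chart at `x₀`. -/
def localForm (α : (x : M) → TangentSpace 𝓘(ℝ, E) x →L[ℝ] G) (x₀ : M) (y : E) : E →L[ℝ] G :=
  (α ((extChartAt 𝓘(ℝ, E) x₀).symm y)).comp (chartDeriv x₀ y)

theorem isSmooth_oneForm_iff (α : (x : M) → TangentSpace 𝓘(ℝ, E) x →L[ℝ] G) :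
    (oneForm α).IsSmooth ↔
      ∀ x₀, ContDiffOn ℝ ∞ (localForm α x₀) (extChartAt 𝓘(ℝ, E) x₀).target := by
  refine forall_congr' fun x₀ => ?_
  let e : (E →L[ℝ] G) ≃L[ℝ] (E [⋀^Fin 1]→L[ℝ] G) :=
    (ContinuousAlternatingMap.ofSubsingletonLIE (𝕜 := ℝ) (E := E) (F := G)
      (0 : Fin 1)).toContinuousLinearEquiv
  exact e.comp_contDiffOn_iff (E := E) (f := localForm α x₀)

theorem differentiableAt_localForm {α : (x : M) → TangentSpace 𝓘(ℝ, E) x →L[ℝ] G}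
    (hα : (oneForm α).IsSmooth) {x₀ : M} {y : E} (hy : y ∈ (extChartAt 𝓘(ℝ, E) x₀).target) :
    DifferentiableAt ℝ (localForm α x₀) y :=
  (((isSmooth_oneForm_iff α).1 hα x₀).contDiffAt
    ((isOpen_extChartAt_target (I := 𝓘(ℝ, E)) x₀).mem_nhds hy)).differentiableAt (by simp)

theorem extDeriv_inChart_oneForm {α : (x : M) → TangentSpace 𝓘(ℝ, E) x →L[ℝ] G}
    (hα : (oneForm α).IsSmooth) {x₀ : M} {y : E} (hy : y ∈ (extChartAt 𝓘(ℝ, E) x₀).target)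
    (v w : E) : extDeriv ((oneForm α).inChart x₀) y ![v, w] =
      fderiv ℝ (localForm α x₀) y v w - fderiv ℝ (localForm α x₀) y w v := by
  have hd := differentiableAt_localForm hα hy
  have hval (u : E) (i : Fin 2) (hu : (i.removeNth ![v, w]) = fun _ => u) :
      (fun x => ((oneForm α).inChart x₀ x) (i.removeNth ![v, w])) =
        fun x => localForm α x₀ x u := by
    rw [hu]; rfl
  have hderiv (u : E) : fderiv ℝ (fun x => localForm α x₀ x u) y =
      (fderiv ℝ (localForm α x₀) y).flip u := by
    ext z
    rw [fderiv_clm_apply hd (differentiableAt_const u)]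
    simp
  rw [extDeriv_apply (hα.differentiableAt hy), Fin.sum_univ_two,
    hval w 0 (by ext i; fin_cases i; rfl), hval v 1 (by ext i; fin_cases i; rfl), hderiv, hderiv]
  simp [sub_eq_add_neg]

theorem isClosed_oneForm_iff {α : (x : M) → TangentSpace 𝓘(ℝ, E) x →L[ℝ] G}
    (hα : (oneForm α).IsSmooth) :
    (oneForm α).IsClosed ↔ ∀ x₀, ∀ y ∈ (extChartAt 𝓘(ℝ, E) x₀).target, ∀ v w,
      fderiv ℝ (localForm α x₀) y v w = fderiv ℝ (localForm α x₀) y w v := by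
  refine forall_congr' fun x₀ => forall₂_congr fun y hy => ⟨fun h v w => ?_, fun h => ?_⟩
  · rw [← sub_eq_zero, ← extDeriv_inChart_oneForm hα hy, h]
    rfl
  · ext v
    rw [show v = ![v 0, v 1] from by ext i; fin_cases i <;> rfl, extDeriv_inChart_oneForm hα hy, h,
      sub_self]
    rfl

/-- The coordinate ball of radius `r` around `x₀`: the part of the domain of the preferred chart at
`x₀` that the chart maps into a ball. Its image is the whole ball only if the ball is contained in
the target of the chart, which the lemmas assume where it matters. -/
def chartBall (x₀ : M) (r : ℝ) : Set M :=
  (extChartAt 𝓘(ℝ, E) x₀).source ∩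
    extChartAt 𝓘(ℝ, E) x₀ ⁻¹' Metric.ball (extChartAt 𝓘(ℝ, E) x₀ x₀) r

theorem isOpen_chartBall (x₀ : M) (r : ℝ) : IsOpen (chartBall (E := E) x₀ r) := by
  rw [chartBall, extChartAt_source]
  exact isOpen_extChartAt_preimage x₀ Metric.isOpen_ball

theorem mem_chartBall (x₀ : M) {r : ℝ} (hr : 0 < r) : x₀ ∈ chartBall (E := E) x₀ r :=
  ⟨mem_extChartAt_source x₀, Metric.mem_ball_self hr⟩

theorem chartBall_mono (x₀ : M) {r r' : ℝ} (h : r ≤ r') :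
    chartBall (E := E) x₀ r ⊆ chartBall (E := E) x₀ r' :=
  fun _ hx => ⟨hx.1, Metric.ball_subset_ball h hx.2⟩

theorem extChartAt_symm_mem_chartBall {x₀ : M} {r : ℝ} {y : E}
    (hr : Metric.ball (extChartAt 𝓘(ℝ, E) x₀ x₀) r ⊆ (extChartAt 𝓘(ℝ, E) x₀).target)
    (hy : y ∈ Metric.ball (extChartAt 𝓘(ℝ, E) x₀ x₀) r) :
    (extChartAt 𝓘(ℝ, E) x₀).symm y ∈ chartBall (E := E) x₀ r := by
  refine ⟨(extChartAt 𝓘(ℝ, E) x₀).map_target (hr hy), ?_⟩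
  rwa [Set.mem_preimage, (extChartAt 𝓘(ℝ, E) x₀).right_inv (hr hy)]

theorem exists_chartBall_subset {x₀ : M} {U : Set M} (hU : U ∈ nhds x₀) :
    ∃ r > 0, Metric.ball (extChartAt 𝓘(ℝ, E) x₀ x₀) r ⊆ (extChartAt 𝓘(ℝ, E) x₀).target ∧
      chartBall (E := E) x₀ r ⊆ U := by
  have hpre : (extChartAt 𝓘(ℝ, E) x₀).target ∩ (extChartAt 𝓘(ℝ, E) x₀).symm ⁻¹' U ∈
      nhds (extChartAt 𝓘(ℝ, E) x₀ x₀) := by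
    refine Filter.inter_mem (extChartAt_target_mem_nhds x₀) ?_
    refine (continuousAt_extChartAt_symm x₀).preimage_mem_nhds ?_
    rwa [extChartAt_to_inv]
  obtain ⟨r, hr, h⟩ := Metric.mem_nhds_iff.1 hpre
  refine ⟨r, hr, h.trans Set.inter_subset_left, fun x hx => ?_⟩
  simpa only [Set.mem_preimage, (extChartAt 𝓘(ℝ, E) x₀).left_inv hx.1] using (h hx.2).2

variable [IsManifold 𝓘(ℝ, E) ∞ M]

theorem isInvertible_chartDeriv {x₀ : M} {y : E} (hy : y ∈ (extChartAt 𝓘(ℝ, E) x₀).target) :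
    ∃ e : E ≃L[ℝ] TangentSpace 𝓘(ℝ, E) ((extChartAt 𝓘(ℝ, E) x₀).symm y),
      (e : E →L[ℝ] TangentSpace 𝓘(ℝ, E) ((extChartAt 𝓘(ℝ, E) x₀).symm y)) = chartDeriv x₀ y := by
  have : IsManifold 𝓘(ℝ, E) 1 M := IsManifold.of_le (n := ∞) (by simp)
  have h := isInvertible_mfderivWithin_extChartAt_symm (I := 𝓘(ℝ, E)) hy
  rw [ModelWithCorners.range_eq_univ, mfderivWithin_univ] at h
  exact h

theorem mdifferentiableAt_extChartAt_symm {x₀ : M} {y : E}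
    (hy : y ∈ (extChartAt 𝓘(ℝ, E) x₀).target) :
    MDifferentiableAt 𝓘(ℝ, E) 𝓘(ℝ, E) (extChartAt 𝓘(ℝ, E) x₀).symm y := by
  have : IsManifold 𝓘(ℝ, E) 1 M := IsManifold.of_le (n := ∞) (by simp)
  have h := mdifferentiableWithinAt_extChartAt_symm (I := 𝓘(ℝ, E)) hy
  rwa [ModelWithCorners.range_eq_univ, mdifferentiableWithinAt_univ] at h

theorem hasFDerivAt_comp_extChartAt_symm {f : M → G} {x₀ : M} {y : E}
    (hy : y ∈ (extChartAt 𝓘(ℝ, E) x₀).target)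
    (hf : MDifferentiableAt 𝓘(ℝ, E) 𝓘(ℝ, G) f ((extChartAt 𝓘(ℝ, E) x₀).symm y)) :
    HasFDerivAt (f ∘ (extChartAt 𝓘(ℝ, E) x₀).symm)
      (localForm (fun x => mfderiv 𝓘(ℝ, E) 𝓘(ℝ, G) f x) x₀ y) y :=
  (hf.hasMFDerivAt.comp y (mdifferentiableAt_extChartAt_symm hy).hasMFDerivAt).hasFDerivAt

theorem contDiffOn_comp_extChartAt_symm {f : M → G} (hf : ContMDiff 𝓘(ℝ, E) 𝓘(ℝ, G) ∞ f)
    (x₀ : M) :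
    ContDiffOn ℝ ∞ (f ∘ (extChartAt 𝓘(ℝ, E) x₀).symm) (extChartAt 𝓘(ℝ, E) x₀).target :=
  (hf.comp_contMDiffOn (contMDiffOn_extChartAt_symm x₀)).contDiffOn

theorem eq_of_mfderiv_eq_zero_on_chartBall {f : M → G} {x₀ : M} {r : ℝ}
    (hr : Metric.ball (extChartAt 𝓘(ℝ, E) x₀ x₀) r ⊆ (extChartAt 𝓘(ℝ, E) x₀).target)
    (hf : MDifferentiable 𝓘(ℝ, E) 𝓘(ℝ, G) f)
    (h : ∀ x ∈ chartBall (E := E) x₀ r, mfderiv 𝓘(ℝ, E) 𝓘(ℝ, G) f x = 0)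
    {x x' : M} (hx : x ∈ chartBall (E := E) x₀ r) (hx' : x' ∈ chartBall (E := E) x₀ r) :
    f x = f x' := by
  have hd (y) (hy : y ∈ Metric.ball (extChartAt 𝓘(ℝ, E) x₀ x₀) r) :
      HasFDerivAt (f ∘ (extChartAt 𝓘(ℝ, E) x₀).symm) (0 : E →L[ℝ] G) y := by
    convert hasFDerivAt_comp_extChartAt_symm (hr hy) (hf _) using 1
    simp only [localForm]
    rw [h _ (extChartAt_symm_mem_chartBall hr hy)]
    rfl
  have key := Metric.isOpen_ball.is_const_of_fderiv_eq_zero (𝕜 := ℝ)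
    (convex_ball (extChartAt 𝓘(ℝ, E) x₀ x₀) r).isPreconnected
    (fun y hy => (hd y hy).differentiableAt.differentiableWithinAt)
    (fun y hy => (hd y hy).fderiv) hx.2 hx'.2
  simpa only [Function.comp_apply, (extChartAt 𝓘(ℝ, E) x₀).left_inv hx.1,
    (extChartAt 𝓘(ℝ, E) x₀).left_inv hx'.1] using key

end Charts

/-! ## Complex tangent vectors and derivations of smooth functions -/

section ComplexTangent

variable {E : Type*} [NormedAddCommGroup E] [NormedSpace ℝ E]
  {M : Type*} [TopologicalSpace M] [ChartedSpace E M]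

/-- The differential at `x` of a complex valued function. -/
def diffAt (f : M → ℂ) (x : M) : TangentSpace 𝓘(ℝ, E) x →L[ℝ] ℂ :=
  mfderiv 𝓘(ℝ, E) 𝓘(ℝ, ℂ) f x

theorem SmoothFn.mdifferentiableAt (f : SmoothFn E M) (x : M) :
    MDifferentiableAt 𝓘(ℝ, E) 𝓘(ℝ, ℂ) f.1 x :=
  f.2.mdifferentiable (by simp) x

namespace ComplexTangent

variable {x : M}

theorem deriv_tmul (c : ℂ) (v : TangentSpace 𝓘(ℝ, E) x) (f : M → ℂ) :
    deriv (c ⊗ₜ[ℝ] v : ComplexTangent E x) f = c * diffAt f x v :=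
  LinearMap.liftBaseChange_tmul ..

theorem deriv_add (Y Z : ComplexTangent E x) (f : M → ℂ) :
    (Y + Z).deriv f = Y.deriv f + Z.deriv f :=
  map_add (LinearMap.liftBaseChange ℂ _) Y Z

theorem deriv_zero (f : M → ℂ) : (0 : ComplexTangent E x).deriv f = 0 :=
  map_zero (LinearMap.liftBaseChange ℂ _)

theorem deriv_smul (c : ℂ) (Y : ComplexTangent E x) (f : M → ℂ) :
    (c • Y).deriv f = c * Y.deriv f :=
  map_smul (LinearMap.liftBaseChange ℂ _) c Y

theorem deriv_sum {ι : Type*} (s : Finset ι) (Y : ι → ComplexTangent E x) (f : M → ℂ) :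
    (∑ i ∈ s, Y i).deriv f = ∑ i ∈ s, (Y i).deriv f :=
  map_sum (LinearMap.liftBaseChange ℂ _) Y s

theorem deriv_mul (Y : ComplexTangent E x) (f g : SmoothFn E M) :
    Y.deriv (f * g).1 = f.1 x * Y.deriv g.1 + g.1 x * Y.deriv f.1 := by
  induction Y using TensorProduct.induction_on with
  | zero => simp [deriv_zero]
  | add Y Z hY hZ => rw [deriv_add, deriv_add, deriv_add, hY, hZ]; ring
  | tmul c v =>
    have hmul : diffAt (f * g).1 x v = f.1 x * diffAt g.1 x v + g.1 x * diffAt f.1 x v :=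
      DFunLike.congr_fun ((SmoothFn.mdifferentiableAt f x).hasMFDerivAt.mul
        (SmoothFn.mdifferentiableAt g x).hasMFDerivAt).mfderiv v
    rw [deriv_tmul, deriv_tmul, deriv_tmul, hmul]
    ring

theorem exists_eq_add_I (Y : ComplexTangent E x) :
    ∃ u v : TangentSpace 𝓘(ℝ, E) x, Y = (1 : ℂ) ⊗ₜ[ℝ] u + Complex.I ⊗ₜ[ℝ] v := by
  induction Y using TensorProduct.induction_on with
  | zero => exact ⟨0, 0, by simp⟩
  | add Y Z hY hZ =>
    obtain ⟨u, v, rfl⟩ := hY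
    obtain ⟨u', v', rfl⟩ := hZ
    exact ⟨u + u', v + v', by rw [TensorProduct.tmul_add, TensorProduct.tmul_add]; abel⟩
  | tmul c v =>
    refine ⟨c.re • v, c.im • v, ?_⟩
    rw [← TensorProduct.smul_tmul, ← TensorProduct.smul_tmul, ← TensorProduct.add_tmul]
    congr 1
    simp

theorem deriv_fn_add (Y : ComplexTangent E x) (f g : SmoothFn E M) :
    Y.deriv (f + g).1 = Y.deriv f.1 + Y.deriv g.1 := by
  have h (v : TangentSpace 𝓘(ℝ, E) x) : diffAt (f + g).1 x v = diffAt f.1 x v + diffAt g.1 x v :=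
    DFunLike.congr_fun ((SmoothFn.mdifferentiableAt f x).hasMFDerivAt.add
      (SmoothFn.mdifferentiableAt g x).hasMFDerivAt).mfderiv v
  obtain ⟨u, v, rfl⟩ := Y.exists_eq_add_I
  simp only [deriv_add, deriv_tmul, h]
  ring

theorem deriv_const (Y : ComplexTangent E x) (c : ℂ) : Y.deriv (fun _ : M => c) = 0 := by
  have h (v : TangentSpace 𝓘(ℝ, E) x) : diffAt (fun _ : M => c) x v = 0 :=
    DFunLike.congr_fun (mfderiv_const (I := 𝓘(ℝ, E)) (I' := 𝓘(ℝ, ℂ)) (c := c)) v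
  obtain ⟨u, v, rfl⟩ := Y.exists_eq_add_I
  simp only [deriv_add, deriv_tmul, h, mul_zero, add_zero]

theorem deriv_fn_smul (Y : ComplexTangent E x) (c : ℂ) (f : SmoothFn E M) :
    Y.deriv (c • f).1 = c * Y.deriv f.1 := by
  rw [Algebra.smul_def, deriv_mul, show (algebraMap ℂ (SmoothFn E M) c).1 = fun _ => c from rfl,
    deriv_const, mul_zero, add_zero]

/-- The action of a complex tangent vector on smooth functions. -/
def derivLinear (Y : ComplexTangent E x) : SmoothFn E M →ₗ[ℂ] ℂ where
  toFun f := Y.deriv f.1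
  map_add' := Y.deriv_fn_add
  map_smul' := Y.deriv_fn_smul

end ComplexTangent

end ComplexTangent

section Cutoff

variable {E : Type*} [NormedAddCommGroup E] [NormedSpace ℝ E] [FiniteDimensional ℝ E]
  {M : Type*} [TopologicalSpace M] [T2Space M] [ChartedSpace E M] [IsManifold 𝓘(ℝ, E) ∞ M]

theorem exists_cutoff {x₀ : M} {U : Set M} (hU : U ∈ nhds x₀) :
    ∃ χ : M → ℝ, ContMDiff 𝓘(ℝ, E) 𝓘(ℝ, ℝ) ∞ χ ∧ tsupport χ ⊆ U ∧
      ∃ r > 0, Metric.ball (extChartAt 𝓘(ℝ, E) x₀ x₀) r ⊆ (extChartAt 𝓘(ℝ, E) x₀).target ∧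
        ∀ x ∈ chartBall (E := E) x₀ r, χ x = 1 := by
  obtain ⟨χ, -, hχ⟩ := (SmoothBumpFunction.nhds_basis_tsupport (I := 𝓘(ℝ, E)) x₀).mem_iff.1 hU
  refine ⟨χ, χ.contMDiff, hχ, χ.rIn, χ.rIn_pos, fun y hy => ?_, fun x hx => ?_⟩
  · exact χ.closedBall_subset ⟨Metric.ball_subset_closedBall
      (Metric.ball_subset_ball χ.rIn_lt_rOut.le hy), by simp⟩
  · refine χ.one_of_dist_le ?_ (Metric.mem_ball.1 hx.2).le
    simpa using hx.1

omit [FiniteDimensional ℝ E] [T2Space M] [IsManifold 𝓘(ℝ, E) ∞ M] in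
theorem contMDiff_cutoff_smul {K : Type*} [NormedAddCommGroup K] [NormedSpace ℝ K]
    {H : Type*} [TopologicalSpace H] {I : ModelWithCorners ℝ K H}
    {N : Type*} [TopologicalSpace N] [ChartedSpace H N]
    {π : N → M} (hπ : ContMDiff I 𝓘(ℝ, E) ∞ π) {χ : M → ℝ}
    (hχ : ContMDiff 𝓘(ℝ, E) 𝓘(ℝ, ℝ) ∞ χ) {U : Set M} (hχU : tsupport χ ⊆ U) {g : N → ℂ}
    (hg : ∀ p, π p ∈ U → ContMDiffAt I 𝓘(ℝ, ℂ) ∞ g p) :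
    ContMDiff I 𝓘(ℝ, ℂ) ∞ (fun p => χ (π p) • g p) := by
  intro p
  by_cases hp : π p ∈ tsupport χ
  · exact ((hχ.comp hπ) p).smul (hg p (hχU hp))
  · have h : (fun p => χ (π p) • g p) =ᶠ[nhds p] fun _ => 0 := by
      filter_upwards [hπ.continuous.continuousAt.preimage_mem_nhds
        ((isClosed_tsupport χ).isOpen_compl.mem_nhds hp)] with q hq
      rw [image_eq_zero_of_notMem_tsupport hq, zero_smul]
    exact contMDiffAt_const.congr_of_eventuallyEq h

theorem exists_smoothFn_eventuallyEq {x₀ : M} {U : Set M} (hU : U ∈ nhds x₀) {g : M → ℂ}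
    (hg : ∀ x ∈ U, ContMDiffAt 𝓘(ℝ, E) 𝓘(ℝ, ℂ) ∞ g x) :
    ∃ f : SmoothFn E M, f.1 =ᶠ[nhds x₀] g := by
  obtain ⟨χ, hχ, hχU, r, hr, -, hχ_one⟩ := exists_cutoff (E := E) hU
  refine ⟨⟨fun x => χ x • g x, contMDiff_cutoff_smul contMDiff_id hχ hχU hg⟩, ?_⟩
  filter_upwards [(isOpen_chartBall (E := E) x₀ r).mem_nhds (mem_chartBall x₀ hr)] with x hx
  simp [hχ_one x hx]

/-- Smooth functions `κ i` on `M` whose expressions in the preferred chart at `x₀` are, over `V`,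
the coordinates with respect to a basis of `E`. -/
structure IsCoordinateSystem (x₀ : M) (V : Set E) (κ : Fin (Module.finrank ℝ E) → SmoothFn E M) :
    Prop where
  isOpen : IsOpen V
  subset : V ⊆ (extChartAt 𝓘(ℝ, E) x₀).target
  apply : ∀ i, ∀ y ∈ V,
    (κ i).1 ((extChartAt 𝓘(ℝ, E) x₀).symm y) = ((Module.finBasis ℝ E).coord i y : ℝ)

theorem exists_isCoordinateSystem {x₀ : M} {y₁ : E} (hy₁ : y₁ ∈ (extChartAt 𝓘(ℝ, E) x₀).target) :
    ∃ V κ, IsCoordinateSystem x₀ V κ ∧ y₁ ∈ V := by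
  obtain ⟨χ, hχ, hχU, r, hr, -, hχ_one⟩ := exists_cutoff (E := E)
    ((isOpen_extChartAt_source (I := 𝓘(ℝ, E)) x₀).mem_nhds
      ((extChartAt 𝓘(ℝ, E) x₀).map_target hy₁))
  have hsmooth (i : Fin (Module.finrank ℝ E)) (x) (hx : x ∈ (extChartAt 𝓘(ℝ, E) x₀).source) :
      ContMDiffAt 𝓘(ℝ, E) 𝓘(ℝ, ℂ) ∞
        (fun x => (((Module.finBasis ℝ E).coord i (extChartAt 𝓘(ℝ, E) x₀ x) : ℝ) : ℂ)) x := by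
    have hcoord : ContDiff ℝ ∞ (fun y => (((Module.finBasis ℝ E).coord i y : ℝ) : ℂ)) :=
      (Complex.ofRealCLM.comp
        (LinearMap.toContinuousLinearMap ((Module.finBasis ℝ E).coord i))).contDiff
    exact hcoord.contMDiff.contMDiffAt.comp x (contMDiffAt_extChartAt' (by simpa using hx))
  refine ⟨(extChartAt 𝓘(ℝ, E) x₀).target ∩ (extChartAt 𝓘(ℝ, E) x₀).symm ⁻¹' chartBall (E := E) _ r,
    fun i => ⟨_, contMDiff_cutoff_smul contMDiff_id hχ hχU (hsmooth i)⟩,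
    ⟨?_, Set.inter_subset_left, fun i y hy => ?_⟩, hy₁, mem_chartBall _ hr⟩
  · exact (continuousOn_extChartAt_symm x₀).isOpen_inter_preimage
      (isOpen_extChartAt_target x₀) (isOpen_chartBall _ r)
  · simp only [id]
    rw [hχ_one _ hy.2, one_smul, (extChartAt 𝓘(ℝ, E) x₀).right_inv hy.1]

namespace IsCoordinateSystem

variable {x₀ : M} {V : Set E} {κ : Fin (Module.finrank ℝ E) → SmoothFn E M}

omit [T2Space M]

theorem diffAt_chartDeriv (h : IsCoordinateSystem x₀ V κ) {y : E} (hy : y ∈ V)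
    (i : Fin (Module.finrank ℝ E)) (v : E) :
    diffAt (κ i).1 ((extChartAt 𝓘(ℝ, E) x₀).symm y) (chartDeriv x₀ y v) =
      ((Module.finBasis ℝ E).coord i v : ℝ) := by
  have hcoord : HasFDerivAt (fun y => (((Module.finBasis ℝ E).coord i y : ℝ) : ℂ))
      (Complex.ofRealCLM.comp
        (LinearMap.toContinuousLinearMap ((Module.finBasis ℝ E).coord i))) y :=
    (Complex.ofRealCLM.comp
        (LinearMap.toContinuousLinearMap ((Module.finBasis ℝ E).coord i))).hasFDerivAt
  have hκ_eq : (κ i).1 ∘ (extChartAt 𝓘(ℝ, E) x₀).symm =ᶠ[nhds y]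
      fun y => (((Module.finBasis ℝ E).coord i y : ℝ) : ℂ) := by
    filter_upwards [h.isOpen.mem_nhds hy] with z hz using h.apply i z hz
  exact DFunLike.congr_fun ((hasFDerivAt_comp_extChartAt_symm (h.subset hy)
    (SmoothFn.mdifferentiableAt (κ i) _)).unique (hcoord.congr_of_eventuallyEq hκ_eq)) v

theorem eq_sum_deriv_smul (h : IsCoordinateSystem x₀ V κ) {y : E} (hy : y ∈ V)
    (Y : ComplexTangent E ((extChartAt 𝓘(ℝ, E) x₀).symm y)) :
    Y = ∑ i, Y.deriv (κ i).1 • ((1 : ℂ) ⊗ₜ[ℝ] chartDeriv x₀ y (Module.finBasis ℝ E i)) := by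
  induction Y using TensorProduct.induction_on with
  | zero =>
    exact (Finset.sum_eq_zero fun i _ =>
      (congrArg (· • _) (ComplexTangent.deriv_zero _)).trans (zero_smul ℂ _)).symm
  | add Y Z hY hZ =>
    simp only [ComplexTangent.deriv_add, add_smul, Finset.sum_add_distrib]
    rw [← hY, ← hZ]
  | tmul c v =>
    obtain ⟨e, he⟩ := isInvertible_chartDeriv (h.subset hy)
    obtain ⟨w, rfl⟩ := e.surjective v
    have he' : e w = chartDeriv x₀ y w := by rw [← he]; rfl
    have hw : chartDeriv x₀ y w =
        ∑ i, (Module.finBasis ℝ E).coord i w • chartDeriv x₀ y (Module.finBasis ℝ E i) := by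
      conv_lhs => rw [← (Module.finBasis ℝ E).sum_repr w]
      rw [map_sum]
      exact Finset.sum_congr rfl fun i _ => (chartDeriv x₀ y).map_smul _ _
    simp only [ComplexTangent.deriv_tmul, he', h.diffAt_chartDeriv hy]
    conv_lhs => rw [hw]
    rw [TensorProduct.tmul_sum]
    refine Finset.sum_congr rfl fun i _ => ?_
    refine (TensorProduct.smul_tmul _ c _).symm.trans ?_
    rw [TensorProduct.smul_tmul']
    congr 1
    simp [mul_comm]

omit [IsManifold 𝓘(ℝ, E) ∞ M] in
theorem eventually_eq_coord (h : IsCoordinateSystem x₀ V κ) (hV : extChartAt 𝓘(ℝ, E) x₀ x₀ ∈ V) :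
    ∀ᶠ x in nhds x₀, ∀ i,
      (κ i).1 x = ((Module.finBasis ℝ E).coord i (extChartAt 𝓘(ℝ, E) x₀ x) : ℝ) := by
  filter_upwards [extChartAt_source_mem_nhds (I := 𝓘(ℝ, E)) x₀,
    (continuousAt_extChartAt (I := 𝓘(ℝ, E)) x₀).preimage_mem_nhds (h.isOpen.mem_nhds hV)]
    with x hx hxV i
  rw [← h.apply i _ hxV, (extChartAt 𝓘(ℝ, E) x₀).left_inv hx]

theorem exists_dual_tangent (h : IsCoordinateSystem x₀ V κ)
    (hV : extChartAt 𝓘(ℝ, E) x₀ x₀ ∈ V) (j : Fin (Module.finrank ℝ E)) :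
    ∃ v : TangentSpace 𝓘(ℝ, E) x₀, ∀ i, diffAt (κ i).1 x₀ v = if i = j then 1 else 0 := by
  suffices ∃ v : TangentSpace 𝓘(ℝ, E)
      ((extChartAt 𝓘(ℝ, E) x₀).symm (extChartAt 𝓘(ℝ, E) x₀ x₀)), ∀ i,
      diffAt (κ i).1 _ v = if i = j then 1 else 0 by
    rwa [extChartAt_to_inv] at this
  refine ⟨chartDeriv x₀ _ (Module.finBasis ℝ E j), fun i => ?_⟩
  refine (h.diffAt_chartDeriv hV i _).trans ?_
  simp [Finsupp.single_apply, apply_ite Complex.ofReal, eq_comm]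

end IsCoordinateSystem

theorem ComplexTangent.ext_deriv {x : M} {Y Z : ComplexTangent E x}
    (h : ∀ f : SmoothFn E M, Y.deriv f.1 = Z.deriv f.1) : Y = Z := by
  obtain ⟨V, κ, hκ, hV⟩ := exists_isCoordinateSystem (mem_extChartAt_target (I := 𝓘(ℝ, E)) x)
  have hsum := hκ.eq_sum_deriv_smul hV
  rw [extChartAt_to_inv] at hsum
  rw [hsum Y, hsum Z]
  simp only [h]

theorem exists_hadamard_expansion (f : SmoothFn E M) (x₀ : M) :
    ∃ g : Fin (Module.finrank ℝ E) → SmoothFn E M, ∀ᶠ x in nhds x₀,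
      f.1 x = f.1 x₀ + ∑ i, (Module.finBasis ℝ E).coord i
        (extChartAt 𝓘(ℝ, E) x₀ x - extChartAt 𝓘(ℝ, E) x₀ x₀) • (g i).1 x := by
  obtain ⟨r, hr, hrt, -⟩ := exists_chartBall_subset (E := E) (Filter.univ_mem (f := nhds x₀))
  obtain ⟨G, hG, hfG⟩ := exists_hadamard_expansion_of_convex (Module.finBasis ℝ E)
    Metric.isOpen_ball (convex_ball _ r) ((contDiffOn_comp_extChartAt_symm f.2 x₀).mono hrt)
    (Metric.mem_ball_self hr)
  have hball := (isOpen_chartBall (E := E) x₀ r).mem_nhds (mem_chartBall x₀ hr)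
  have hext (i) : ∃ g : SmoothFn E M, g.1 =ᶠ[nhds x₀] fun x => G i (extChartAt 𝓘(ℝ, E) x₀ x) :=
    exists_smoothFn_eventuallyEq hball fun x hx =>
      ((hG i).contDiffAt (Metric.isOpen_ball.mem_nhds hx.2)).contMDiffAt.comp x
        (contMDiffAt_extChartAt' (by simpa using hx.1))
  choose g hg using hext
  refine ⟨g, ?_⟩
  filter_upwards [hball, Filter.eventually_all.2 hg] with x hx hgx
  simpa only [Function.comp_apply, (extChartAt 𝓘(ℝ, E) x₀).left_inv hx.1, extChartAt_to_inv, hgx]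
    using hfG _ hx.2

end Cutoff

section PointDerivation

variable {E : Type*} [NormedAddCommGroup E] [NormedSpace ℝ E]
  {M : Type*} [TopologicalSpace M] [ChartedSpace E M] {x₀ : M} {D D' : SmoothFn E M →ₗ[ℂ] ℂ}

/-- The linear functional `D` is a derivation at the point `x₀` of the algebra of smooth
functions. -/
def IsPointDerivation (x₀ : M) (D : SmoothFn E M →ₗ[ℂ] ℂ) : Prop :=
  ∀ f g : SmoothFn E M, D (f * g) = f.1 x₀ * D g + g.1 x₀ * D f

theorem ComplexTangent.isPointDerivation (Y : ComplexTangent E x₀) :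
    IsPointDerivation x₀ Y.derivLinear :=
  Y.deriv_mul

namespace IsPointDerivation

theorem sub (hD : IsPointDerivation x₀ D) (hD' : IsPointDerivation x₀ D') :
    IsPointDerivation x₀ (D - D') := fun f g => by
  rw [LinearMap.sub_apply, LinearMap.sub_apply, LinearMap.sub_apply, hD, hD']
  ring

theorem apply_algebraMap (hD : IsPointDerivation x₀ D) (c : ℂ) :
    D (algebraMap ℂ (SmoothFn E M) c) = 0 := by
  have hone : D 1 = 0 := by simpa using hD 1 1
  rw [Algebra.algebraMap_eq_smul_one, map_smul, hone, smul_zero]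

variable [FiniteDimensional ℝ E] [T2Space M] [IsManifold 𝓘(ℝ, E) ∞ M]

theorem apply_eq_zero_of_eventuallyEq_zero (hD : IsPointDerivation x₀ D) {f : SmoothFn E M}
    (hf : f.1 =ᶠ[nhds x₀] 0) : D f = 0 := by
  obtain ⟨χ, hχ, hχU, r, hr, -, hχ_one⟩ := exists_cutoff (E := E) hf
  let φ : SmoothFn E M := ⟨fun x => (χ x : ℂ), Complex.ofRealCLM.contDiff.comp_contMDiff hχ⟩
  have hφf : φ * f = 0 := by
    ext x
    by_cases hx : x ∈ tsupport χ
    · simp [show f.1 x = 0 from hχU hx]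
    · simp [φ, image_eq_zero_of_notMem_tsupport hx]
  have hleibniz := hD φ f
  rw [hφf, map_zero, hf.self_of_nhds] at hleibniz
  simpa [φ, hχ_one x₀ (mem_chartBall x₀ hr)] using hleibniz.symm

theorem congr_of_eventuallyEq (hD : IsPointDerivation x₀ D) {f g : SmoothFn E M}
    (hfg : f.1 =ᶠ[nhds x₀] g.1) : D f = D g := by
  rw [← sub_eq_zero, ← map_sub]
  exact hD.apply_eq_zero_of_eventuallyEq_zero (hfg.sub_eq (f := f.1) (g := g.1))

theorem eq_zero_of_coordinates (hD : IsPointDerivation x₀ D) {V : Set E}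
    {κ : Fin (Module.finrank ℝ E) → SmoothFn E M} (hκ : IsCoordinateSystem x₀ V κ)
    (hV : extChartAt 𝓘(ℝ, E) x₀ x₀ ∈ V) (h : ∀ i, D (κ i) = 0) : D = 0 := by
  ext f
  obtain ⟨g, hg⟩ := exists_hadamard_expansion f x₀
  have hcoord := hκ.eventually_eq_coord hV
  have hexpand : f.1 =ᶠ[nhds x₀] (algebraMap ℂ (SmoothFn E M) (f.1 x₀) +
      ∑ i, (κ i - algebraMap ℂ (SmoothFn E M) ((κ i).1 x₀)) * g i : SmoothFn E M).1 := by
    filter_upwards [hg, hcoord] with x hx hκx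
    rw [hx]
    simp [hκx, hcoord.self_of_nhds, Finset.sum_apply, sub_mul]
  have hterm (i) : D ((κ i - algebraMap ℂ (SmoothFn E M) ((κ i).1 x₀)) * g i) = 0 := by
    rw [hD, map_sub, h, hD.apply_algebraMap, sub_zero, mul_zero, add_zero]
    exact mul_eq_zero_of_left (sub_self _) _
  rw [hD.congr_of_eventuallyEq hexpand, map_add, hD.apply_algebraMap, map_sum,
    Finset.sum_eq_zero fun i _ => hterm i, add_zero, LinearMap.zero_apply]

theorem exists_complexTangent (hD : IsPointDerivation x₀ D) :
    ∃ Y : ComplexTangent E x₀, ∀ f : SmoothFn E M, Y.deriv f.1 = D f := by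
  obtain ⟨V, κ, hκ, hV⟩ := exists_isCoordinateSystem (mem_extChartAt_target (I := 𝓘(ℝ, E)) x₀)
  choose v hv using hκ.exists_dual_tangent hV
  let Y : ComplexTangent E x₀ := ∑ j, D (κ j) • ((1 : ℂ) ⊗ₜ[ℝ] v j)
  have hY (i) : Y.deriv (κ i).1 = D (κ i) := by
    simp only [Y, ComplexTangent.deriv_sum, ComplexTangent.deriv_smul, ComplexTangent.deriv_tmul,
      hv]
    simp
  have hzero : Y.derivLinear - D = 0 :=
    (Y.isPointDerivation.sub hD).eq_zero_of_coordinates hκ hV fun i => sub_eq_zero.2 (hY i)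
  exact ⟨Y, fun f => LinearMap.congr_fun (sub_eq_zero.1 hzero) f⟩

end IsPointDerivation

end PointDerivation

/-! ## Symplectic forms in coordinates -/

section SymplecticCoordinates

variable {E : Type*} [NormedAddCommGroup E] [NormedSpace ℝ E]
  {M : Type*} [TopologicalSpace M] [ChartedSpace E M]

namespace SymplecticForm

variable (Ω : SymplecticForm E M)

theorem flatComplex_tmul (x : M) (c : ℂ) (v w : TangentSpace 𝓘(ℝ, E) x) :
    Ω.flatComplex x (c ⊗ₜ[ℝ] v : ComplexTangent E x) w = c * (Ω.flat x v w : ℝ) := by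
  rw [flatComplex, LinearMap.liftBaseChange_tmul]
  rfl

theorem flatComplex_injective (x : M) : Function.Injective (Ω.flatComplex x) := by
  rw [← LinearMap.ker_eq_bot, LinearMap.ker_eq_bot']
  intro Y hY
  obtain ⟨u, v, rfl⟩ := Y.exists_eq_add_I
  have hreim (w : TangentSpace 𝓘(ℝ, E) x) :
      (Ω.flat x u w : ℂ) + Complex.I * (Ω.flat x v w : ℝ) = 0 := by
    rw [← one_mul (Ω.flat x u w : ℂ), ← flatComplex_tmul, ← flatComplex_tmul]
    rw [map_add] at hY
    exact DFunLike.congr_fun hY w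
  have hu : u = 0 := Ω.flat_injective x <| by
    rw [map_zero]
    ext w
    simpa using congrArg Complex.re (hreim w)
  have hv : v = 0 := Ω.flat_injective x <| by
    rw [map_zero]
    ext w
    simpa using congrArg Complex.im (hreim w)
  rw [hu, hv]
  simp

theorem eq_hamiltonianField_iff [FiniteDimensional ℝ E] {f : M → ℂ} {x : M}
    {Y : ComplexTangent E x} :
    Y = Ω.hamiltonianField f x ↔ Ω.flatComplex x Y = diffAt f x := by
  rw [← (Ω.flatComplex_injective x).eq_iff, Ω.flatComplex_hamiltonianField]
  rfl

/-- The coefficients of the symplectic form in the preferred chart at `x₀`. -/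
def coefficient (x₀ : M) (i j : Fin (Module.finrank ℝ E)) [FiniteDimensional ℝ E] (y : E) : ℝ :=
  Ω.toForm.inChart x₀ y ![Module.finBasis ℝ E i, Module.finBasis ℝ E j]

theorem contDiffOn_coefficient [FiniteDimensional ℝ E] (x₀ : M)
    (i j : Fin (Module.finrank ℝ E)) :
    ContDiffOn ℝ ∞ (Ω.coefficient x₀ i j) (extChartAt 𝓘(ℝ, E) x₀).target := by
  exact (ContinuousAlternatingMap.apply ℝ E ℝ
    ![Module.finBasis ℝ E i, Module.finBasis ℝ E j]).contDiff.comp_contDiffOn (Ω.smooth x₀)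

theorem coefficient_swap [FiniteDimensional ℝ E] (x₀ : M)
    (i j : Fin (Module.finrank ℝ E)) (y : E) :
    Ω.coefficient x₀ i j y = - Ω.coefficient x₀ j i y := by
  refine Eq.trans ?_ ((Ω.toForm.inChart x₀ y).map_swap
    ![Module.finBasis ℝ E j, Module.finBasis ℝ E i] (show (0 : Fin 2) ≠ 1 by decide))
  change Ω.toForm.inChart x₀ y _ = Ω.toForm.inChart x₀ y _
  congr 1
  ext k
  fin_cases k <;> rfl

theorem flat_chartDeriv [FiniteDimensional ℝ E] (x₀ : M)
    (i j : Fin (Module.finrank ℝ E)) (y : E) :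
    Ω.flat _ (chartDeriv x₀ y (Module.finBasis ℝ E i)) (chartDeriv x₀ y (Module.finBasis ℝ E j)) =
      Ω.coefficient x₀ i j y := by
  rw [flat_apply]
  change _ = Ω.toForm _ _
  congr 1
  ext k
  fin_cases k <;> rfl

/-- The contraction of the symplectic form with a vector field, in the preferred chart at `x₀`. -/
def contractLocal (Y : (x : M) → ComplexTangent E x) (x₀ : M) : E → E →L[ℝ] ℂ :=
  localForm (fun x => Ω.flatComplex x (Y x)) x₀

variable [FiniteDimensional ℝ E] [IsManifold 𝓘(ℝ, E) ∞ M]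
  {x₀ : M} {V : Set E} {κ : Fin (Module.finrank ℝ E) → SmoothFn E M}

theorem contractLocal_basis (hκ : IsCoordinateSystem x₀ V κ) {y : E} (hy : y ∈ V)
    (Y : (x : M) → ComplexTangent E x) (j : Fin (Module.finrank ℝ E)) :
    Ω.contractLocal Y x₀ y (Module.finBasis ℝ E j) =
      ∑ i, (Y ((extChartAt 𝓘(ℝ, E) x₀).symm y)).deriv (κ i).1 * Ω.coefficient x₀ i j y := by
  change Ω.flatComplex _ (Y _) (chartDeriv x₀ y _) = _
  conv_lhs => rw [hκ.eq_sum_deriv_smul hy (Y ((extChartAt 𝓘(ℝ, E) x₀).symm y))]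
  rw [map_sum]
  refine (sum_apply ..).trans (Finset.sum_congr rfl fun i _ => ?_)
  rw [map_smul]
  refine (smul_apply ..).trans ?_
  rw [flatComplex_tmul, one_mul, flat_chartDeriv, smul_eq_mul]

omit [IsManifold 𝓘(ℝ, E) ∞ M] in
theorem contractLocal_eq_sum (Y : (x : M) → ComplexTangent E x) (y w : E) :
    Ω.contractLocal Y x₀ y w = ∑ j, ((Module.finBasis ℝ E).coord j w : ℝ) *
      Ω.contractLocal Y x₀ y (Module.finBasis ℝ E j) := by
  conv_lhs => rw [← (Module.finBasis ℝ E).sum_repr w]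
  rw [map_sum]
  simp

theorem contDiffOn_contractLocal {P : Type*} [NormedAddCommGroup P] [NormedSpace ℝ P]
    (hκ : IsCoordinateSystem x₀ V κ) {s : Set P} {π : P → E} (hπ : ContDiffOn ℝ ∞ π s)
    (hπV : Set.MapsTo π s V) {Y : P → (x : M) → ComplexTangent E x}
    (hY : ∀ i, ContDiffOn ℝ ∞
      (fun p => (Y p ((extChartAt 𝓘(ℝ, E) x₀).symm (π p))).deriv (κ i).1) s) :
    ContDiffOn ℝ ∞ (fun p => Ω.contractLocal (Y p) x₀ (π p)) s := by
  have hcoeff (i j) : ContDiffOn ℝ ∞ (fun p => (Ω.coefficient x₀ i j (π p) : ℂ)) s :=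
    Complex.ofRealCLM.contDiff.comp_contDiffOn
      ((Ω.contDiffOn_coefficient x₀ i j).comp hπ fun _ hp => hκ.subset (hπV hp))
  rw [contDiffOn_clm_apply]
  intro w
  have hsum : ContDiffOn ℝ ∞ (fun p => ∑ j, (((Module.finBasis ℝ E).coord j w : ℝ) : ℂ) *
      ∑ i, (Y p ((extChartAt 𝓘(ℝ, E) x₀).symm (π p))).deriv (κ i).1 *
        Ω.coefficient x₀ i j (π p)) s :=
    ContDiffOn.sum fun j _ => contDiffOn_const.mul
      (ContDiffOn.sum fun i _ => (hY i).mul (hcoeff i j))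
  refine hsum.congr fun p hp => ?_
  rw [contractLocal_eq_sum]
  simp only [Ω.contractLocal_basis hκ (hπV hp)]

theorem contDiffOn_contractLocal_of_preserves {Y : (x : M) → ComplexTangent E x}
    (hκ : IsCoordinateSystem x₀ V κ)
    (hY : ∀ f ∈ SmoothFn E M, (fun x => (Y x).deriv f) ∈ SmoothFn E M) :
    ContDiffOn ℝ ∞ (Ω.contractLocal Y x₀) V :=
  Ω.contDiffOn_contractLocal hκ (Y := fun _ => Y) contDiffOn_id (Set.mapsTo_id V) fun i =>
    (contDiffOn_comp_extChartAt_symm (hY _ (κ i).2) x₀).mono hκ.subset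

theorem isSmooth_contract [T2Space M] {Y : (x : M) → ComplexTangent E x}
    (hY : ∀ f ∈ SmoothFn E M, (fun x => (Y x).deriv f) ∈ SmoothFn E M) :
    (Ω.contract Y).IsSmooth := by
  refine (isSmooth_oneForm_iff _).2 fun x₀ y hy => ?_
  obtain ⟨V, κ, hκ, hV⟩ := exists_isCoordinateSystem hy
  exact ((Ω.contDiffOn_contractLocal_of_preserves hκ hY).contDiffAt
    (hκ.isOpen.mem_nhds hV)).contDiffWithinAt

theorem sum_poisson_mul_coefficient (hκ : IsCoordinateSystem x₀ V κ) {y : E} (hy : y ∈ V)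
    (i j : Fin (Module.finrank ℝ E)) :
    ∑ k, Ω.poisson (κ i).1 (κ k).1 ((extChartAt 𝓘(ℝ, E) x₀).symm y) * Ω.coefficient x₀ k j y =
      if i = j then 1 else 0 := by
  have hflat : Ω.contractLocal (Ω.hamiltonianField (κ i).1) x₀ y (Module.finBasis ℝ E j) =
      diffAt (κ i).1 ((extChartAt 𝓘(ℝ, E) x₀).symm y) (chartDeriv x₀ y (Module.finBasis ℝ E j)) :=
    DFunLike.congr_fun (Ω.flatComplex_hamiltonianField (κ i).1 _) _
  refine (Ω.contractLocal_basis hκ hy (Ω.hamiltonianField (κ i).1) j).symm.trans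
    ((hflat.trans (hκ.diffAt_chartDeriv hy i _)).trans ?_)
  simp [Finsupp.single_apply, apply_ite Complex.ofReal, eq_comm]

theorem deriv_coord_eq_neg_sum (hκ : IsCoordinateSystem x₀ V κ) {y : E} (hy : y ∈ V)
    (Y : (x : M) → ComplexTangent E x) (i : Fin (Module.finrank ℝ E)) :
    (Y ((extChartAt 𝓘(ℝ, E) x₀).symm y)).deriv (κ i).1 =
      -∑ l, Ω.poisson (κ i).1 (κ l).1 ((extChartAt 𝓘(ℝ, E) x₀).symm y) *
        Ω.contractLocal Y x₀ y (Module.finBasis ℝ E l) := by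
  have hswap : ∑ l, Ω.poisson (κ i).1 (κ l).1 ((extChartAt 𝓘(ℝ, E) x₀).symm y) *
      Ω.contractLocal Y x₀ y (Module.finBasis ℝ E l) =
      ∑ k, (Y ((extChartAt 𝓘(ℝ, E) x₀).symm y)).deriv (κ k).1 *
        -∑ l, Ω.poisson (κ i).1 (κ l).1 ((extChartAt 𝓘(ℝ, E) x₀).symm y) *
          Ω.coefficient x₀ l k y := by
    simp only [Ω.contractLocal_basis hκ hy, Finset.mul_sum, ← Finset.sum_neg_distrib]
    rw [Finset.sum_comm]
    refine Finset.sum_congr rfl fun k _ => Finset.sum_congr rfl fun l _ => ?_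
    rw [Ω.coefficient_swap x₀ k l]
    push_cast
    ring
  rw [hswap]
  simp only [Ω.sum_poisson_mul_coefficient hκ hy, mul_neg, Finset.sum_neg_distrib, neg_neg,
    mul_ite, mul_one, mul_zero, Finset.sum_ite_eq, Finset.mem_univ, if_true]

end SymplecticForm

end SymplecticCoordinates

/-! ## Infinitesimal automorphisms of the Poisson bracket -/

section PoissonDerivations

theorem isSymm_of_isSymm_mul_mul_transpose {ι K : Type*} [Fintype ι] [DecidableEq ι] [CommRing K]
    {R W A : Matrix ι ι K} (hWR : W * R = 1) (h : (R * A * R.transpose).IsSymm) : A.IsSymm := by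
  have hA : W * (R * A * R.transpose) * W.transpose = A := by
    calc W * (R * A * R.transpose) * W.transpose = (W * R) * A * (W * R).transpose := by
          simp only [Matrix.transpose_mul, Matrix.mul_assoc]
      _ = A := by simp [hWR]
  rw [← hA, Matrix.IsSymm, Matrix.transpose_mul, Matrix.transpose_mul, h.eq,
    Matrix.transpose_transpose]
  exact (Matrix.mul_assoc ..).symm

/-- The identity behind the closedness of `ι_Y Ω` for an infinitesimal automorphism `Y` of the
Poisson bracket, in terms of the components `R` of the bracket, `p` of the field and `α` of the
contraction, and of their derivatives `dR k`, `dp k` and `dα k` along the `k`-th coordinate. -/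
theorem isSymm_of_jacobi_of_isDerivation {ι K : Type*} [Fintype ι] [DecidableEq ι] [CommRing K]
    {R W dα : Matrix ι ι K} {α p : ι → K} {dR : ι → ι → ι → K} {dp : ι → ι → K}
    (hinv : R * W = 1) (hanti : ∀ i j, R i j = -R j i)
    (hp : ∀ i, p i = -∑ l, R i l * α l)
    (hdp : ∀ k j, dp k j = -∑ l, (dR k j l * α l + R j l * dα k l))
    (hjac : ∀ i j l, ∑ k, R i k * dR k j l - ∑ k, R j k * dR k i l = -∑ k, R l k * dR k i j)
    (hder : ∀ i j, ∑ k, p k * dR k i j = -∑ l, R j l * dp l i + ∑ k, R i k * dp k j) :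
    dα.IsSymm := by
  have hfield (i j) : ∑ k, p k * dR k i j = ∑ m, (∑ k, R m k * dR k i j) * α m := by
    simp only [hp, ← Finset.sum_neg_distrib, Finset.sum_mul]
    rw [Finset.sum_comm]
    refine Finset.sum_congr rfl fun m _ => Finset.sum_congr rfl fun k _ => ?_
    rw [hanti k m]
    ring
  have hcomponents (i j) : ∑ k, R i k * dp k j =
      -∑ m, (∑ k, R i k * dR k j m) * α m - (R * dα * R.transpose) i j := by
    simp only [hdp, Matrix.mul_apply, Matrix.transpose_apply, Finset.sum_mul, mul_neg,
      Finset.mul_sum, ← Finset.sum_neg_distrib, ← Finset.sum_sub_distrib]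
    rw [Finset.sum_comm]
    exact Finset.sum_congr rfl fun m _ => Finset.sum_congr rfl fun k _ => by ring
  have hjacobi (i j) : ∑ m, (∑ k, R i k * dR k j m) * α m - ∑ m, (∑ k, R j k * dR k i m) * α m =
      -∑ m, (∑ k, R m k * dR k i j) * α m := by
    rw [← Finset.sum_sub_distrib, ← Finset.sum_neg_distrib]
    exact Finset.sum_congr rfl fun m _ => by rw [← sub_mul, hjac, neg_mul]
  refine isSymm_of_isSymm_mul_mul_transpose (mul_eq_one_comm.1 hinv)
    (Matrix.IsSymm.ext fun i j => ?_)
  have hbalance := hder i j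
  rw [hfield, hcomponents, hcomponents] at hbalance
  linear_combination hjacobi i j - hbalance

variable {E : Type*} [NormedAddCommGroup E] [NormedSpace ℝ E] [FiniteDimensional ℝ E]
  {M : Type*} [TopologicalSpace M] [ChartedSpace E M]

/-- The operation `br` on smooth functions is the Poisson bracket, and satisfies the Jacobi
identity. The bracket of a star product has this property because its product is smooth and
associative, so neither the smoothness nor the Jacobi identity is derived from `Ω`. -/
structure IsPoissonBracket (Ω : SymplecticForm E M)
    (br : SmoothFn E M → SmoothFn E M → SmoothFn E M) : Prop where
  apply : ∀ f g x, (br f g).1 x = Ω.poisson f.1 g.1 x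
  swap : ∀ f g, br f g = -br g f
  jacobi : ∀ f g k, br f (br g k) - br g (br f k) = -br k (br f g)

variable [IsManifold 𝓘(ℝ, E) ∞ M]

theorem ComplexTangent.deriv_eq_sum {x₀ : M} {V : Set E}
    {κ : Fin (Module.finrank ℝ E) → SmoothFn E M} (hκ : IsCoordinateSystem x₀ V κ) {y : E}
    (hy : y ∈ V) (Y : ComplexTangent E ((extChartAt 𝓘(ℝ, E) x₀).symm y)) (f : SmoothFn E M) :
    Y.deriv f.1 = ∑ i, Y.deriv (κ i).1 *
      fderiv ℝ (f.1 ∘ (extChartAt 𝓘(ℝ, E) x₀).symm) y (Module.finBasis ℝ E i) := by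
  conv_lhs => rw [hκ.eq_sum_deriv_smul hy Y]
  rw [ComplexTangent.deriv_sum]
  refine Finset.sum_congr rfl fun i _ => ?_
  rw [ComplexTangent.deriv_smul, ComplexTangent.deriv_tmul, one_mul,
    (hasFDerivAt_comp_extChartAt_symm (hκ.subset hy) (SmoothFn.mdifferentiableAt f _)).fderiv]
  rfl

namespace IsPoissonBracket

variable {Ω : SymplecticForm E M} {br : SmoothFn E M → SmoothFn E M → SmoothFn E M}
  {P : SmoothFn E M → SmoothFn E M} {Y : (x : M) → ComplexTangent E x}
  {x₀ : M} {V : Set E} {κ : Fin (Module.finrank ℝ E) → SmoothFn E M} {y : E}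

theorem coord_eq_sum (hbr : IsPoissonBracket Ω br) (hκ : IsCoordinateSystem x₀ V κ) (hy : y ∈ V)
    (i : Fin (Module.finrank ℝ E)) (f : SmoothFn E M) :
    (br (κ i) f).1 ((extChartAt 𝓘(ℝ, E) x₀).symm y) =
      ∑ k, (br (κ i) (κ k)).1 ((extChartAt 𝓘(ℝ, E) x₀).symm y) *
        fderiv ℝ (f.1 ∘ (extChartAt 𝓘(ℝ, E) x₀).symm) y (Module.finBasis ℝ E k) := by
  simp only [hbr.apply]
  exact (Ω.hamiltonianField (κ i).1 _).deriv_eq_sum hκ hy f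

theorem fderiv_coord (hbr : IsPoissonBracket Ω br) (hκ : IsCoordinateSystem x₀ V κ) (hy : y ∈ V)
    (hY : ∀ f x, (Y x).deriv f.1 = (P f).1 x) (k j : Fin (Module.finrank ℝ E)) :
    fderiv ℝ ((P (κ j)).1 ∘ (extChartAt 𝓘(ℝ, E) x₀).symm) y (Module.finBasis ℝ E k) =
      -∑ l, (fderiv ℝ ((br (κ j) (κ l)).1 ∘ (extChartAt 𝓘(ℝ, E) x₀).symm) y
          (Module.finBasis ℝ E k) * Ω.contractLocal Y x₀ y (Module.finBasis ℝ E l) +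
        (br (κ j) (κ l)).1 ((extChartAt 𝓘(ℝ, E) x₀).symm y) *
          fderiv ℝ (Ω.contractLocal Y x₀) y (Module.finBasis ℝ E k) (Module.finBasis ℝ E l)) := by
  have hYs : ∀ f ∈ SmoothFn E M, (fun x => (Y x).deriv f) ∈ SmoothFn E M := fun f hf => by
    simpa only [hY ⟨f, hf⟩] using (P ⟨f, hf⟩).2
  have hbracket (l) := (hasFDerivAt_comp_extChartAt_symm (hκ.subset hy)
    (SmoothFn.mdifferentiableAt (br (κ j) (κ l)) _)).differentiableAt.hasFDerivAt
  have hcontract := (((Ω.contDiffOn_contractLocal_of_preserves hκ hYs).contDiffAt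
      (hκ.isOpen.mem_nhds hy)).differentiableAt (by simp)).hasFDerivAt
  have heq : (P (κ j)).1 ∘ (extChartAt 𝓘(ℝ, E) x₀).symm =ᶠ[nhds y]
      fun z => -∑ l, ((br (κ j) (κ l)).1 ∘ (extChartAt 𝓘(ℝ, E) x₀).symm) z *
        Ω.contractLocal Y x₀ z (Module.finBasis ℝ E l) := by
    filter_upwards [hκ.isOpen.mem_nhds hy] with z hz
    simp only [Function.comp_apply, ← hY, hbr.apply]
    exact Ω.deriv_coord_eq_neg_sum hκ hz Y j
  rw [heq.fderiv_eq]
  refine (DFunLike.congr_fun (HasFDerivAt.fun_sum (u := Finset.univ) fun l _ =>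
    (hbracket l).mul (hcontract.clm_apply
      (hasFDerivAt_const (Module.finBasis ℝ E l) y))).neg.fderiv _).trans ?_
  simp [sum_apply, mul_comm, add_comm]

theorem fderiv_contractLocal_basis_comm (hbr : IsPoissonBracket Ω br)
    (hκ : IsCoordinateSystem x₀ V κ) (hy : y ∈ V) (hY : ∀ f x, (Y x).deriv f.1 = (P f).1 x)
    (hP : ∀ f g, P (br f g) = br (P f) g + br f (P g)) (k l : Fin (Module.finrank ℝ E)) :
    fderiv ℝ (Ω.contractLocal Y x₀) y (Module.finBasis ℝ E k) (Module.finBasis ℝ E l) =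
      fderiv ℝ (Ω.contractLocal Y x₀) y (Module.finBasis ℝ E l) (Module.finBasis ℝ E k) := by
  set ψ := (extChartAt 𝓘(ℝ, E) x₀).symm
  set b := Module.finBasis ℝ E
  refine (isSymm_of_jacobi_of_isDerivation (R := Matrix.of fun i j => (br (κ i) (κ j)).1 (ψ y))
    (W := Matrix.of fun i j => (Ω.coefficient x₀ i j y : ℂ))
    (α := fun l => Ω.contractLocal Y x₀ y (b l)) (p := fun i => (P (κ i)).1 (ψ y))
    (dR := fun k i j => fderiv ℝ ((br (κ i) (κ j)).1 ∘ ψ) y (b k))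
    (dα := Matrix.of fun k l => fderiv ℝ (Ω.contractLocal Y x₀) y (b k) (b l))
    (dp := fun k j => fderiv ℝ ((P (κ j)).1 ∘ ψ) y (b k)) ?_ (fun i j => ?_) (fun i => ?_)
    (hbr.fderiv_coord hκ hy hY) (fun i j l => ?_) fun i j => ?_).apply l k
  · ext i j
    rw [Matrix.mul_apply, Matrix.one_apply, ← Ω.sum_poisson_mul_coefficient hκ hy i j]
    simp only [Matrix.of_apply, hbr.apply]
    rfl
  · exact congrArg (fun f : SmoothFn E M => f.1 (ψ y)) (hbr.swap (κ i) (κ j))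
  · simp only [← hY, Matrix.of_apply, hbr.apply]
    exact Ω.deriv_coord_eq_neg_sum hκ hy Y i
  · have hjac : (br (κ i) (br (κ j) (κ l))).1 (ψ y) - (br (κ j) (br (κ i) (κ l))).1 (ψ y) =
        -(br (κ l) (br (κ i) (κ j))).1 (ψ y) :=
      congrArg (fun f : SmoothFn E M => f.1 (ψ y)) (hbr.jacobi (κ i) (κ j) (κ l))
    rwa [hbr.coord_eq_sum hκ hy, hbr.coord_eq_sum hκ hy, hbr.coord_eq_sum hκ hy] at hjac
  · have hder : (P (br (κ i) (κ j))).1 (ψ y) = -(br (κ j) (P (κ i))).1 (ψ y) +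
        (br (κ i) (P (κ j))).1 (ψ y) := by
      rw [hP, hbr.swap (P (κ i))]
      rfl
    rw [hbr.coord_eq_sum hκ hy, hbr.coord_eq_sum hκ hy, ← hY, (Y _).deriv_eq_sum hκ hy] at hder
    simpa only [hY, Matrix.of_apply] using hder

theorem mem_symplecticFields [T2Space M] (hbr : IsPoissonBracket Ω br)
    (hY : ∀ f x, (Y x).deriv f.1 = (P f).1 x)
    (hP : ∀ f g, P (br f g) = br (P f) g + br f (P g)) : Y ∈ Ω.symplecticFields := by
  have hYs : ∀ f ∈ SmoothFn E M, (fun x => (Y x).deriv f) ∈ SmoothFn E M := fun f hf => by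
    simpa only [hY ⟨f, hf⟩] using (P ⟨f, hf⟩).2
  have hsmooth := Ω.isSmooth_contract hYs
  refine ⟨hYs, hsmooth, (isClosed_oneForm_iff hsmooth).2 fun x₀ y hy v w => ?_⟩
  obtain ⟨V, κ, hκ, hV⟩ := exists_isCoordinateSystem hy
  have hflip : fderiv ℝ (Ω.contractLocal Y x₀) y = (fderiv ℝ (Ω.contractLocal Y x₀) y).flip :=
    ContinuousLinearMap.coe_injective <| (Module.finBasis ℝ E).ext fun k =>
      ContinuousLinearMap.coe_injective <| (Module.finBasis ℝ E).ext fun l =>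
        hbr.fderiv_contractLocal_basis_comm hκ hV hY hP k l
  exact DFunLike.congr_fun (DFunLike.congr_fun hflip v) w

end IsPoissonBracket

end PoissonDerivations

/-! ## Local Hamiltonians depending smoothly on parameters -/

section LocalHamiltonian

variable {E : Type*} [NormedAddCommGroup E] [NormedSpace ℝ E]
  {M : Type*} [TopologicalSpace M] [ChartedSpace E M]
  {F : Type*} [NormedAddCommGroup F] [NormedSpace ℝ F]
  {T : Type*} [TopologicalSpace T] [ChartedSpace F T]

/-- Smoothness of a family of complex vector fields in the parameter and the point jointly, tested
on smooth functions. -/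
def IsSmoothFamily (F : Type*) [NormedAddCommGroup F] [NormedSpace ℝ F] [ChartedSpace F T]
    (Y : T → (x : M) → ComplexTangent E x) : Prop :=
  ∀ f : SmoothFn E M, ContMDiff (𝓘(ℝ, F).prod 𝓘(ℝ, E)) 𝓘(ℝ, ℂ) ∞
    fun p : T × M => (Y p.1 p.2).deriv f.1

theorem contDiffOn_comp_prod_extChartAt_symm [IsManifold 𝓘(ℝ, E) ∞ M] [IsManifold 𝓘(ℝ, F) ∞ T]
    {G : Type*} [NormedAddCommGroup G] [NormedSpace ℝ G] {c : T × M → G}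
    (hc : ContMDiff (𝓘(ℝ, F).prod 𝓘(ℝ, E)) 𝓘(ℝ, G) ∞ c) (σ₀ : T) (x₀ : M) :
    ContDiffOn ℝ ∞ (fun p : F × E => c ((extChartAt 𝓘(ℝ, F) σ₀).symm p.1,
      (extChartAt 𝓘(ℝ, E) x₀).symm p.2))
      ((extChartAt 𝓘(ℝ, F) σ₀).target ×ˢ (extChartAt 𝓘(ℝ, E) x₀).target) := by
  refine ContMDiffOn.contDiffOn (hc.comp_contMDiffOn (ContMDiffOn.prodMk ?_ ?_))
  · exact (contMDiffOn_extChartAt_symm σ₀).comp contDiff_fst.contMDiff.contMDiffOn fun p hp => hp.1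
  · exact (contMDiffOn_extChartAt_symm x₀).comp contDiff_snd.contMDiff.contMDiffOn fun p hp => hp.2

namespace SymplecticForm

variable (Ω : SymplecticForm E M)

/-- The primitive of `ι_Y Ω` around `x₀` obtained by integrating along segments from `x₀` in the
preferred chart at `x₀`. -/
def radialPrimitive (Y : (x : M) → ComplexTangent E x) (x₀ x : M) : ℂ :=
  ∫ᶜ z in .segment (extChartAt 𝓘(ℝ, E) x₀ x₀) (extChartAt 𝓘(ℝ, E) x₀ x), Ω.contractLocal Y x₀ z

theorem hasFDerivAt_radialPrimitive {Y : (x : M) → ComplexTangent E x}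
    (hY : Y ∈ Ω.symplecticFields) {x₀ : M} {R : ℝ}
    (hR : Metric.ball (extChartAt 𝓘(ℝ, E) x₀ x₀) R ⊆ (extChartAt 𝓘(ℝ, E) x₀).target) {y : E}
    (hy : y ∈ Metric.ball (extChartAt 𝓘(ℝ, E) x₀ x₀) R) :
    HasFDerivAt (Ω.radialPrimitive Y x₀ ∘ (extChartAt 𝓘(ℝ, E) x₀).symm)
      (Ω.contractLocal Y x₀ y) y := by
  have hdiff (z) (hz : z ∈ Metric.ball (extChartAt 𝓘(ℝ, E) x₀ x₀) R) :=
    (differentiableAt_localForm hY.2.1 (hR hz)).hasFDerivAt.hasFDerivWithinAt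
      (s := Metric.ball (extChartAt 𝓘(ℝ, E) x₀ x₀) R)
  have hprimitive := (convex_ball _ R
    ).hasFDerivWithinAt_curveIntegral_segment_of_hasFDerivWithinAt_symmetric hdiff
    (fun z hz v _ w _ => (isClosed_oneForm_iff hY.2.1).1 hY.2.2 x₀ z (hR hz) v w)
    (Metric.mem_ball_self (Metric.pos_of_mem_ball hy)) hy
  have hball := Metric.isOpen_ball.mem_nhds hy
  refine (hprimitive.hasFDerivAt hball).congr_of_eventuallyEq ?_
  filter_upwards [hball] with z hz
  rw [Function.comp_apply, radialPrimitive, (extChartAt 𝓘(ℝ, E) x₀).right_inv (hR hz)]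
  rfl

theorem eq_hamiltonianField_of_hasFDerivAt [FiniteDimensional ℝ E] [IsManifold 𝓘(ℝ, E) ∞ M]
    {Y : (x : M) → ComplexTangent E x} {x₀ : M} {y : E}
    (hy : y ∈ (extChartAt 𝓘(ℝ, E) x₀).target) {f : M → ℂ}
    (hf : MDifferentiableAt 𝓘(ℝ, E) 𝓘(ℝ, ℂ) f ((extChartAt 𝓘(ℝ, E) x₀).symm y))
    (hfY : HasFDerivAt (f ∘ (extChartAt 𝓘(ℝ, E) x₀).symm) (Ω.contractLocal Y x₀ y) y) :
    Y ((extChartAt 𝓘(ℝ, E) x₀).symm y) =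
      Ω.hamiltonianField f ((extChartAt 𝓘(ℝ, E) x₀).symm y) := by
  have hforms := hfY.unique (hasFDerivAt_comp_extChartAt_symm hy hf)
  obtain ⟨e, he⟩ := isInvertible_chartDeriv hy
  simp only [contractLocal, localForm, ← he] at hforms
  refine Ω.eq_hamiltonianField_iff.2 (ContinuousLinearMap.ext fun v => ?_)
  obtain ⟨w, rfl⟩ := e.surjective v
  exact DFunLike.congr_fun hforms w

variable [FiniteDimensional ℝ E] [FiniteDimensional ℝ F]
  [IsManifold 𝓘(ℝ, E) ∞ M] [IsManifold 𝓘(ℝ, F) ∞ T]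
  {Y : T → (x : M) → ComplexTangent E x} {x₀ : M} {V : Set E}
  {κ : Fin (Module.finrank ℝ E) → SmoothFn E M} {R : ℝ}

theorem contDiffOn_curveIntegral_contractLocal (hY : IsSmoothFamily F Y)
    (hκ : IsCoordinateSystem x₀ V κ) (hR : Metric.ball (extChartAt 𝓘(ℝ, E) x₀ x₀) R ⊆ V) (σ₀ : T) :
    ContDiffOn ℝ ∞ (fun p : F × E => ∫ᶜ z in .segment (extChartAt 𝓘(ℝ, E) x₀ x₀) p.2,
        Ω.contractLocal (Y ((extChartAt 𝓘(ℝ, F) σ₀).symm p.1)) x₀ z)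
      ((extChartAt 𝓘(ℝ, F) σ₀).target ×ˢ Metric.ball (extChartAt 𝓘(ℝ, E) x₀ x₀) R) := by
  set y₀ := extChartAt 𝓘(ℝ, E) x₀ x₀
  set s := (extChartAt 𝓘(ℝ, F) σ₀).target ×ˢ Metric.ball y₀ R
  have hs : IsOpen s := (isOpen_extChartAt_target σ₀).prod Metric.isOpen_ball
  have hcontract : ContDiffOn ℝ ∞ (fun q : (F × E) × E =>
      Ω.contractLocal (Y ((extChartAt 𝓘(ℝ, F) σ₀).symm q.1.1)) x₀ q.1.2 q.2) (s ×ˢ Set.univ) :=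
    (Ω.contDiffOn_contractLocal hκ (π := fun q : (F × E) × E => q.1.2)
      (Y := fun q : (F × E) × E => Y ((extChartAt 𝓘(ℝ, F) σ₀).symm q.1.1))
      (contDiff_snd.comp contDiff_fst).contDiffOn (fun q hq => hR hq.1.2) fun i =>
        (contDiffOn_comp_prod_extChartAt_symm (hY (κ i)) σ₀ x₀).comp
          contDiff_fst.contDiffOn fun q hq => ⟨hq.1.1, hκ.subset (hR hq.1.2)⟩).clm_apply
      contDiff_snd.contDiffOn
  let segment : (F × E) × ℝ → (F × E) × E :=
    fun q => ((q.1.1, y₀ + q.2 • (q.1.2 - y₀)), q.1.2 - y₀)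
  have hsegment : Set.MapsTo segment (s ×ˢ Set.uIcc 0 1) (s ×ˢ Set.univ) := fun q hq =>
    ⟨⟨hq.1.1, (convex_ball y₀ R).add_smul_sub_mem
      (Metric.mem_ball_self (Metric.pos_of_mem_ball hq.1.2)) hq.1.2
      (Set.uIcc_of_le (zero_le_one (α := ℝ)) ▸ hq.2)⟩, Set.mem_univ _⟩
  refine (contDiffOn_intervalIntegral_comp hs (hs.prod isOpen_univ) hcontract
    (h := segment) (by fun_prop) hsegment).congr fun p _ => ?_
  simp only [curveIntegral_segment, AffineMap.lineMap_apply_module', add_comm, segment]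

theorem contMDiffAt_radialPrimitive (hY : IsSmoothFamily F Y) (hκ : IsCoordinateSystem x₀ V κ)
    (hR : Metric.ball (extChartAt 𝓘(ℝ, E) x₀ x₀) R ⊆ V) {p : T × M}
    (hp : p.2 ∈ chartBall (E := E) x₀ R) :
    ContMDiffAt (𝓘(ℝ, F).prod 𝓘(ℝ, E)) 𝓘(ℝ, ℂ) ∞
      (fun p : T × M => Ω.radialPrimitive (Y p.1) x₀ p.2) p := by
  obtain ⟨σ₀, x⟩ := p
  have hlocal := (Ω.contDiffOn_curveIntegral_contractLocal hY hκ hR σ₀).contDiffAt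
    (x := (extChartAt 𝓘(ℝ, F) σ₀ σ₀, extChartAt 𝓘(ℝ, E) x₀ x))
    (((isOpen_extChartAt_target σ₀).prod Metric.isOpen_ball).mem_nhds
      ⟨mem_extChartAt_target σ₀, hp.2⟩)
  have hchart : ContMDiffAt (𝓘(ℝ, F).prod 𝓘(ℝ, E)) 𝓘(ℝ, F × E) ∞
      (fun p : T × M => (extChartAt 𝓘(ℝ, F) σ₀ p.1, extChartAt 𝓘(ℝ, E) x₀ p.2)) (σ₀, x) :=
    ContMDiffAt.prodMk_space
      ((contMDiffAt_extChartAt (x := σ₀)).comp (σ₀, x) contMDiffAt_fst)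
      ((contMDiffAt_extChartAt' (by simpa using hp.1)).comp (σ₀, x) contMDiffAt_snd)
  refine (hlocal.contMDiffAt.comp (σ₀, x) hchart).congr_of_eventuallyEq ?_
  filter_upwards [continuous_fst.continuousAt.preimage_mem_nhds
    (extChartAt_source_mem_nhds (I := 𝓘(ℝ, F)) σ₀)] with q hq
  simp only [Function.comp_apply, (extChartAt 𝓘(ℝ, F) σ₀).left_inv hq]
  rfl

variable (F T) in
theorem exists_smooth_hamiltonian [T2Space M] (x₀ : M) : ∃ r > 0,
    Metric.ball (extChartAt 𝓘(ℝ, E) x₀ x₀) r ⊆ (extChartAt 𝓘(ℝ, E) x₀).target ∧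
    ∀ Y : T → (x : M) → ComplexTangent E x, (∀ σ, Y σ ∈ Ω.symplecticFields) →
      IsSmoothFamily F Y →
      ∃ b : T × M → ℂ, ContMDiff (𝓘(ℝ, F).prod 𝓘(ℝ, E)) 𝓘(ℝ, ℂ) ∞ b ∧
        ∀ σ, ∀ x ∈ chartBall (E := E) x₀ r, Y σ x = Ω.hamiltonianField (fun x => b (σ, x)) x := by
  obtain ⟨V, κ, hκ, hV⟩ := exists_isCoordinateSystem (mem_extChartAt_target (I := 𝓘(ℝ, E)) x₀)
  obtain ⟨R, hR0, hR⟩ := Metric.mem_nhds_iff.1 (hκ.isOpen.mem_nhds hV)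
  obtain ⟨χ, hχ, hχU, r, hr, -, hχ_one⟩ := exists_cutoff (E := E)
    ((isOpen_chartBall (E := E) x₀ R).mem_nhds (mem_chartBall x₀ hR0))
  have hball : Metric.ball (extChartAt 𝓘(ℝ, E) x₀ x₀) (min r R) ⊆
      Metric.ball (extChartAt 𝓘(ℝ, E) x₀ x₀) R := Metric.ball_subset_ball (min_le_right _ _)
  have htarget := hball.trans (hR.trans hκ.subset)
  refine ⟨min r R, lt_min hr hR0, htarget, fun Y hYs hY => ?_⟩
  have hb : ContMDiff (𝓘(ℝ, F).prod 𝓘(ℝ, E)) 𝓘(ℝ, ℂ) ∞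
      (fun p : T × M => χ p.2 • Ω.radialPrimitive (Y p.1) x₀ p.2) :=
    contMDiff_cutoff_smul contMDiff_snd hχ hχU fun p hp =>
      Ω.contMDiffAt_radialPrimitive hY hκ hR hp
  refine ⟨_, hb, fun σ x hx => ?_⟩
  have hbσ : ContMDiff 𝓘(ℝ, E) 𝓘(ℝ, ℂ) ∞ (fun x => χ x • Ω.radialPrimitive (Y σ) x₀ x) :=
    hb.comp (contMDiff_const.prodMk contMDiff_id)
  obtain ⟨y, hy, rfl⟩ : ∃ y ∈ Metric.ball (extChartAt 𝓘(ℝ, E) x₀ x₀) (min r R),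
      (extChartAt 𝓘(ℝ, E) x₀).symm y = x := ⟨_, hx.2, (extChartAt 𝓘(ℝ, E) x₀).left_inv hx.1⟩
  refine Ω.eq_hamiltonianField_of_hasFDerivAt (htarget hy) (hbσ.mdifferentiable (by simp) _) <|
    (Ω.hasFDerivAt_radialPrimitive (hYs σ) (hR.trans hκ.subset) (hball hy)).congr_of_eventuallyEq ?_
  filter_upwards [Metric.isOpen_ball.mem_nhds hy] with z hz
  have hχz := hχ_one _ (chartBall_mono x₀ (min_le_left r R)
    (extChartAt_symm_mem_chartBall htarget hz))
  rw [Function.comp_apply, hχz, one_smul, Function.comp_apply]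

end SymplecticForm

end LocalHamiltonian

section Hamiltonians

variable {E : Type*} [NormedAddCommGroup E] [NormedSpace ℝ E]
  {M : Type*} [TopologicalSpace M] [ChartedSpace E M]
  {F : Type*} [NormedAddCommGroup F] [NormedSpace ℝ F]
  {T : Type*} [TopologicalSpace T] [ChartedSpace F T]

theorem diffAt_add (f g : SmoothFn E M) (x : M) :
    diffAt (E := E) (f + g).1 x = diffAt f.1 x + diffAt g.1 x :=
  ((SmoothFn.mdifferentiableAt f x).hasMFDerivAt.add
      (SmoothFn.mdifferentiableAt g x).hasMFDerivAt).mfderiv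

theorem diffAt_const (c : ℂ) (x : M) : diffAt (E := E) (fun _ : M => c) x = 0 :=
  mfderiv_const

theorem diffAt_smul (c : ℂ) (f : SmoothFn E M) (x : M) :
    diffAt (E := E) (c • f).1 x = c • diffAt f.1 x := by
  ext v
  have h := ComplexTangent.deriv_fn_smul ((1 : ℂ) ⊗ₜ[ℝ] v : ComplexTangent E x) c f
  rwa [ComplexTangent.deriv_tmul, ComplexTangent.deriv_tmul, one_mul, one_mul] at h

theorem diffAt_ofReal {u : M → ℝ} {x : M} (hu : MDifferentiableAt 𝓘(ℝ, E) 𝓘(ℝ, ℝ) u x) :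
    diffAt (E := E) (fun x => (u x : ℂ)) x = Complex.ofRealCLM.comp
      (mfderiv 𝓘(ℝ, E) 𝓘(ℝ, ℝ) u x : TangentSpace 𝓘(ℝ, E) x →L[ℝ] ℝ) :=
  (Complex.ofRealCLM.hasFDerivAt.hasMFDerivAt.comp x hu.hasMFDerivAt).mfderiv

section

variable {G G' : Type*} [NormedAddCommGroup G] [NormedSpace ℝ G] [NormedAddCommGroup G']
  [NormedSpace ℝ G'] {α : (x : M) → TangentSpace 𝓘(ℝ, E) x →L[ℝ] G}

theorem isSmooth_oneForm_comp (L : G →L[ℝ] G') (hα : (oneForm α).IsSmooth) :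
    (oneForm fun x => L.comp (α x)).IsSmooth :=
  (isSmooth_oneForm_iff _).2 fun x₀ =>
    contDiffOn_const.clm_comp ((isSmooth_oneForm_iff α).1 hα x₀)

theorem isClosed_oneForm_comp (L : G →L[ℝ] G') (hα : (oneForm α).IsSmooth)
    (hα_closed : (oneForm α).IsClosed) : (oneForm fun x => L.comp (α x)).IsClosed := by
  refine (isClosed_oneForm_iff (isSmooth_oneForm_comp L hα)).2 fun x₀ y hy v w => ?_
  have hderiv : HasFDerivAt (localForm (fun x => L.comp (α x)) x₀)
      ((ContinuousLinearMap.compL ℝ E G G' L).comp (fderiv ℝ (localForm α x₀) y)) y :=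
    (ContinuousLinearMap.compL ℝ E G G' L).hasFDerivAt.comp y
      (differentiableAt_localForm hα hy).hasFDerivAt
  rw [hderiv.fderiv]
  exact congrArg L ((isClosed_oneForm_iff hα).1 hα_closed x₀ y hy v w)

end

theorem exists_mfderiv_eq (hH : Subsingleton (DeRhamH1 E M))
    {α : (x : M) → TangentSpace 𝓘(ℝ, E) x →L[ℝ] ℝ} (hα : (oneForm α).IsSmooth)
    (hα_closed : (oneForm α).IsClosed) :
    ∃ f : M → ℝ, ContMDiff 𝓘(ℝ, E) 𝓘(ℝ, ℝ) ∞ f ∧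
      ∀ x, mfderiv 𝓘(ℝ, E) 𝓘(ℝ, ℝ) f x = α x := by
  have hzero : (Submodule.Quotient.mk (⟨oneForm α, hα, hα_closed⟩ : closedOneForms E M) :
      DeRhamH1 E M) = 0 := Subsingleton.elim _ _
  rw [Submodule.Quotient.mk_eq_zero] at hzero
  obtain ⟨f, hf, hfα⟩ := hzero
  exact ⟨f, hf, fun x => (ContinuousAlternatingMap.ofSubsingleton ℝ
    (TangentSpace 𝓘(ℝ, E) x) ℝ (0 : Fin 1)).injective (congrFun hfα x)⟩

theorem exists_diffAt_eq (hH : Subsingleton (DeRhamH1 E M))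
    {α : (x : M) → TangentSpace 𝓘(ℝ, E) x →L[ℝ] ℂ} (hα : (oneForm α).IsSmooth)
    (hα_closed : (oneForm α).IsClosed) : ∃ f : SmoothFn E M, ∀ x, diffAt f.1 x = α x := by
  have hpart (L : ℂ →L[ℝ] ℝ) : ∃ f : M → ℝ, ContMDiff 𝓘(ℝ, E) 𝓘(ℝ, ℝ) ∞ f ∧
      ∀ x, mfderiv 𝓘(ℝ, E) 𝓘(ℝ, ℝ) f x = L.comp (α x) :=
    exists_mfderiv_eq hH (isSmooth_oneForm_comp L hα) (isClosed_oneForm_comp L hα hα_closed)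
  obtain ⟨u, hu, hu_deriv⟩ := hpart Complex.reCLM
  obtain ⟨v, hv, hv_deriv⟩ := hpart Complex.imCLM
  let u' : SmoothFn E M := ⟨fun x => (u x : ℂ), Complex.ofRealCLM.contDiff.comp_contMDiff hu⟩
  let v' : SmoothFn E M := ⟨fun x => (v x : ℂ), Complex.ofRealCLM.contDiff.comp_contMDiff hv⟩
  refine ⟨u' + Complex.I • v', fun x => ?_⟩
  rw [diffAt_add, diffAt_smul]
  simp only [u', v', diffAt_ofReal (hu.mdifferentiable (by simp) x),
    diffAt_ofReal (hv.mdifferentiable (by simp) x), hu_deriv, hv_deriv]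
  ext w
  exact (congrArg _ (mul_comm _ _)).trans (Complex.re_add_im _)

theorem contMDiff_of_locally_eq_add_const [PreconnectedSpace M] {b : T × M → ℂ}
    (hb : ∀ x₀ : M, ∃ U, IsOpen U ∧ x₀ ∈ U ∧ ∃ c : T × M → ℂ,
      ContMDiff (𝓘(ℝ, F).prod 𝓘(ℝ, E)) 𝓘(ℝ, ℂ) ∞ c ∧
        ∀ σ, ∀ x ∈ U, ∀ x' ∈ U, b (σ, x) - c (σ, x) = b (σ, x') - c (σ, x'))
    {x₁ : M} (hx₁ : ContMDiff 𝓘(ℝ, F) 𝓘(ℝ, ℂ) ∞ fun σ => b (σ, x₁)) :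
    ContMDiff (𝓘(ℝ, F).prod 𝓘(ℝ, E)) 𝓘(ℝ, ℂ) ∞ b := by
  choose U hU hmem c hc hbc using hb
  have hspread {x₀ x x' : M} (hx : x ∈ U x₀)
      (hslice : ContMDiff 𝓘(ℝ, F) 𝓘(ℝ, ℂ) ∞ fun σ => b (σ, x)) (hx' : x' ∈ U x₀) (σ : T) :
      ContMDiffAt (𝓘(ℝ, F).prod 𝓘(ℝ, E)) 𝓘(ℝ, ℂ) ∞ b (σ, x') := by
    have hsmooth : ContMDiff (𝓘(ℝ, F).prod 𝓘(ℝ, E)) 𝓘(ℝ, ℂ) ∞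
        fun p : T × M => c x₀ p + (b (p.1, x) - c x₀ (p.1, x)) :=
      (hc x₀).add ((hslice.comp contMDiff_fst).sub
        ((hc x₀).comp (contMDiff_fst.prodMk contMDiff_const)))
    refine (hsmooth (σ, x')).congr_of_eventuallyEq ?_
    filter_upwards [continuous_snd.continuousAt.preimage_mem_nhds ((hU x₀).mem_nhds hx')]
      with p hp
    rw [← hbc x₀ p.1 p.2 hp x hx, add_sub_cancel]
  have hslice {x₀ x x' : M} (hx : x ∈ U x₀) (hx' : x' ∈ U x₀)
      (h : ContMDiff 𝓘(ℝ, F) 𝓘(ℝ, ℂ) ∞ fun σ => b (σ, x)) :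
      ContMDiff 𝓘(ℝ, F) 𝓘(ℝ, ℂ) ∞ fun σ => b (σ, x') := fun σ =>
    (hspread hx h hx' σ).comp σ (contMDiffAt_id.prodMk contMDiffAt_const)
  have hconst : IsLocallyConstant fun x => ContMDiff 𝓘(ℝ, F) 𝓘(ℝ, ℂ) ∞ fun σ => b (σ, x) := by
    refine (IsLocallyConstant.iff_eventually_eq _).2 fun x₀ => ?_
    filter_upwards [(hU x₀).mem_nhds (hmem x₀)] with x hx
    exact propext ⟨hslice hx (hmem x₀), hslice (hmem x₀) hx⟩
  intro p
  have hp := (hconst.apply_eq_of_preconnectedSpace x₁ p.2).mp hx₁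
  exact hspread (hmem p.2) hp (hmem p.2) p.1

namespace SymplecticForm

variable (Ω : SymplecticForm E M) [FiniteDimensional ℝ E]

theorem flatComplex_hamiltonianField_eq_diffAt (f : M → ℂ) (x : M) :
    Ω.flatComplex x (Ω.hamiltonianField f x) = diffAt f x :=
  Ω.flatComplex_hamiltonianField f x

theorem hamiltonianField_add (f g : SmoothFn E M) (x : M) :
    Ω.hamiltonianField (f + g).1 x = Ω.hamiltonianField f.1 x + Ω.hamiltonianField g.1 x := by
  refine Eq.symm (Ω.eq_hamiltonianField_iff.2 ?_)
  rw [map_add, flatComplex_hamiltonianField_eq_diffAt, flatComplex_hamiltonianField_eq_diffAt,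
    diffAt_add]

theorem hamiltonianField_smul (c : ℂ) (f : SmoothFn E M) (x : M) :
    Ω.hamiltonianField (c • f).1 x = c • Ω.hamiltonianField f.1 x := by
  refine Eq.symm (Ω.eq_hamiltonianField_iff.2 ?_)
  rw [map_smul, flatComplex_hamiltonianField_eq_diffAt, diffAt_smul]

theorem hamiltonianField_sub (f g : SmoothFn E M) (x : M) :
    Ω.hamiltonianField (f - g).1 x = Ω.hamiltonianField f.1 x - Ω.hamiltonianField g.1 x := by
  have hneg : f - g = f + (-1 : ℂ) • g := by rw [neg_one_smul, sub_eq_add_neg]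
  rw [hneg, hamiltonianField_add, hamiltonianField_smul, neg_one_smul, sub_eq_add_neg]

theorem hamiltonianField_const (c : ℂ) (x : M) : Ω.hamiltonianField (fun _ => c) x = 0 := by
  refine Eq.symm (Ω.eq_hamiltonianField_iff.2 ?_)
  rw [map_zero, diffAt_const]

theorem hamiltonianField_eq_zero_iff {f : M → ℂ} {x : M} :
    Ω.hamiltonianField f x = 0 ↔ diffAt (E := E) f x = 0 := by
  rw [eq_comm, eq_hamiltonianField_iff, map_zero, eq_comm]

theorem exists_hamiltonian_of_subsingleton (hH : Subsingleton (DeRhamH1 E M))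
    {Y : (x : M) → ComplexTangent E x} (hY : Y ∈ Ω.symplecticFields) :
    ∃ b : SmoothFn E M, ∀ x, Y x = Ω.hamiltonianField b.1 x := by
  obtain ⟨b, hb⟩ := exists_diffAt_eq hH hY.2.1 hY.2.2
  exact ⟨b, fun x => Ω.eq_hamiltonianField_iff.2 (hb x).symm⟩

variable [IsManifold 𝓘(ℝ, E) ∞ M]

theorem eq_of_hamiltonianField_eq_zero {f : SmoothFn E M} {x₀ : M} {r : ℝ}
    (hr : Metric.ball (extChartAt 𝓘(ℝ, E) x₀ x₀) r ⊆ (extChartAt 𝓘(ℝ, E) x₀).target)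
    (h : ∀ x ∈ chartBall (E := E) x₀ r, Ω.hamiltonianField f.1 x = 0) {x x' : M}
    (hx : x ∈ chartBall (E := E) x₀ r) (hx' : x' ∈ chartBall (E := E) x₀ r) : f.1 x = f.1 x' :=
  eq_of_mfderiv_eq_zero_on_chartBall hr (fun x => SmoothFn.mdifferentiableAt f x)
    (fun x hx => Ω.hamiltonianField_eq_zero_iff.1 (h x hx)) hx hx'

theorem eq_of_hamiltonianField_eq_zero_of_preconnected [PreconnectedSpace M] {f : SmoothFn E M}
    (h : ∀ x, Ω.hamiltonianField f.1 x = 0) (x x' : M) : f.1 x = f.1 x' := by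
  refine IsLocallyConstant.apply_eq_of_preconnectedSpace
    ((IsLocallyConstant.iff_exists_open _).2 fun x₀ => ?_) x x'
  obtain ⟨r, hr, hrt, -⟩ := exists_chartBall_subset (E := E) (Filter.univ_mem (f := nhds x₀))
  exact ⟨_, isOpen_chartBall x₀ r, mem_chartBall x₀ hr, fun y hy =>
    Ω.eq_of_hamiltonianField_eq_zero hrt (fun x _ => h x) hy (mem_chartBall x₀ hr)⟩

theorem contMDiff_hamiltonian_family [T2Space M] [FiniteDimensional ℝ F] [IsManifold 𝓘(ℝ, F) ∞ T]
    [PreconnectedSpace M] {Y : T → (x : M) → ComplexTangent E x}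
    (hYs : ∀ σ, Y σ ∈ Ω.symplecticFields) (hY : IsSmoothFamily F Y)
    {b : T → SmoothFn E M} (hb : ∀ σ x, Y σ x = Ω.hamiltonianField (b σ).1 x) {x₁ : M}
    (hx₁ : ContMDiff 𝓘(ℝ, F) 𝓘(ℝ, ℂ) ∞ fun σ => (b σ).1 x₁) :
    ContMDiff (𝓘(ℝ, F).prod 𝓘(ℝ, E)) 𝓘(ℝ, ℂ) ∞ fun p : T × M => (b p.1).1 p.2 := by
  refine contMDiff_of_locally_eq_add_const (fun x₀ => ?_) hx₁
  obtain ⟨r, hr, hrt, hH⟩ := Ω.exists_smooth_hamiltonian F T x₀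
  obtain ⟨c, hc, hcY⟩ := hH Y hYs hY
  refine ⟨_, isOpen_chartBall (E := E) x₀ r, mem_chartBall x₀ hr, c, hc, fun σ x hx x' hx' => ?_⟩
  have hcσ : ContMDiff 𝓘(ℝ, E) 𝓘(ℝ, ℂ) ∞ fun x => c (σ, x) :=
    hc.comp (contMDiff_const.prodMk contMDiff_id)
  exact Ω.eq_of_hamiltonianField_eq_zero (f := b σ - ⟨_, hcσ⟩) hrt
    (fun x hx => by rw [hamiltonianField_sub, ← hb, ← hcY σ x hx, sub_self]) hx hx'

end SymplecticForm

end Hamiltonians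

section Formal

variable {E : Type*} [NormedAddCommGroup E] [NormedSpace ℝ E]
  {M : Type*} [TopologicalSpace M] [ChartedSpace E M]

namespace FormalFn

theorem smul_eq_mul_map (p : ℂ⟦X⟧) (f : FormalFn E M) :
    p • f = PowerSeries.map (algebraMap ℂ (SmoothFn E M)) p * f := rfl

theorem complex_smul_eq (a : ℂ) (f : FormalFn E M) : a • f = (a • (1 : ℂ⟦X⟧)) • f := by
  rw [smul_assoc, one_smul]

theorem X_pow_smul (n : ℕ) (f : FormalFn E M) :
    (PowerSeries.X ^ n : ℂ⟦X⟧) • f = PowerSeries.X ^ n * f := by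
  rw [smul_eq_mul_map, map_pow, PowerSeries.map_X]

theorem X_smul (f : FormalFn E M) : (PowerSeries.X : ℂ⟦X⟧) • f = PowerSeries.X * f := by
  simpa using X_pow_smul 1 f

theorem coeff_zero_X_smul (f : FormalFn E M) :
    PowerSeries.coeff 0 ((PowerSeries.X : ℂ⟦X⟧) • f) = 0 := by
  rw [X_smul, PowerSeries.coeff_zero_X_mul]

theorem coeff_succ_X_smul (n : ℕ) (f : FormalFn E M) :
    PowerSeries.coeff (n + 1) ((PowerSeries.X : ℂ⟦X⟧) • f) = PowerSeries.coeff n f := by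
  rw [X_smul, PowerSeries.coeff_succ_X_mul]

theorem coeff_X_pow_smul_add (m n : ℕ) (f : FormalFn E M) :
    PowerSeries.coeff (n + m) ((PowerSeries.X ^ m : ℂ⟦X⟧) • f) = PowerSeries.coeff n f := by
  rw [X_pow_smul, PowerSeries.coeff_X_pow_mul]

theorem coeff_X_pow_smul_self (m : ℕ) (f : FormalFn E M) :
    PowerSeries.coeff m ((PowerSeries.X ^ m : ℂ⟦X⟧) • f) = PowerSeries.coeff 0 f := by
  simpa only [zero_add] using coeff_X_pow_smul_add m 0 f

theorem coeff_X_pow_smul_of_lt {m k : ℕ} (hk : k < m) (f : FormalFn E M) :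
    PowerSeries.coeff k ((PowerSeries.X ^ m : ℂ⟦X⟧) • f) = 0 := by
  rw [X_pow_smul, PowerSeries.coeff_X_pow_mul', if_neg (by omega)]

theorem exists_eq_X_pow_smul {f : FormalFn E M} {m : ℕ}
    (hf : ∀ k < m, PowerSeries.coeff k f = 0) :
    ∃ g : FormalFn E M, f = (PowerSeries.X ^ m : ℂ⟦X⟧) • g := by
  obtain ⟨g, hg⟩ := PowerSeries.X_pow_dvd_iff.2 hf
  exact ⟨g, by rw [X_pow_smul, hg]⟩

theorem X_smul_injective :
    Function.Injective fun f : FormalFn E M => (PowerSeries.X : ℂ⟦X⟧) • f := fun f g hfg => by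
  ext1 n
  rw [← coeff_succ_X_smul, ← coeff_succ_X_smul n g]
  exact congrArg (PowerSeries.coeff (n + 1)) hfg

/-- The formal function `(f - f₀) / h`. -/
def shift (f : FormalFn E M) : FormalFn E M := PowerSeries.mk fun n => PowerSeries.coeff (n + 1) f

theorem eq_C_add_X_smul (f : FormalFn E M) :
    f = PowerSeries.C (PowerSeries.coeff 0 f) + (PowerSeries.X : ℂ⟦X⟧) • shift f := by
  rw [X_smul, add_comm, PowerSeries.coeff_zero_eq_constantCoeff_apply]
  exact PowerSeries.eq_X_mul_shift_add_const f

theorem X_smul_shift {f : FormalFn E M} (hf : PowerSeries.coeff 0 f = 0) :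
    (PowerSeries.X : ℂ⟦X⟧) • shift f = f := by
  conv_rhs => rw [eq_C_add_X_smul f, hf, map_zero, zero_add]

/-- The value of a formal function at a point. -/
def ev (x : M) : FormalFn E M →ₗ[ℂ⟦X⟧] ℂ⟦X⟧ where
  toFun := PowerSeries.map ((Pi.evalRingHom (fun _ : M => ℂ) x).comp (SmoothFn E M).subtype)
  map_add' := map_add _
  map_smul' p f := by
    rw [smul_eq_mul_map, map_mul, RingHom.id_apply, smul_eq_mul]
    congr 1

theorem coeff_ev (x : M) (f : FormalFn E M) (n : ℕ) :
    PowerSeries.coeff n (ev x f) = (PowerSeries.coeff n f : SmoothFn E M).1 x :=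
  PowerSeries.coeff_map ((Pi.evalRingHom (fun _ : M => ℂ) x).comp (SmoothFn E M).subtype) n f

theorem ev_eq_iff {x : M} {f g : FormalFn E M} :
    ev x f = ev x g ↔ ∀ n, (PowerSeries.coeff n f : SmoothFn E M).1 x =
      (PowerSeries.coeff n g : SmoothFn E M).1 x := by
  simp only [PowerSeries.ext_iff, coeff_ev]

theorem ev_one (x : M) : ev x (1 : FormalFn E M) = 1 :=
  map_one (PowerSeries.map ((Pi.evalRingHom (fun _ : M => ℂ) x).comp (SmoothFn E M).subtype))

theorem ev_smul_one (x : M) (p : ℂ⟦X⟧) : ev x (p • (1 : FormalFn E M)) = p := by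
  rw [map_smul, ev_one, smul_eq_mul, mul_one]

theorem ext_ev {f g : FormalFn E M} (hfg : ∀ x, ev x f = ev x g) : f = g := by
  ext n x
  exact ev_eq_iff.1 (hfg x) n

end FormalFn

open FormalFn

theorem commutatorMul_add (P Q : SmoothFn E M →ₗ[ℂ] SmoothFn E M) (g : SmoothFn E M) :
    commutatorMul (P + Q) g = commutatorMul P g + commutatorMul Q g := by
  ext f : 1
  simp only [commutatorMul, LinearMap.sub_apply, LinearMap.comp_apply, LinearMap.add_apply,
    map_add]
  abel

theorem commutatorMul_neg (P : SmoothFn E M →ₗ[ℂ] SmoothFn E M) (g : SmoothFn E M) :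
    commutatorMul (-P) g = -commutatorMul P g := by
  ext f : 1
  simp only [commutatorMul, LinearMap.sub_apply, LinearMap.comp_apply, LinearMap.neg_apply,
    map_neg]
  abel

theorem commutatorMul_apply_congr {P Q : SmoothFn E M →ₗ[ℂ] SmoothFn E M} {x : M}
    (hPQ : ∀ f, (P f).1 x = (Q f).1 x) (g f : SmoothFn E M) :
    (commutatorMul P g f).1 x = (commutatorMul Q g f).1 x := by
  change (P (g * f)).1 x - g.1 x * (P f).1 x = (Q (g * f)).1 x - g.1 x * (Q f).1 x
  rw [hPQ, hPQ]

namespace IsDiffOp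

variable {k : ℕ} {P Q : SmoothFn E M →ₗ[ℂ] SmoothFn E M}

theorem add (hP : IsDiffOp k P) (hQ : IsDiffOp k Q) : IsDiffOp k (P + Q) := by
  induction k generalizing P Q with
  | zero => exact fun g => by rw [commutatorMul_add, hP, hQ, add_zero]
  | succ k ih => exact fun g => commutatorMul_add P Q g ▸ ih (hP g) (hQ g)

theorem neg (hP : IsDiffOp k P) : IsDiffOp k (-P) := by
  induction k generalizing P with
  | zero => exact fun g => by rw [commutatorMul_neg, hP]; exact LinearMap.ext fun _ => neg_zero
  | succ k ih => exact fun g => commutatorMul_neg P g ▸ ih (hP g)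

theorem succ (hP : IsDiffOp k P) : IsDiffOp (k + 1) P := by
  induction k generalizing P with
  | zero =>
    intro g g'
    rw [hP g]
    ext f : 1
    simp [commutatorMul]
  | succ k ih => exact fun g => ih (hP g)

theorem of_pointwise (hP : ∀ x, ∃ Q : SmoothFn E M →ₗ[ℂ] SmoothFn E M,
    IsDiffOp k Q ∧ ∀ f, (P f).1 x = (Q f).1 x) : IsDiffOp k P := by
  induction k generalizing P with
  | zero =>
    intro g
    ext f x
    obtain ⟨Q, hQ, hPQ⟩ := hP x
    rw [commutatorMul_apply_congr hPQ, hQ g]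
  | succ k ih =>
    refine fun g => ih fun x => ?_
    obtain ⟨Q, hQ, hPQ⟩ := hP x
    exact ⟨commutatorMul Q g, hQ g, commutatorMul_apply_congr hPQ g⟩

end IsDiffOp

namespace FormalOp

variable {A B : FormalOp E M} {m : ℕ}

theorem coeff_apply (B : FormalOp E M) (k : ℕ) (f : SmoothFn E M) :
    B.coeff k f = PowerSeries.coeff k (B (PowerSeries.C f)) := rfl

theorem coeff_add (A B : FormalOp E M) (k : ℕ) : (A + B).coeff k = A.coeff k + B.coeff k := by
  ext f : 1
  simp only [coeff_apply, LinearMap.add_apply, map_add]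

theorem coeff_sub (A B : FormalOp E M) (k : ℕ) : (A - B).coeff k = A.coeff k + -B.coeff k := by
  ext f : 1
  simp only [coeff_apply, LinearMap.add_apply, LinearMap.neg_apply, LinearMap.sub_apply, map_sub]
  exact sub_eq_add_neg _ _

theorem coeff_zero_eq (B : FormalOp E M) (f : FormalFn E M) :
    PowerSeries.coeff 0 (B f) = B.coeff 0 (PowerSeries.coeff 0 f) := by
  conv_lhs => rw [eq_C_add_X_smul f, map_add, map_add, map_smul, coeff_zero_X_smul, add_zero]
  rfl

theorem coeff_succ_eq (B : FormalOp E M) (n : ℕ) (f : FormalFn E M) :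
    PowerSeries.coeff (n + 1) (B f) =
      B.coeff (n + 1) (PowerSeries.coeff 0 f) + PowerSeries.coeff n (B (shift f)) := by
  conv_lhs => rw [eq_C_add_X_smul f, map_add, map_add, map_smul, coeff_succ_X_smul]
  rfl

theorem IsNatural.add (hA : A.IsNatural) (hB : B.IsNatural) : (A + B).IsNatural :=
  fun k => coeff_add A B k ▸ (hA k).add (hB k)

theorem IsNatural.sub (hA : A.IsNatural) (hB : B.IsNatural) : (A - B).IsNatural :=
  fun k => coeff_sub A B k ▸ (hA k).add (hB k).neg

theorem VanishesModH.add (hA : A.VanishesModH) (hB : B.VanishesModH) : (A + B).VanishesModH :=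
  fun f => by rw [LinearMap.add_apply, map_add, hA, hB, add_zero]

theorem VanishesModH.sub (hA : A.VanishesModH) (hB : B.VanishesModH) : (A - B).VanishesModH :=
  fun f => by rw [LinearMap.sub_apply, map_sub, hA, hB, sub_zero]

theorem coeff_zero_map (L : FormalFn E M →ₗ[ℂ⟦X⟧] FormalOp E M) (c : FormalFn E M) :
    (L c).coeff 0 = (L (PowerSeries.C (PowerSeries.coeff 0 c))).coeff 0 := by
  ext f : 1
  conv_lhs => rw [eq_C_add_X_smul c]
  rw [coeff_apply, coeff_apply, map_add, map_smul, LinearMap.add_apply, LinearMap.smul_apply,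
    map_add, coeff_zero_X_smul, add_zero]

theorem coeff_succ_map (L : FormalFn E M →ₗ[ℂ⟦X⟧] FormalOp E M) (k : ℕ) (c : FormalFn E M) :
    (L c).coeff (k + 1) = (L (PowerSeries.C (PowerSeries.coeff 0 c))).coeff (k + 1) +
      (L (shift c)).coeff k := by
  ext f : 1
  conv_lhs => rw [eq_C_add_X_smul c]
  rw [LinearMap.add_apply, coeff_apply, coeff_apply, coeff_apply, map_add, map_smul,
    LinearMap.add_apply, LinearMap.smul_apply, map_add, coeff_succ_X_smul]

theorem isNatural_of_C {L : FormalFn E M →ₗ[ℂ⟦X⟧] FormalOp E M}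
    (hL : ∀ f : SmoothFn E M, (L (PowerSeries.C f)).IsNatural) (c : FormalFn E M) :
    (L c).IsNatural := by
  intro k
  induction k generalizing c with
  | zero => exact coeff_zero_map L c ▸ hL _ 0
  | succ k ih => exact coeff_succ_map L k c ▸ (hL _ _).add (ih _).succ

theorem exists_glue {L : M → FormalOp E M}
    (hL : ∀ x₀ f, ∀ᶠ x in nhds x₀, ev x (L x f) = ev x (L x₀ f)) :
    ∃ B : FormalOp E M, ∀ x f, ev x (B f) = ev x (L x f) := by
  let glued (f : FormalFn E M) : FormalFn E M := PowerSeries.mk fun k =>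
    ⟨fun x => (PowerSeries.coeff k (L x f) : SmoothFn E M).1 x, fun x₀ =>
      ((PowerSeries.coeff k (L x₀ f) : SmoothFn E M).2 x₀).congr_of_eventuallyEq <|
        (hL x₀ f).mono fun x hx => ev_eq_iff.1 hx k⟩
  have ev_glued (x : M) (f : FormalFn E M) : ev x (glued f) = ev x (L x f) :=
    ev_eq_iff.2 fun k => by rw [PowerSeries.coeff_mk]
  refine ⟨⟨⟨glued, fun f g => ext_ev fun x => ?_⟩, fun p f => ext_ev fun x => ?_⟩,
    fun x f => ev_glued x f⟩
  · simp only [ev_glued, map_add]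
  · change ev x (glued (p • f)) = ev x (p • glued f)
    simp only [ev_glued, map_smul]

/-- `B = 0` modulo `h ^ m`; for `m = 1` this is `FormalOp.VanishesModH`. -/
def VanishesModHPow (m : ℕ) (B : FormalOp E M) : Prop :=
  ∀ f, ∀ k < m, PowerSeries.coeff k (B f) = 0

theorem VanishesModH.vanishesModHPow_one (hB : B.VanishesModH) : B.VanishesModHPow 1 :=
  fun f _ hk => Nat.lt_one_iff.1 hk ▸ hB f

theorem eq_zero_of_vanishesModHPow (hB : ∀ m, B.VanishesModHPow m) : B = 0 := by
  ext f k : 2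
  exact hB (k + 1) f k k.lt_succ_self

namespace VanishesModHPow

theorem mono {n : ℕ} (hB : B.VanishesModHPow n) (hmn : m ≤ n) : B.VanishesModHPow m :=
  fun f k hk => hB f k (hk.trans_le hmn)

theorem sub (hA : A.VanishesModHPow m) (hB : B.VanishesModHPow m) :
    (A - B).VanishesModHPow m := fun f k hk => by
  rw [LinearMap.sub_apply, map_sub, hA f k hk, hB f k hk, sub_zero]

theorem sub_succ (hA : A.VanishesModHPow m) (hB : B.VanishesModHPow m)
    (hAB : ∀ f, PowerSeries.coeff m (A f) = PowerSeries.coeff m (B f)) :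
    (A - B).VanishesModHPow (m + 1) := fun f k hk => by
  obtain hk | rfl := Nat.lt_succ_iff_lt_or_eq.1 hk
  · exact hA.sub hB f k hk
  · rw [LinearMap.sub_apply, map_sub, hAB, sub_self]

theorem coeff_eq (hB : B.VanishesModHPow m) (f : FormalFn E M) :
    PowerSeries.coeff m (B f) = B.coeff m (PowerSeries.coeff 0 f) := by
  cases m with
  | zero => exact B.coeff_zero_eq f
  | succ m => rw [coeff_succ_eq, hB _ m m.lt_succ_self, add_zero]

theorem exists_eq_X_pow_smul (hB : B.VanishesModHPow m) (f : FormalFn E M) :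
    ∃ d : FormalFn E M, B f = (PowerSeries.X ^ m : ℂ⟦X⟧) • d ∧
      PowerSeries.coeff 0 d = B.coeff m (PowerSeries.coeff 0 f) := by
  obtain ⟨d, hd⟩ := FormalFn.exists_eq_X_pow_smul (hB f)
  exact ⟨d, hd, by rw [← hB.coeff_eq, hd, coeff_X_pow_smul_self]⟩

end VanishesModHPow

end FormalOp

section Locality

variable [FiniteDimensional ℝ E] [T2Space M] [IsManifold 𝓘(ℝ, E) ∞ M]

theorem IsDiffOp.apply_eq_zero {k : ℕ} {P : SmoothFn E M →ₗ[ℂ] SmoothFn E M} (hP : IsDiffOp k P)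
    {x : M} {f : SmoothFn E M} (hf : f.1 =ᶠ[nhds x] 0) : (P f).1 x = 0 := by
  obtain ⟨χ, hχ, hχU, r, hr, -, hχ_one⟩ := exists_cutoff (E := E) hf
  let φ : SmoothFn E M := ⟨fun x => 1 - (χ x : ℂ),
    (contDiff_const.sub Complex.ofRealCLM.contDiff).comp_contMDiff hχ⟩
  have hφf : φ * f = f := by
    ext y
    change (1 - (χ y : ℂ)) * f.1 y = f.1 y
    by_cases hy : y ∈ tsupport χ
    · have hfy : f.1 y = 0 := hχU hy
      rw [hfy, mul_zero]
    · rw [image_eq_zero_of_notMem_tsupport hy, Complex.ofReal_zero, sub_zero, one_mul]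
  have hφx : φ.1 x = 0 := by simp [φ, hχ_one x (mem_chartBall x hr)]
  have hcomm (P : SmoothFn E M →ₗ[ℂ] SmoothFn E M) :
      (P f).1 x = (commutatorMul P φ f).1 x := by
    change _ = (P (φ * f)).1 x - φ.1 x * (P f).1 x
    rw [hφf, hφx, zero_mul, sub_zero]
  induction k generalizing P with
  | zero => rw [hcomm, hP]; rfl
  | succ k ih => exact (hcomm P).trans (ih (hP φ))

namespace FormalOp.IsNatural

variable {B : FormalOp E M} {x : M} {U : Set M}

theorem ev_eq_zero (hB : B.IsNatural) (hU : U ∈ nhds x) {f : FormalFn E M}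
    (hf : ∀ y ∈ U, ev y f = 0) : ev x (B f) = 0 := by
  have coeff_eventuallyEq {f : FormalFn E M} (hf : ∀ y ∈ U, ev y f = 0) :
      (PowerSeries.coeff 0 f : SmoothFn E M).1 =ᶠ[nhds x] 0 := by
    filter_upwards [hU] with y hy
    rw [← coeff_ev, hf y hy]
    rfl
  ext n
  rw [coeff_ev, map_zero]
  induction n generalizing f with
  | zero =>
    rw [coeff_zero_eq]
    exact (hB 0).apply_eq_zero (coeff_eventuallyEq hf)
  | succ n ih =>
    have hshift : ∀ y ∈ U, ev y (shift f) = 0 := fun y hy => by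
      ext k
      rw [coeff_ev, shift, PowerSeries.coeff_mk, ← coeff_ev, hf y hy, map_zero, map_zero]
    rw [coeff_succ_eq]
    change _ + _ = (0 : ℂ)
    rw [(hB (n + 1)).apply_eq_zero (coeff_eventuallyEq hf), ih hshift, add_zero]

theorem ev_congr (hB : B.IsNatural) (hU : U ∈ nhds x) {f g : FormalFn E M}
    (hfg : ∀ y ∈ U, ev y f = ev y g) : ev x (B f) = ev x (B g) := by
  rw [← sub_eq_zero, ← map_sub, ← map_sub]
  exact hB.ev_eq_zero hU fun y hy => by rw [map_sub, hfg y hy, sub_self]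

end FormalOp.IsNatural

end Locality

end Formal

section StarProducts

open FormalFn

variable {E : Type*} [NormedAddCommGroup E] [NormedSpace ℝ E] [FiniteDimensional ℝ E]
  {M : Type*} [TopologicalSpace M] [ChartedSpace E M] {Ω : SymplecticForm E M}

namespace StarProduct

variable (S : StarProduct Ω)

/-- The commutator `f ↦ b ⋆ f - f ⋆ b`. -/
def ad : FormalFn E M →ₗ[ℂ⟦X⟧] FormalOp E M where
  toFun b := S.mul b - S.mul.flip b
  map_add' b c := by
    rw [map_add, map_add]
    abel
  map_smul' p b := by
    rw [map_smul, map_smul]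
    ext1 f
    exact (smul_sub p (S.mul b f) (S.mul f b)).symm

theorem ad_apply (b f : FormalFn E M) : S.ad b f = S.mul b f - S.mul f b := rfl

theorem ad_swap (b f : FormalFn E M) : S.ad b f = -S.ad f b := by
  rw [ad_apply, ad_apply, neg_sub]

theorem ad_smul_one (p : ℂ⟦X⟧) : S.ad (p • 1) = 0 := by
  ext1 f
  rw [map_smul, LinearMap.smul_apply, ad_apply, S.one_mul, S.mul_one, sub_self, smul_zero]
  rfl

theorem isNatural_mul (c : FormalFn E M) : FormalOp.IsNatural (S.mul c) :=
  FormalOp.isNatural_of_C (fun f => (S.natural f).1) c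

theorem isNatural_flip (c : FormalFn E M) : FormalOp.IsNatural (S.mul.flip c) :=
  FormalOp.isNatural_of_C (fun f => (S.natural f).2) c

theorem isNatural_ad (c : FormalFn E M) : FormalOp.IsNatural (S.ad c) :=
  (S.isNatural_mul c).sub (S.isNatural_flip c)

theorem coeff_zero_mul (f g : FormalFn E M) :
    PowerSeries.coeff 0 (S.mul f g) = PowerSeries.coeff 0 f * PowerSeries.coeff 0 g := by
  rw [FormalOp.coeff_zero_eq, FormalOp.coeff_apply]
  change PowerSeries.coeff 0 (S.mul.flip (PowerSeries.C (PowerSeries.coeff 0 g)) f) = _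
  rw [FormalOp.coeff_zero_eq, FormalOp.coeff_apply]
  exact S.coeff_zero _ _

theorem coeff_zero_ad (b f : FormalFn E M) : PowerSeries.coeff 0 (S.ad b f) = 0 := by
  rw [ad_apply, map_sub, coeff_zero_mul, coeff_zero_mul, mul_comm, sub_self]

/-- The quasi-inner derivations `h⁻¹ (b ⋆ · - · ⋆ b)`, for which `b` need not be a multiple
of `h`. -/
def quasiInner : FormalFn E M →ₗ[ℂ⟦X⟧] FormalOp E M where
  toFun b :=
    { toFun := fun f => shift (S.ad b f)
      map_add' := fun f g => X_smul_injective <| by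
        simp only [smul_add, X_smul_shift (S.coeff_zero_ad _ _)]
        rw [map_add]
      map_smul' := fun p f => X_smul_injective <| by
        simp only [RingHom.id_apply, smul_comm _ p, X_smul_shift (S.coeff_zero_ad _ _)]
        rw [map_smul] }
  map_add' b c := LinearMap.ext fun f => X_smul_injective <| by
    simp only [LinearMap.add_apply, LinearMap.coe_mk, AddHom.coe_mk, smul_add,
      X_smul_shift (S.coeff_zero_ad _ _)]
    rw [map_add, LinearMap.add_apply]
  map_smul' p b := LinearMap.ext fun f => X_smul_injective <| by
    simp only [RingHom.id_apply, LinearMap.smul_apply, LinearMap.coe_mk, AddHom.coe_mk,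
      smul_comm _ p, X_smul_shift (S.coeff_zero_ad _ _)]
    rw [map_smul, LinearMap.smul_apply]

theorem X_smul_quasiInner (b f : FormalFn E M) :
    (PowerSeries.X : ℂ⟦X⟧) • S.quasiInner b f = S.ad b f :=
  X_smul_shift (S.coeff_zero_ad b f)

theorem coeff_quasiInner (k : ℕ) (b f : FormalFn E M) :
    PowerSeries.coeff k (S.quasiInner b f) = PowerSeries.coeff (k + 1) (S.ad b f) := by
  rw [← X_smul_quasiInner, coeff_succ_X_smul]

theorem quasiInner_swap (b f : FormalFn E M) : S.quasiInner b f = -S.quasiInner f b :=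
  X_smul_injective <| by simp only [smul_neg, X_smul_quasiInner, ← ad_swap]

/-- The Leibniz rule `B(f ⋆ g) = B(f) ⋆ g + f ⋆ B(g)`, without any condition modulo `h`. -/
def IsDerivation (B : FormalOp E M) : Prop :=
  ∀ f g, B (S.mul f g) = S.mul (B f) g + S.mul f (B g)

theorem isDerivation_quasiInner (b : FormalFn E M) : S.IsDerivation (S.quasiInner b) :=
  fun f g => X_smul_injective <| by
    change (PowerSeries.X : ℂ⟦X⟧) • S.quasiInner b (S.mul f g) = (PowerSeries.X : ℂ⟦X⟧) •
      (S.mul (S.quasiInner b f) g + S.mul f (S.quasiInner b g))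
    rw [smul_add, ← LinearMap.smul_apply _ (S.mul _), ← map_smul S.mul, ← map_smul (S.mul f)]
    simp only [X_smul_quasiInner, ad_apply, map_sub, LinearMap.sub_apply, S.mul_assoc]
    abel

section

variable {S} {A B : FormalOp E M}

theorem IsDerivation.sub (hA : S.IsDerivation A) (hB : S.IsDerivation B) :
    S.IsDerivation (A - B) := fun f g => by
  simp only [LinearMap.sub_apply, hA f g, hB f g, map_sub]
  abel

theorem IsDerivation.map_quasiInner (hB : S.IsDerivation B) (b f : FormalFn E M) :
    B (S.quasiInner b f) = S.quasiInner (B b) f + S.quasiInner b (B f) :=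
  X_smul_injective <| by
    simp only [smul_add, ← map_smul B, X_smul_quasiInner, ad_apply, map_sub, hB f b, hB b f]
    abel

end

/-- The Poisson bracket as an operation on smooth functions. It is smooth because it is a
coefficient of the star product. -/
def bracket (f g : SmoothFn E M) : SmoothFn E M :=
  (-Complex.I) • PowerSeries.coeff 0 (S.quasiInner (PowerSeries.C f) (PowerSeries.C g))

theorem bracket_apply (f g : SmoothFn E M) (x : M) :
    (S.bracket f g).1 x = Ω.poisson f.1 g.1 x := by
  change -Complex.I * (PowerSeries.coeff 0 (S.quasiInner (PowerSeries.C f) (PowerSeries.C g)) :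
    SmoothFn E M).1 x = _
  rw [coeff_quasiInner, ad_apply, map_sub, S.coeff_one, ← _root_.mul_assoc]
  simp

theorem bracket_smul (c : ℂ) (f g : SmoothFn E M) : S.bracket f (c • g) = c • S.bracket f g := by
  ext x
  change (S.bracket f (c • g)).1 x = c * (S.bracket f g).1 x
  rw [bracket_apply, bracket_apply]
  exact ComplexTangent.deriv_fn_smul _ c g

theorem bracket_swap (f g : SmoothFn E M) : S.bracket f g = -S.bracket g f := by
  rw [bracket, quasiInner_swap, map_neg, smul_neg]
  rfl

theorem smul_bracket (c : ℂ) (f g : SmoothFn E M) : S.bracket (c • f) g = c • S.bracket f g := by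
  rw [S.bracket_swap, bracket_smul, ← smul_neg, ← S.bracket_swap]

theorem coeff_zero_quasiInner (b f : FormalFn E M) : PowerSeries.coeff 0 (S.quasiInner b f) =
    Complex.I • S.bracket (PowerSeries.coeff 0 b) (PowerSeries.coeff 0 f) := by
  rw [FormalOp.coeff_zero_eq, FormalOp.coeff_zero_map, bracket, smul_smul, mul_neg,
    Complex.I_mul_I, neg_neg, one_smul]
  rfl

theorem isPoissonBracket_bracket : IsPoissonBracket Ω S.bracket where
  apply := S.bracket_apply
  swap := S.bracket_swap
  jacobi f g k := by
    have hder := congrArg (PowerSeries.coeff 0) <|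
      (S.isDerivation_quasiInner (PowerSeries.C f)).map_quasiInner (PowerSeries.C g)
        (PowerSeries.C k)
    simp only [map_add, coeff_zero_quasiInner, PowerSeries.coeff_zero_C, bracket_smul,
      smul_bracket, ← smul_add] at hder
    have hjacobi := smul_right_injective _ Complex.I_ne_zero
      (smul_right_injective _ Complex.I_ne_zero hder)
    rw [hjacobi, add_sub_cancel_right, S.bracket_swap]

namespace IsDerivation

variable {S} {B : FormalOp E M} (hder : S.IsDerivation B) {m : ℕ} (hB : B.VanishesModHPow m)

include hder hB

theorem leading_coeff_mul (f g : SmoothFn E M) :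
    B.coeff m (f * g) = f * B.coeff m g + g * B.coeff m f := by
  obtain ⟨d, hd, hd₀⟩ := hB.exists_eq_X_pow_smul (PowerSeries.C f)
  obtain ⟨e, he, he₀⟩ := hB.exists_eq_X_pow_smul (PowerSeries.C g)
  have hleading := congrArg (PowerSeries.coeff m) (hder (PowerSeries.C f) (PowerSeries.C g))
  rw [hd, he, map_smul, LinearMap.smul_apply, map_smul, map_add, coeff_X_pow_smul_self,
    coeff_X_pow_smul_self, hB.coeff_eq, coeff_zero_mul, coeff_zero_mul, coeff_zero_mul, hd₀, he₀,
    PowerSeries.coeff_zero_C, PowerSeries.coeff_zero_C] at hleading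
  rw [hleading]
  ring

theorem leading_coeff_bracket (f g : SmoothFn E M) :
    B.coeff m (S.bracket f g) = S.bracket (B.coeff m f) g + S.bracket f (B.coeff m g) := by
  obtain ⟨d, hd, hd₀⟩ := hB.exists_eq_X_pow_smul (PowerSeries.C f)
  obtain ⟨e, he, he₀⟩ := hB.exists_eq_X_pow_smul (PowerSeries.C g)
  have hleading := congrArg (PowerSeries.coeff m)
    (hder.map_quasiInner (PowerSeries.C f) (PowerSeries.C g))
  rw [hB.coeff_eq, hd, he, map_smul, LinearMap.smul_apply, map_smul, map_add,
    coeff_X_pow_smul_self, coeff_X_pow_smul_self, coeff_zero_quasiInner, coeff_zero_quasiInner,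
    coeff_zero_quasiInner, hd₀, he₀, PowerSeries.coeff_zero_C, PowerSeries.coeff_zero_C, map_smul,
    ← smul_add] at hleading
  exact smul_right_injective _ Complex.I_ne_zero hleading

variable [T2Space M] [IsManifold 𝓘(ℝ, E) ∞ M]

theorem exists_complexTangent_leading_coeff (x : M) :
    ∃ Z : ComplexTangent E x, ∀ f : SmoothFn E M,
      Z.deriv f.1 = (((-Complex.I) • B.coeff m) f).1 x := by
  let D : SmoothFn E M →ₗ[ℂ] ℂ :=
    LinearMap.proj x ∘ₗ (SmoothFn E M).val.toLinearMap ∘ₗ ((-Complex.I) • B.coeff m)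
  refine IsPointDerivation.exists_complexTangent (D := D) fun f g => ?_
  change -Complex.I * (B.coeff m (f * g)).1 x =
    f.1 x * (-Complex.I * (B.coeff m g).1 x) + g.1 x * (-Complex.I * (B.coeff m f).1 x)
  rw [hder.leading_coeff_mul hB]
  change -Complex.I * (f.1 x * (B.coeff m g).1 x + g.1 x * (B.coeff m f).1 x) = _
  ring

theorem exists_symplecticField_leading_coeff :
    ∃ Y : Ω.symplecticFields, ∀ (f : FormalFn E M) (x : M),
      (PowerSeries.coeff m (B f) : SmoothFn E M).1 x =
        Complex.I * (Y.1 x).deriv (PowerSeries.coeff 0 f : SmoothFn E M).1 := by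
  choose Y hY using hder.exists_complexTangent_leading_coeff hB
  have hY_mem : Y ∈ Ω.symplecticFields :=
    S.isPoissonBracket_bracket.mem_symplecticFields (fun f x => hY x f) fun f g => by
      rw [LinearMap.smul_apply, hder.leading_coeff_bracket hB, smul_add, ← smul_bracket,
        ← bracket_smul]
      rfl
  refine ⟨⟨Y, hY_mem⟩, fun f x => ?_⟩
  rw [hY, hB.coeff_eq]
  change _ = Complex.I * (-Complex.I * (B.coeff m (PowerSeries.coeff 0 f)).1 x)
  rw [← _root_.mul_assoc]
  simp

end IsDerivation

end StarProduct

end StarProducts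

section Correspondence

open FormalFn

variable {E : Type*} [NormedAddCommGroup E] [NormedSpace ℝ E] [FiniteDimensional ℝ E]
  {M : Type*} [TopologicalSpace M] [ChartedSpace E M] {Ω : SymplecticForm E M}

namespace IsHamiltonianOn

variable {Y Z : ℕ → Ω.symplecticFields} {b c : FormalFn E M} {U V : Set M}

theorem mono (hb : IsHamiltonianOn Y b U) (hV : V ⊆ U) : IsHamiltonianOn Y b V :=
  fun k x hx => hb k x (hV hx)

theorem add (hb : IsHamiltonianOn Y b U) (hc : IsHamiltonianOn Z c U) :
    IsHamiltonianOn (Y + Z) (b + c) U := fun k x hx => by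
  rw [map_add, Ω.hamiltonianField_add, ← hb k x hx, ← hc k x hx]
  rfl

theorem smul (a : ℂ) (hb : IsHamiltonianOn Y b U) : IsHamiltonianOn (a • Y) (a • b) U :=
  fun k x hx => by
    rw [PowerSeries.coeff_smul, Ω.hamiltonianField_smul, ← hb k x hx]
    rfl

theorem sub (hb : IsHamiltonianOn Y b U) (hc : IsHamiltonianOn Z c U) :
    IsHamiltonianOn (Y - Z) (b - c) U := fun k x hx => by
  rw [map_sub, Ω.hamiltonianField_sub, ← hb k x hx, ← hc k x hx]
  rfl

theorem exists_X_pow_smul {m : ℕ} (hY : ∀ k < m, Y k = 0) (hb : IsHamiltonianOn Y b U) :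
    ∃ d : FormalFn E M, IsHamiltonianOn Y ((PowerSeries.X ^ m : ℂ⟦X⟧) • d) U := by
  refine ⟨PowerSeries.mk fun n => PowerSeries.coeff (n + m) b, fun k x hx => ?_⟩
  obtain hk | hk := lt_or_ge k m
  · rw [coeff_X_pow_smul_of_lt hk, hY k hk]
    exact (Ω.hamiltonianField_const 0 x).symm
  · obtain ⟨n, rfl⟩ := Nat.exists_eq_add_of_le' hk
    rw [coeff_X_pow_smul_add, PowerSeries.coeff_mk]
    exact hb _ x hx

theorem exists_ev_sub_eq_ev_smul_one [IsManifold 𝓘(ℝ, E) ∞ M] {x : M} (hU : U ∈ nhds x)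
    (hb : IsHamiltonianOn Y b U) (hc : IsHamiltonianOn Y c U) :
    ∃ V ∈ nhds x, ∃ p : ℂ⟦X⟧, ∀ y ∈ V, ev y (b - c) = ev y (p • (1 : FormalFn E M)) := by
  obtain ⟨r, hr, hball, hrU⟩ := exists_chartBall_subset (E := E) hU
  refine ⟨chartBall x r, (isOpen_chartBall (E := E) x r).mem_nhds (mem_chartBall x hr),
    ev x (b - c), fun y hy => ?_⟩
  rw [ev_smul_one]
  ext k
  rw [coeff_ev, coeff_ev]
  refine Ω.eq_of_hamiltonianField_eq_zero (f := PowerSeries.coeff k (b - c)) hball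
    (fun z hz => ?_) hy (mem_chartBall x hr)
  rw [← hb.sub hc k z (hrU hz), sub_self]
  rfl

end IsHamiltonianOn

variable [IsManifold 𝓘(ℝ, E) ∞ M] [T2Space M]

theorem exists_isHamiltonianOn_family {F : Type*} [NormedAddCommGroup F] [NormedSpace ℝ F]
    [FiniteDimensional ℝ F] {T : Type*} [TopologicalSpace T] [ChartedSpace F T]
    [IsManifold 𝓘(ℝ, F) ∞ T] {Y : T → ℕ → Ω.symplecticFields}
    (hY : ∀ k, IsSmoothFamily F fun σ => (Y σ k).1) (x₀ : M) :
    ∃ U : Set M, IsOpen U ∧ x₀ ∈ U ∧ ∃ b ∈ Sections E M F T,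
      ∀ σ, IsHamiltonianOn (Y σ) (b σ) U := by
  obtain ⟨r, hr, -, hlocal⟩ := Ω.exists_smooth_hamiltonian F T x₀
  choose b hb hYb using fun k => hlocal (fun σ => (Y σ k).1) (fun σ => (Y σ k).2) (hY k)
  refine ⟨chartBall x₀ r, isOpen_chartBall (E := E) x₀ r, mem_chartBall x₀ hr,
    fun σ => PowerSeries.mk fun k =>
      ⟨fun x => b k (σ, x), (hb k).comp (contMDiff_const.prodMk contMDiff_id)⟩,
    fun k => ?_, fun σ k x hx => ?_⟩
  · simp only [PowerSeries.coeff_mk]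
    exact hb k
  · rw [PowerSeries.coeff_mk]
    exact hYb k σ x hx

theorem exists_isHamiltonianOn (Y : ℕ → Ω.symplecticFields) (x₀ : M) :
    ∃ U : Set M, IsOpen U ∧ x₀ ∈ U ∧ ∃ b, IsHamiltonianOn Y b U := by
  have hY (k : ℕ) : IsSmoothFamily ℝ fun _ : ℝ => (Y k).1 := fun f =>
    ContMDiff.comp (I' := 𝓘(ℝ, E)) (g := fun x => ((Y k).1 x).deriv f.1) ((Y k).2.1 f.1 f.2)
      contMDiff_snd
  obtain ⟨U, hU, hxU, b, -, hb⟩ := exists_isHamiltonianOn_family hY x₀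
  exact ⟨U, hU, hxU, b 0, hb 0⟩

namespace StarProduct

variable (S : StarProduct Ω) {x : M} {U : Set M}

theorem ev_mul_congr (hU : U ∈ nhds x) {f f' g g' : FormalFn E M}
    (hf : ∀ y ∈ U, ev y f = ev y f') (hg : ∀ y ∈ U, ev y g = ev y g') :
    ev x (S.mul f g) = ev x (S.mul f' g') :=
  ((S.isNatural_mul f).ev_congr hU hg).trans ((S.isNatural_flip g').ev_congr hU hf)

theorem ev_ad_congr (hU : U ∈ nhds x) {b c : FormalFn E M} (hbc : ∀ y ∈ U, ev y b = ev y c)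
    (f : FormalFn E M) : ev x (S.ad b f) = ev x (S.ad c f) := by
  rw [ad_apply, ad_apply, map_sub, map_sub, S.ev_mul_congr hU hbc fun _ _ => rfl,
    S.ev_mul_congr hU (fun _ _ => rfl) hbc]

variable {Y : ℕ → Ω.symplecticFields} {b c : FormalFn E M}

theorem ev_quasiInner_eq_of_isHamiltonianOn (hU : U ∈ nhds x) (hb : IsHamiltonianOn Y b U)
    (hc : IsHamiltonianOn Y c U) (f : FormalFn E M) :
    ev x (S.quasiInner b f) = ev x (S.quasiInner c f) := by
  obtain ⟨V, hV, p, hbc⟩ := hb.exists_ev_sub_eq_ev_smul_one hU hc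
  have had : ev x (S.ad (b - c) f) = 0 := by
    rw [S.ev_ad_congr hV hbc, ad_smul_one, LinearMap.zero_apply, map_zero]
  rw [← X_smul_quasiInner, map_smul, smul_eq_mul, map_sub, LinearMap.sub_apply, map_sub] at had
  exact sub_eq_zero.1 ((mul_eq_zero.1 had).resolve_left PowerSeries.X_ne_zero)

variable {S} {A B : FormalOp E M} {Z : ℕ → Ω.symplecticFields}

theorem corresponds_iff :
    S.Corresponds B Y ↔ ∀ (U : Set M) (b : FormalFn E M), IsOpen U → IsHamiltonianOn Y b U →
      ∀ f, ∀ x ∈ U, ev x (B f) = ev x (S.quasiInner b f) := by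
  have coeff_X_mul_iff (b f : FormalFn E M) (x : M) :
      (∀ k, (PowerSeries.coeff k (PowerSeries.X * B f) : SmoothFn E M).1 x =
        (PowerSeries.coeff k (S.mul b f - S.mul f b) : SmoothFn E M).1 x) ↔
      ev x (B f) = ev x (S.quasiInner b f) := by
    rw [← ev_eq_iff, ← X_smul, ← ad_apply, ← X_smul_quasiInner, map_smul, map_smul]
    exact mul_right_inj' PowerSeries.X_ne_zero
  refine ⟨fun hB U b hU hb f x hx => (coeff_X_mul_iff b f x).1 fun k => hB.2 U b hU hb f k x hx,
    fun hB => ⟨exists_isHamiltonianOn Y, fun U b hU hb f k x hx =>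
      (coeff_X_mul_iff b f x).2 (hB U b hU hb f x hx) k⟩⟩

theorem corresponds_of_pointwise (hB : ∀ x, ∃ U ∈ nhds x, ∃ b, IsHamiltonianOn Y b U ∧
    ∀ f, ev x (B f) = ev x (S.quasiInner b f)) : S.Corresponds B Y := by
  refine corresponds_iff.2 fun U b hU hb f x hx => ?_
  obtain ⟨V, hV, c, hc, hBc⟩ := hB x
  rw [hBc, S.ev_quasiInner_eq_of_isHamiltonianOn (Filter.inter_mem hV (hU.mem_nhds hx))
    (hc.mono Set.inter_subset_left) (hb.mono Set.inter_subset_right)]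

namespace Corresponds

theorem exists_quasiInner (hB : S.Corresponds B Y) (x : M) :
    ∃ U, IsOpen U ∧ x ∈ U ∧ ∃ b, IsHamiltonianOn Y b U ∧
      ∀ f, ∀ y ∈ U, ev y (B f) = ev y (S.quasiInner b f) := by
  obtain ⟨U, hU, hxU, b, hb⟩ := exists_isHamiltonianOn Y x
  exact ⟨U, hU, hxU, b, hb, corresponds_iff.1 hB U b hU hb⟩

theorem add (hA : S.Corresponds A Y) (hB : S.Corresponds B Z) :
    S.Corresponds (A + B) (Y + Z) := by
  refine corresponds_of_pointwise fun x => ?_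
  obtain ⟨U, hU, hxU, b, hb, hAb⟩ := hA.exists_quasiInner x
  obtain ⟨V, hV, hxV, c, hc, hBc⟩ := hB.exists_quasiInner x
  refine ⟨U ∩ V, (hU.inter hV).mem_nhds ⟨hxU, hxV⟩, b + c,
    (hb.mono Set.inter_subset_left).add (hc.mono Set.inter_subset_right), fun f => ?_⟩
  rw [map_add, LinearMap.add_apply, LinearMap.add_apply, map_add, map_add, hAb f x hxU,
    hBc f x hxV]

theorem smul (a : ℂ) (hA : S.Corresponds A Y) : S.Corresponds (a • A) (a • Y) := by
  refine corresponds_of_pointwise fun x => ?_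
  obtain ⟨U, hU, hxU, b, hb, hAb⟩ := hA.exists_quasiInner x
  refine ⟨U, hU.mem_nhds hxU, a • b, hb.smul a, fun f => ?_⟩
  rw [LinearMap.smul_apply, complex_smul_eq, complex_smul_eq a b, map_smul, hAb f x hxU,
    map_smul S.quasiInner, LinearMap.smul_apply, map_smul]

theorem sub (hA : S.Corresponds A Y) (hB : S.Corresponds B Z) :
    S.Corresponds (A - B) (Y - Z) := by
  refine corresponds_of_pointwise fun x => ?_
  obtain ⟨U, hU, hxU, b, hb, hAb⟩ := hA.exists_quasiInner x
  obtain ⟨V, hV, hxV, c, hc, hBc⟩ := hB.exists_quasiInner x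
  refine ⟨U ∩ V, (hU.inter hV).mem_nhds ⟨hxU, hxV⟩, b - c,
    (hb.mono Set.inter_subset_left).sub (hc.mono Set.inter_subset_right), fun f => ?_⟩
  rw [map_sub S.quasiInner, LinearMap.sub_apply, LinearMap.sub_apply, map_sub, map_sub,
    hAb f x hxU, hBc f x hxV]

theorem unique (hA : S.Corresponds A Y) (hB : S.Corresponds B Y) : A = B := by
  ext1 f
  refine ext_ev fun x => ?_
  obtain ⟨U, hU, hxU, b, hb, hAb⟩ := hA.exists_quasiInner x
  rw [hAb f x hxU, corresponds_iff.1 hB U b hU hb f x hxU]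

theorem isDerivation (hB : S.Corresponds B Y) : S.IsDerivation B := by
  refine fun f g => ext_ev fun x => ?_
  obtain ⟨U, hU, hxU, b, -, hBb⟩ := hB.exists_quasiInner x
  rw [hBb _ x hxU, S.isDerivation_quasiInner b f g, map_add, map_add,
    S.ev_mul_congr (hU.mem_nhds hxU) (hBb f) fun _ _ => rfl,
    S.ev_mul_congr (hU.mem_nhds hxU) (fun _ _ => rfl) (hBb g)]

section

variable {m : ℕ}

theorem exists_X_pow_smul_quasiInner (hB : S.Corresponds B Y) (hY : ∀ k < m, Y k = 0) (x : M) :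
    ∃ d : FormalFn E M,
      Ω.hamiltonianField (PowerSeries.coeff 0 d : SmoothFn E M).1 x = (Y m).1 x ∧
      ∀ f, ev x (B f) = ev x ((PowerSeries.X ^ m : ℂ⟦X⟧) • S.quasiInner d f) := by
  obtain ⟨U, hU, hxU, b, hb⟩ := exists_isHamiltonianOn Y x
  obtain ⟨d, hd⟩ := hb.exists_X_pow_smul hY
  refine ⟨d, ?_, fun f => ?_⟩
  · rw [hd m x hxU, coeff_X_pow_smul_self]
  · rw [corresponds_iff.1 hB U _ hU hd f x hxU, map_smul, LinearMap.smul_apply]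

theorem vanishesModHPow (hB : S.Corresponds B Y) (hY : ∀ k < m, Y k = 0) :
    B.VanishesModHPow m := fun f k hk => by
  ext x
  obtain ⟨d, -, hBd⟩ := hB.exists_X_pow_smul_quasiInner hY x
  rw [ev_eq_iff.1 (hBd f) k, coeff_X_pow_smul_of_lt hk]

theorem coeff_eq (hB : S.Corresponds B Y) (hY : ∀ k < m, Y k = 0) (f : FormalFn E M) (x : M) :
    (PowerSeries.coeff m (B f) : SmoothFn E M).1 x =
      Complex.I * ((Y m).1 x).deriv (PowerSeries.coeff 0 f : SmoothFn E M).1 := by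
  obtain ⟨d, hdY, hBd⟩ := hB.exists_X_pow_smul_quasiInner hY x
  rw [ev_eq_iff.1 (hBd f) m, coeff_X_pow_smul_self, coeff_zero_quasiInner, ← hdY]
  exact congrArg (Complex.I * ·) (S.bracket_apply _ _ x)

theorem vanishesModHPow_iff (hB : S.Corresponds B Y) :
    B.VanishesModHPow m ↔ ∀ k < m, Y k = 0 := by
  refine ⟨fun hBm k => ?_, hB.vanishesModHPow⟩
  induction k using Nat.strong_induction_on with
  | _ k ih =>
    refine fun hk => Subtype.ext (funext fun x => ComplexTangent.ext_deriv fun f => ?_)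
    have hcoeff := hB.coeff_eq (fun j hj => ih j hj (hj.trans hk)) (PowerSeries.C f) x
    rw [hBm _ k hk, PowerSeries.coeff_zero_C] at hcoeff
    rw [(mul_eq_zero.1 hcoeff.symm).resolve_left Complex.I_ne_zero]
    exact (map_zero (LinearMap.liftBaseChange ℂ _)).symm

end

theorem mem_derivations (hB : S.Corresponds B Y) (hY : Y 0 = 0) : B ∈ S.derivations :=
  ⟨hB.isDerivation, fun f =>
    hB.vanishesModHPow (m := 1) (fun _ hk => Nat.lt_one_iff.1 hk ▸ hY) f 0 one_pos⟩

theorem isNatural (hB : S.Corresponds B Y) (hY : Y 0 = 0) : B.IsNatural := by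
  refine fun k => IsDiffOp.of_pointwise fun x => ?_
  obtain ⟨d, -, hBd⟩ := hB.exists_X_pow_smul_quasiInner (m := 1)
    (fun _ hk => Nat.lt_one_iff.1 hk ▸ hY) x
  refine ⟨(S.ad d).coeff k, S.isNatural_ad d k, fun f => ?_⟩
  have hBf := hBd (PowerSeries.C f)
  rw [pow_one, X_smul_quasiInner] at hBf
  exact ev_eq_iff.1 hBf k

end Corresponds

variable (S)

theorem exists_corresponds (Y : ℕ → Ω.symplecticFields) : ∃ B, S.Corresponds B Y := by
  choose U hU hxU b hb using exists_isHamiltonianOn (Ω := Ω) Y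
  obtain ⟨B, hB⟩ := FormalOp.exists_glue (L := fun x => S.quasiInner (b x)) fun x₀ f => by
    filter_upwards [(hU x₀).mem_nhds (hxU x₀)] with x hx
    exact S.ev_quasiInner_eq_of_isHamiltonianOn (((hU x).inter (hU x₀)).mem_nhds ⟨hxU x, hx⟩)
      ((hb x).mono Set.inter_subset_left) ((hb x₀).mono Set.inter_subset_right) f
  exact ⟨B, corresponds_of_pointwise fun x =>
    ⟨U x, (hU x).mem_nhds (hxU x), b x, hb x, hB x⟩⟩

variable {S}

theorem IsDerivation.exists_corresponds_sub_vanishesModHPow (hB : S.IsDerivation B) (m : ℕ) :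
    ∃ A Y, S.Corresponds A Y ∧ (B - A).VanishesModHPow m := by
  induction m with
  | zero =>
    obtain ⟨A, hA⟩ := S.exists_corresponds 0
    exact ⟨A, 0, hA, fun _ k hk => absurd hk k.not_lt_zero⟩
  | succ m ih =>
    obtain ⟨A, Y, hA, hBA⟩ := ih
    obtain ⟨Z, hZ⟩ := (hB.sub hA.isDerivation).exists_symplecticField_leading_coeff hBA
    obtain ⟨C, hC⟩ := S.exists_corresponds (Pi.single m Z)
    have hsingle (k : ℕ) (hk : k < m) : (Pi.single m Z : ℕ → Ω.symplecticFields) k = 0 :=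
      Pi.single_eq_of_ne hk.ne _
    refine ⟨A + C, Y + Pi.single m Z, hA.add hC, ?_⟩
    have hsub : B - (A + C) = B - A - C := LinearMap.ext fun f => sub_add_eq_sub_sub _ _ _
    rw [hsub]
    refine hBA.sub_succ (hC.vanishesModHPow hsingle) fun f => ?_
    ext x
    rw [hZ, hC.coeff_eq hsingle, Pi.single_eq_same]

theorem IsDerivation.exists_corresponds (hB : S.IsDerivation B) : ∃ Y, S.Corresponds B Y := by
  choose A Y hA hBA using hB.exists_corresponds_sub_vanishesModHPow
  have hcoherent (m k : ℕ) (hk : k < m) : Y (k + 1) k = Y m k := by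
    have hvanishes : (A (k + 1) - A m).VanishesModHPow (k + 1) := by
      have hsub : A (k + 1) - A m = (B - A m) - (B - A (k + 1)) :=
        LinearMap.ext fun f => (sub_sub_sub_cancel_left _ _ _).symm
      exact hsub ▸ ((hBA m).mono hk).sub (hBA (k + 1))
    exact sub_eq_zero.1
      (((hA (k + 1)).sub (hA m)).vanishesModHPow_iff.1 hvanishes k k.lt_succ_self)
  obtain ⟨C, hC⟩ := S.exists_corresponds fun k => Y (k + 1) k
  have hBC : B - C = 0 := FormalOp.eq_zero_of_vanishesModHPow fun m => by
    have hsub : B - C = (B - A m) - (C - A m) :=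
      LinearMap.ext fun f => (sub_sub_sub_cancel_right _ _ _).symm
    exact hsub ▸ (hBA m).sub ((hC.sub (hA m)).vanishesModHPow fun k hk =>
      sub_eq_zero.2 (hcoherent m k hk))
  have hB_eq : B = C := LinearMap.ext fun f => sub_eq_zero.1 (LinearMap.congr_fun hBC f)
  exact ⟨_, hB_eq ▸ hC⟩

theorem exists_corresponds_of_mem_derivations (hB : B ∈ S.derivations) :
    ∃ Y : ℕ → Ω.symplecticFields, Y 0 = 0 ∧ S.Corresponds B Y := by
  obtain ⟨Y, hY⟩ := IsDerivation.exists_corresponds hB.1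
  have hB_one : B.VanishesModHPow 1 := FormalOp.VanishesModH.vanishesModHPow_one hB.2
  exact ⟨Y, hY.vanishesModHPow_iff.1 hB_one 0 one_pos, hY⟩

end StarProduct

end Correspondence

section Parameters

variable {E : Type*} [NormedAddCommGroup E] [NormedSpace ℝ E]
  {M : Type*} [TopologicalSpace M] [ChartedSpace E M]
  {F : Type*} [NormedAddCommGroup F] [NormedSpace ℝ F]
  {T : Type*} [TopologicalSpace T] [ChartedSpace F T]

theorem exists_vectorField_eq [FiniteDimensional ℝ F] [T2Space T] [IsManifold 𝓘(ℝ, F) ∞ T]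
    {σ : T} (v : TangentSpace 𝓘(ℝ, F) σ) : ∃ V : VectorFields F T, V σ = v := by
  obtain ⟨s, hs, hsmooth⟩ := FiberBundle.exists_contMDiffOn_extend (k := ∞) 𝓘(ℝ, F) F
    (V := (TangentSpace 𝓘(ℝ, F) : T → Type _)) v
  obtain ⟨u, hus, hu, hσ⟩ := mem_nhds_iff.1 hs
  obtain ⟨χ, hχ, hχu, r, hr, -, hχ_one⟩ := exists_cutoff (E := F) (hu.mem_nhds hσ)
  refine ⟨⟨χ • FiberBundle.extend F v,
    ContMDiffOn.smul_section_of_tsupport hχ.contMDiffOn hu hχu (hsmooth.mono hus)⟩, ?_⟩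
  change χ σ • FiberBundle.extend F v σ = v
  rw [hχ_one σ (mem_chartBall σ hr), one_smul, FiberBundle.extend_apply_self]

variable (F T) in
/-- The constant section of `T × C^∞(M)⟦h⟧` with value `f`. -/
def constSection (f : FormalFn E M) : Sections E M F T :=
  ⟨fun _ => f, fun k => ContMDiff.comp (I' := 𝓘(ℝ, E))
    (g := (PowerSeries.coeff k f : SmoothFn E M).1) (PowerSeries.coeff k f).2 contMDiff_snd⟩

theorem Sections.sub_mem {f g : T → FormalFn E M} (hf : f ∈ Sections E M F T)
    (hg : g ∈ Sections E M F T) : (fun σ => f σ - g σ) ∈ Sections E M F T :=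
  fun k => (hf k).sub (hg k)

end Parameters

/-! ## Connections and forms with values in derivations -/

section Torsor

variable {E : Type*} [NormedAddCommGroup E] [NormedSpace ℝ E]
  {M : Type*} [TopologicalSpace M] [ChartedSpace E M] [IsManifold 𝓘(ℝ, E) ∞ M]
  {F : Type*} [NormedAddCommGroup F] [NormedSpace ℝ F]
  {T : Type*} [TopologicalSpace T] [ChartedSpace F T] [IsManifold 𝓘(ℝ, F) ∞ T]

/-- The operator `D` is given by `D_V f = V[f] + A(V)(f)`. No regularity of the form `A` is
required. -/
def HasConnectionForm (D : CovariantOp E M F T) (A : RawOneForm F T fun _ => FormalOp E M) : Prop :=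
  ∀ V f σ, (D V f).1 σ = (alongDeriv V f).1 σ + A σ (V σ) (f.1 σ)

theorem isFormalConnection_iff {D : CovariantOp E M F T} : IsFormalConnection D ↔
    ∃ A : RawOneForm F T fun _ => FormalOp E M, IsSmoothOperatorForm A ∧
      (∀ σ v, FormalOp.IsNatural (A σ v) ∧ FormalOp.VanishesModH (A σ v)) ∧
      HasConnectionForm D A :=
  ⟨fun ⟨A, hA, hnat, hD⟩ => ⟨A, hA, hnat, fun V f σ => by rw [hD]; rfl⟩,
    fun ⟨A, hA, hnat, hD⟩ => ⟨A, hA, hnat, fun V f => Subtype.ext (funext (hD V f))⟩⟩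

theorem HasConnectionForm.sub_apply {D D₀ : CovariantOp E M F T}
    {A A₀ : RawOneForm F T fun _ => FormalOp E M} (hD : HasConnectionForm D A)
    (hD₀ : HasConnectionForm D₀ A₀) (V : VectorFields F T) (f : Sections E M F T) (σ : T) :
    (D V f).1 σ - (D₀ V f).1 σ = (A σ (V σ) - A₀ σ (V σ)) (f.1 σ) := by
  rw [hD, hD₀]
  exact add_sub_add_left_eq_sub _ _ _

variable [FiniteDimensional ℝ E] {Ω : SymplecticForm E M}

omit [IsManifold 𝓘(ℝ, E) ∞ M] in
theorem StarProduct.exists_linearMap_sub_eq {S : StarProduct Ω} {V : Type*} [AddCommGroup V]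
    [Module ℝ V] {A A' : V →ₗ[ℝ] FormalOp E M} (h : ∀ v, A v - A' v ∈ S.derivations) :
    ∃ L : V →ₗ[ℝ] S.derivations, ∀ v, (L v).1 = A v - A' v := by
  let L : V →ₗ[ℝ] FormalOp E M :=
    { toFun := fun v => A v - A' v
      map_add' := fun v w => LinearMap.ext fun f => by
        rw [map_add, map_add]
        exact add_sub_add_comm _ _ _ _
      map_smul' := fun c v => LinearMap.ext fun f => by
        rw [map_smul, map_smul]
        exact (smul_sub c (A v f) (A' v f)).symm }
  exact ⟨L.codRestrict (S.derivations.restrictScalars ℝ) h, fun _ => rfl⟩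

theorem StarProduct.isNatural_of_mem_derivations [T2Space M]
    {S : StarProduct Ω} {B : FormalOp E M} (hB : B ∈ S.derivations) : B.IsNatural := by
  obtain ⟨Y, hY, hBY⟩ := exists_corresponds_of_mem_derivations hB
  exact hBY.isNatural hY

namespace StarFamily

variable (S : StarFamily F T Ω)

omit [IsManifold 𝓘(ℝ, E) ∞ M] in
theorem toOp_mul (β : S.derivationForms) (V : VectorFields F T) (f g : Sections E M F T) :
    S.toOp β V (S.mul f g) = S.mul (S.toOp β V f) g + S.mul f (S.toOp β V g) :=
  Subtype.ext (funext fun σ => (β.1 σ (V σ)).2.1 (f.1 σ) (g.1 σ))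

omit [IsManifold 𝓘(ℝ, E) ∞ M] [IsManifold 𝓘(ℝ, F) ∞ T] in
theorem add_mul (f g k : Sections E M F T) : S.mul (f + g) k = S.mul f k + S.mul g k :=
  Subtype.ext (funext fun σ => LinearMap.map_add₂ (S.star σ).mul (f.1 σ) (g.1 σ) (k.1 σ))

omit [IsManifold 𝓘(ℝ, E) ∞ M] [IsManifold 𝓘(ℝ, F) ∞ T] in
theorem mul_add (f g k : Sections E M F T) : S.mul f (g + k) = S.mul f g + S.mul f k :=
  Subtype.ext (funext fun σ => map_add ((S.star σ).mul (f.1 σ)) (g.1 σ) (k.1 σ))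

theorem add_toOp_mem_compatibleConnections [T2Space M]
    {D₀ : CovariantOp E M F T} (hD₀ : D₀ ∈ S.compatibleConnections) (β : S.derivationForms) :
    D₀ + S.toOp β ∈ S.compatibleConnections := by
  obtain ⟨hconn, hleibniz⟩ := hD₀
  obtain ⟨A₀, hA₀, hnat, hD₀A₀⟩ := isFormalConnection_iff.1 hconn
  refine ⟨isFormalConnection_iff.2
    ⟨fun σ => A₀ σ + ((S.star σ).derivations.subtype.restrictScalars ℝ) ∘ₗ β.1 σ,
      fun V f => (Sections E M F T).add_mem (hA₀ V f) (β.2 V f), fun σ v => ⟨?_, ?_⟩,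
      fun V f σ => ?_⟩, fun V f g => ?_⟩
  · exact (hnat σ v).1.add (StarProduct.isNatural_of_mem_derivations (β.1 σ v).2)
  · exact (hnat σ v).2.add (β.1 σ v).2.2
  · change (D₀ V f).1 σ + (S.toOp β V f).1 σ = _
    rw [hD₀A₀, add_assoc]
    rfl
  · simp only [Pi.add_apply, hleibniz, S.toOp_mul, S.add_mul, S.mul_add]
    exact add_add_add_comm _ _ _ _

variable [FiniteDimensional ℝ F] [T2Space T]

omit [IsManifold 𝓘(ℝ, E) ∞ M] in
theorem toOp_injective : Function.Injective S.toOp := by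
  refine fun β β' h => Subtype.ext (funext fun σ => LinearMap.ext fun v =>
    Subtype.ext (LinearMap.ext fun f => ?_))
  obtain ⟨V, rfl⟩ := exists_vectorField_eq v
  exact congrArg (fun D : CovariantOp E M F T => (D V (constSection F T f)).1 σ) h

theorem isDerivation_sub {D D₀ : CovariantOp E M F T}
    {A A₀ : RawOneForm F T fun _ => FormalOp E M} (hDA : HasConnectionForm D A)
    (hDA₀ : HasConnectionForm D₀ A₀)
    (hD : ∀ V f g, D V (S.mul f g) = S.mul (D V f) g + S.mul f (D V g))
    (hD₀ : ∀ V f g, D₀ V (S.mul f g) = S.mul (D₀ V f) g + S.mul f (D₀ V g))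
    (σ : T) (v : TangentSpace 𝓘(ℝ, F) σ) : (S.star σ).IsDerivation (A σ v - A₀ σ v) := by
  intro f g
  obtain ⟨V, rfl⟩ := exists_vectorField_eq v
  set f' := constSection F T f
  set g' := constSection F T g
  calc (A σ (V σ) - A₀ σ (V σ)) ((S.star σ).mul f g)
      = (D V (S.mul f' g')).1 σ - (D₀ V (S.mul f' g')).1 σ :=
        (hDA.sub_apply hDA₀ V (S.mul f' g') σ).symm
    _ = (S.star σ).mul ((D V f').1 σ - (D₀ V f').1 σ) g +
          (S.star σ).mul f ((D V g').1 σ - (D₀ V g').1 σ) := by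
        rw [hD, hD₀, LinearMap.map_sub₂, map_sub]
        exact add_sub_add_comm _ _ _ _
    _ = (S.star σ).mul ((A σ (V σ) - A₀ σ (V σ)) f) g +
          (S.star σ).mul f ((A σ (V σ) - A₀ σ (V σ)) g) := by
        rw [hDA.sub_apply hDA₀, hDA.sub_apply hDA₀]
        rfl

theorem exists_add_toOp_eq {D D₀ : CovariantOp E M F T} (hD : D ∈ S.compatibleConnections)
    (hD₀ : D₀ ∈ S.compatibleConnections) : ∃ β, D₀ + S.toOp β = D := by
  obtain ⟨A, hA, hnat, hDA⟩ := isFormalConnection_iff.1 hD.1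
  obtain ⟨A₀, hA₀, hnat₀, hDA₀⟩ := isFormalConnection_iff.1 hD₀.1
  have hmem (σ : T) (v : TangentSpace 𝓘(ℝ, F) σ) : A σ v - A₀ σ v ∈ (S.star σ).derivations :=
    ⟨S.isDerivation_sub hDA hDA₀ hD.2 hD₀.2 σ v, (hnat σ v).2.sub (hnat₀ σ v).2⟩
  choose β hβ using fun σ => StarProduct.exists_linearMap_sub_eq (hmem σ)
  have hβ_apply (σ : T) (v : TangentSpace 𝓘(ℝ, F) σ) (f : FormalFn E M) :
      (β σ v).1 f = A σ v f - A₀ σ v f := LinearMap.congr_fun (hβ σ v) f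
  have hsmooth : β ∈ S.derivationForms := fun V f => by
    have hsub := Sections.sub_mem (hA V f) (hA₀ V f)
    simp only [← hβ_apply] at hsub
    exact hsub
  refine ⟨⟨β, hsmooth⟩, funext fun V => funext fun f => Subtype.ext (funext fun σ => ?_)⟩
  change (D₀ V f).1 σ + (β σ (V σ)).1 (f.1 σ) = (D V f).1 σ
  rw [hβ, ← hDA.sub_apply hDA₀]
  exact add_sub_cancel _ _

theorem bijOn_toOp [T2Space M] {D₀ : CovariantOp E M F T}
    (hD₀ : D₀ ∈ S.compatibleConnections) :
    Set.BijOn (fun β : S.derivationForms => D₀ + S.toOp β) Set.univ S.compatibleConnections := by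
  refine ⟨fun β _ => S.add_toOp_mem_compatibleConnections hD₀ β,
    fun _ _ _ _ h => S.toOp_injective (add_left_cancel h), fun D hD => ?_⟩
  obtain ⟨β, hβ⟩ := S.exists_add_toOp_eq hD hD₀
  exact ⟨β, Set.mem_univ β, hβ⟩

end StarFamily

end Torsor

/-! ## Forms with values in formal symplectic vector fields -/

section SymplecticForms

open FormalFn

variable {E : Type*} [NormedAddCommGroup E] [NormedSpace ℝ E] [FiniteDimensional ℝ E]
  {M : Type*} [TopologicalSpace M] [ChartedSpace E M]
  {Ω : SymplecticForm E M}

section Equivalence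

variable [T2Space M] [IsManifold 𝓘(ℝ, E) ∞ M]

theorem StarProduct.Corresponds.unique_field {S : StarProduct Ω} {B : FormalOp E M}
    {Y Z : ℕ → Ω.symplecticFields} (hY : S.Corresponds B Y) (hZ : S.Corresponds B Z) : Y = Z := by
  have hvanishes (m : ℕ) : (B - B).VanishesModHPow m := fun f k _ => by
    rw [LinearMap.sub_apply, sub_self, map_zero]
  exact funext fun k =>
    sub_eq_zero.1 ((hY.sub hZ).vanishesModHPow_iff.1 (hvanishes (k + 1)) k k.lt_succ_self)

namespace StarProduct

variable (S : StarProduct Ω)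

theorem exists_symplecticEquiv : ∃ φ : formalSymplecticFields Ω ≃ₗ[ℂ] S.derivations,
    ∀ Y, S.Corresponds (φ Y).1 Y.1 := by
  choose φ hφ using S.exists_corresponds
  let φ₀ : formalSymplecticFields Ω →ₗ[ℂ] S.derivations :=
    { toFun := fun Y => ⟨φ Y.1, (hφ Y.1).mem_derivations Y.2⟩
      map_add' := fun Y Z => Subtype.ext ((hφ _).unique ((hφ Y.1).add (hφ Z.1)))
      map_smul' := fun c Y => Subtype.ext ((hφ _).unique ((hφ Y.1).smul c)) }
  have hφ₀ (Y) : S.Corresponds (φ₀ Y).1 Y.1 := hφ Y.1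
  refine ⟨LinearEquiv.ofBijective φ₀ ⟨fun Y Z h => ?_, fun B => ?_⟩, hφ₀⟩
  · exact Subtype.ext ((hφ₀ Y).unique_field (h ▸ hφ₀ Z))
  · obtain ⟨Y, hY, hBY⟩ := exists_corresponds_of_mem_derivations B.2
    exact ⟨⟨Y, hY⟩, Subtype.ext ((hφ Y).unique hBY)⟩

/-- The isomorphism `φ : h Γ_sym(M)⟦h⟧ ≃ Der₀(M, ⋆)` given by `Y ↦ h⁻¹ ad_⋆(b)` where `Y = X_b`. It
is unique, by `StarProduct.Corresponds.unique`. -/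
def symplecticEquiv : formalSymplecticFields Ω ≃ₗ[ℂ] S.derivations :=
  S.exists_symplecticEquiv.choose

theorem corresponds_symplecticEquiv (Y : formalSymplecticFields Ω) :
    S.Corresponds (S.symplecticEquiv Y).1 Y.1 :=
  S.exists_symplecticEquiv.choose_spec Y

theorem corresponds_symplecticEquiv_symm (B : S.derivations) :
    S.Corresponds B.1 (S.symplecticEquiv.symm B).1 := by
  simpa only [LinearEquiv.apply_symm_apply] using
    S.corresponds_symplecticEquiv (S.symplecticEquiv.symm B)

end StarProduct

end Equivalence

variable {F : Type*} [NormedAddCommGroup F] [NormedSpace ℝ F]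
  {T : Type*} [TopologicalSpace T] [ChartedSpace F T]

namespace StarFamily

variable (S : StarFamily F T Ω) {Y : T → ℕ → Ω.symplecticFields} {B : T → FormalOp E M}

theorem quasiInner_mem_sections {b f : T → FormalFn E M} (hb : b ∈ Sections E M F T)
    (hf : f ∈ Sections E M F T) :
    (fun σ => (S.star σ).quasiInner (b σ) (f σ)) ∈ Sections E M F T := fun k => by
  simp only [StarProduct.coeff_quasiInner]
  exact Sections.sub_mem (S.smooth ⟨b, hb⟩ ⟨f, hf⟩) (S.smooth ⟨f, hf⟩ ⟨b, hb⟩) (k + 1)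

variable [T2Space M] [IsManifold 𝓘(ℝ, E) ∞ M] [FiniteDimensional ℝ F] [IsManifold 𝓘(ℝ, F) ∞ T]

theorem mem_sections_of_corresponds (hY : ∀ k, IsSmoothFamily F fun σ => (Y σ k).1)
    (hB : ∀ σ, (S.star σ).Corresponds (B σ) (Y σ)) {f : T → FormalFn E M}
    (hf : f ∈ Sections E M F T) : (fun σ => B σ (f σ)) ∈ Sections E M F T := by
  rintro k ⟨σ₀, x₀⟩
  obtain ⟨U, hU, hx₀, b, hb, hbY⟩ := exists_isHamiltonianOn_family hY x₀
  refine (S.quasiInner_mem_sections hb hf k (σ₀, x₀)).congr_of_eventuallyEq ?_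
  filter_upwards [(hU.preimage continuous_snd).mem_nhds (show (σ₀, x₀) ∈ Prod.snd ⁻¹' U from hx₀)]
    with p hp
  exact ev_eq_iff.1 (StarProduct.corresponds_iff.1 (hB p.1) U (b p.1) hU (hbY p.1) (f p.1) p.2 hp) k

/-- Subtracting the derivations that correspond to the truncation of `Y` turns the `k`-th
coefficient into the leading one. -/
theorem isSmoothFamily_of_corresponds_of_lt (hB : ∀ σ, (S.star σ).Corresponds (B σ) (Y σ))
    (hsmooth : ∀ f : SmoothFn E M, (fun σ => B σ (PowerSeries.C f)) ∈ Sections E M F T) {k : ℕ}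
    (hlt : ∀ j < k, IsSmoothFamily F fun σ => (Y σ j).1) :
    IsSmoothFamily F fun σ => (Y σ k).1 := by
  let Y' : T → ℕ → Ω.symplecticFields := fun σ j => if j < k then Y σ j else 0
  have hY' (j : ℕ) : IsSmoothFamily F fun σ => (Y' σ j).1 := by
    by_cases hj : j < k
    · simpa only [Y', if_pos hj] using hlt j hj
    · simp only [Y', if_neg hj]
      exact fun f => contMDiff_const.congr fun p => map_zero (LinearMap.liftBaseChange ℂ _)
  choose B' hB' using fun σ => (S.star σ).exists_corresponds (Y' σ)
  intro f
  have hdiff := Sections.sub_mem (hsmooth f)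
    (S.mem_sections_of_corresponds hY' hB' (constSection F T (PowerSeries.C f)).2) k
  refine ((contDiff_const_smul (-Complex.I)).comp_contMDiff hdiff).congr fun p => ?_
  have hcoeff := ((hB p.1).sub (hB' p.1)).coeff_eq (m := k) (fun j hj => by
    simp only [Pi.sub_apply, Y', if_pos hj, sub_self]) (PowerSeries.C f) p.2
  have hYk : (Y p.1 - Y' p.1) k = Y p.1 k := by
    simp only [Pi.sub_apply, Y', lt_irrefl, if_false, sub_zero]
  rw [hYk, PowerSeries.coeff_zero_C, LinearMap.sub_apply] at hcoeff
  refine Eq.trans ?_ (congrArg (-Complex.I * ·) hcoeff.symm)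
  rw [← mul_assoc, neg_mul, Complex.I_mul_I, neg_neg, one_mul]

theorem isSmoothFamily_of_corresponds (hB : ∀ σ, (S.star σ).Corresponds (B σ) (Y σ))
    (hsmooth : ∀ f : SmoothFn E M, (fun σ => B σ (PowerSeries.C f)) ∈ Sections E M F T) (k : ℕ) :
    IsSmoothFamily F fun σ => (Y σ k).1 := by
  induction k using Nat.strong_induction_on with
  | _ k ih => exact S.isSmoothFamily_of_corresponds_of_lt hB hsmooth ih

end StarFamily

section OneForms

variable {N N' : T → Type*} [∀ σ, AddCommMonoid (N σ)] [∀ σ, Module ℝ (N σ)]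
  [∀ σ, Module ℂ (N σ)] [∀ σ, SMulCommClass ℝ ℂ (N σ)]
  [∀ σ, AddCommMonoid (N' σ)] [∀ σ, Module ℝ (N' σ)]
  [∀ σ, Module ℂ (N' σ)] [∀ σ, SMulCommClass ℝ ℂ (N' σ)]
  [∀ σ, LinearMap.CompatibleSMul (N σ) (N' σ) ℝ ℂ]
  [∀ σ, LinearMap.CompatibleSMul (N' σ) (N σ) ℝ ℂ]

/-- The isomorphism `Ω¹(T, N) ≃ Ω¹(T, N')` induced by a family of isomorphisms of the values. The
spaces of smooth forms are passed as subspaces `P`, `P'` of the spaces of all pointwise forms. -/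
def oneFormEquiv (e : ∀ σ, N σ ≃ₗ[ℂ] N' σ) (P : Submodule ℂ (RawOneForm F T N))
    (P' : Submodule ℂ (RawOneForm F T N'))
    (h : ∀ α ∈ P, (fun σ => ((e σ).toLinearMap.restrictScalars ℝ) ∘ₗ α σ) ∈ P')
    (h' : ∀ α ∈ P', (fun σ => ((e σ).symm.toLinearMap.restrictScalars ℝ) ∘ₗ α σ) ∈ P) :
    P ≃ₗ[ℂ] P' where
  toFun α := ⟨_, h α.1 α.2⟩
  invFun α := ⟨_, h' α.1 α.2⟩
  map_add' _ _ := Subtype.ext (funext fun σ => LinearMap.ext fun _ => map_add (e σ) _ _)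
  map_smul' _ _ := Subtype.ext (funext fun σ => LinearMap.ext fun _ => map_smul (e σ) _ _)
  left_inv _ := Subtype.ext (funext fun σ => LinearMap.ext fun _ => (e σ).symm_apply_apply _)
  right_inv _ := Subtype.ext (funext fun σ => LinearMap.ext fun _ => (e σ).apply_symm_apply _)

end OneForms

/-- The isomorphism `Ω¹(T, h Γ_sym(M)⟦h⟧) ≃ Ω¹(T, Der₀)` given by applying
`StarProduct.symplecticEquiv` pointwise. -/
def StarFamily.symplecticFormsEquiv [T2Space M] [IsManifold 𝓘(ℝ, E) ∞ M]
    [FiniteDimensional ℝ F] [IsManifold 𝓘(ℝ, F) ∞ T] (S : StarFamily F T Ω) :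
    symplecticForms F T Ω ≃ₗ[ℂ] S.derivationForms :=
  oneFormEquiv (fun σ => (S.star σ).symplecticEquiv) _ _
    (fun Y hY V f => S.mem_sections_of_corresponds (Y := fun σ => (Y σ (V σ)).1)
      (fun k g => hY V g k) (fun σ => (S.star σ).corresponds_symplecticEquiv _) f.2)
    (fun β hβ V f k => S.isSmoothFamily_of_corresponds
      (fun σ => (S.star σ).corresponds_symplecticEquiv_symm (β σ (V σ)))
      (fun g => hβ V (constSection F T (PowerSeries.C g))) k f)

end SymplecticForms

/-! ## Formal functions modulo constants -/

section FunctionForms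

open FormalFn

variable {E : Type*} [NormedAddCommGroup E] [NormedSpace ℝ E] {M : Type*} [TopologicalSpace M]
  [ChartedSpace E M]

theorem FormalFnModConst.mk_eq_mk_iff {b c : FormalFn E M} :
    (Submodule.Quotient.mk b : FormalFnModConst E M) = Submodule.Quotient.mk c ↔
      ∃ p : ℂ⟦X⟧, b - c = p • (1 : FormalFn E M) := by
  simp only [Submodule.Quotient.eq, LinearMap.mem_range, Algebra.linearMap_apply,
    Algebra.algebraMap_eq_smul_one, eq_comm]

variable [FiniteDimensional ℝ E] {Ω : SymplecticForm E M}

theorem SymplecticForm.hamiltonianField_coeff_smul_one (p : ℂ⟦X⟧) (k : ℕ) (x : M) :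
    Ω.hamiltonianField (PowerSeries.coeff k (p • (1 : FormalFn E M)) : SmoothFn E M).1 x = 0 := by
  have hconst : (PowerSeries.coeff k (p • (1 : FormalFn E M)) : SmoothFn E M).1 =
      fun _ => PowerSeries.coeff k p :=
    funext fun y => by rw [← coeff_ev, ev_smul_one]
  rw [hconst, Ω.hamiltonianField_const]

variable [IsManifold 𝓘(ℝ, E) ∞ M]

theorem FormalFnModConst.mk_eq_mk_of_hamiltonianField_eq [PreconnectedSpace M]
    {b c : FormalFn E M} (h : ∀ k x, Ω.hamiltonianField (PowerSeries.coeff k b : SmoothFn E M).1 x =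
      Ω.hamiltonianField (PowerSeries.coeff k c : SmoothFn E M).1 x) :
    (Submodule.Quotient.mk b : FormalFnModConst E M) = Submodule.Quotient.mk c := by
  rw [mk_eq_mk_iff]
  obtain hM | ⟨⟨x₁⟩⟩ := isEmpty_or_nonempty M
  · exact ⟨0, ext_ev fun x => isEmptyElim x⟩
  · refine ⟨ev x₁ (b - c), ext_ev fun x => ?_⟩
    rw [ev_smul_one]
    ext k
    rw [coeff_ev, coeff_ev]
    refine Ω.eq_of_hamiltonianField_eq_zero_of_preconnected (fun y => ?_) x x₁
    rw [map_sub, Ω.hamiltonianField_sub, h, sub_self]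

variable [T2Space M]

namespace IsPoissonBracket

variable {br : SmoothFn E M → SmoothFn E M → SmoothFn E M} (hbr : IsPoissonBracket Ω br)

include hbr in
theorem hamiltonianField_mem_symplecticFields (f : SmoothFn E M) :
    Ω.hamiltonianField f.1 ∈ Ω.symplecticFields := by
  refine hbr.mem_symplecticFields (P := br f) (fun g x => (hbr.apply f g x).symm) fun g k => ?_
  rw [hbr.swap (br f g) k, ← hbr.jacobi f g k]
  abel

/-- The formal Hamiltonian vector field `X_b = ∑ X_{b_k} h^k`. The bracket `br` only serves to show
that the fields `X_{b_k}` are smooth and symplectic. -/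
def formalHamiltonianField : FormalFn E M →ₗ[ℂ] (ℕ → Ω.symplecticFields) where
  toFun b k := ⟨_, hbr.hamiltonianField_mem_symplecticFields (PowerSeries.coeff k b)⟩
  map_add' b c := funext fun k => Subtype.ext <| funext fun x => by
    rw [map_add]
    exact Ω.hamiltonianField_add _ _ x
  map_smul' a b := funext fun k => Subtype.ext <| funext fun x => by
    rw [PowerSeries.coeff_smul]
    exact Ω.hamiltonianField_smul _ _ x

/-- The map `[b] ↦ X_b` on formal functions modulo constants. -/
def modConstHamiltonianField : FormalFnModConst E M →ₗ[ℂ] (ℕ → Ω.symplecticFields) :=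
  Submodule.liftQ ((LinearMap.range (Algebra.linearMap ℂ⟦X⟧ (FormalFn E M))).restrictScalars ℂ)
    hbr.formalHamiltonianField (by
      rintro _ ⟨p, rfl⟩
      refine funext fun k => Subtype.ext (funext fun x => ?_)
      rw [Algebra.linearMap_apply, Algebra.algebraMap_eq_smul_one]
      exact Ω.hamiltonianField_coeff_smul_one p k x) ∘ₗ
    (Submodule.Quotient.restrictScalarsEquiv ℂ _).symm.toLinearMap

theorem modConstHamiltonianField_mk (b : FormalFn E M) :
    hbr.modConstHamiltonianField (Submodule.Quotient.mk b) = hbr.formalHamiltonianField b := rfl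

theorem modConstHamiltonianField_injective [PreconnectedSpace M] :
    Function.Injective hbr.modConstHamiltonianField := by
  intro β γ h
  obtain ⟨b, rfl⟩ := Submodule.Quotient.mk_surjective _ β
  obtain ⟨c, rfl⟩ := Submodule.Quotient.mk_surjective _ γ
  rw [modConstHamiltonianField_mk, modConstHamiltonianField_mk] at h
  exact FormalFnModConst.mk_eq_mk_of_hamiltonianField_eq (Ω := Ω) fun k x =>
    congrFun (congrArg Subtype.val (congrFun h k)) x

theorem exists_modConstHamiltonianField_eq (hH : Subsingleton (DeRhamH1 E M))
    {Y : ℕ → Ω.symplecticFields} (hY : Y 0 = 0) :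
    ∃ β ∈ hFormalFnModConst E M, hbr.modConstHamiltonianField β = Y := by
  choose b hb using fun k => Ω.exists_hamiltonian_of_subsingleton hH (Y k).2
  refine ⟨_, ⟨Submodule.Quotient.mk (PowerSeries.mk fun k => b (k + 1)), rfl⟩,
    funext fun k => Subtype.ext (funext fun x => ?_)⟩
  change Ω.hamiltonianField (PowerSeries.coeff k ((PowerSeries.X : ℂ⟦X⟧) •
    (PowerSeries.mk fun k => b (k + 1) : FormalFn E M)) : SmoothFn E M).1 x = (Y k).1 x
  cases k with
  | zero =>
    rw [coeff_zero_X_smul, hY]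
    exact Ω.hamiltonianField_const 0 x
  | succ k => rw [coeff_succ_X_smul, PowerSeries.coeff_mk, hb]

theorem modConstHamiltonianField_mem {β : FormalFnModConst E M} (hβ : β ∈ hFormalFnModConst E M) :
    hbr.modConstHamiltonianField β ∈ formalSymplecticFields Ω := by
  obtain ⟨γ, rfl⟩ := hβ
  obtain ⟨c, rfl⟩ := Submodule.Quotient.mk_surjective _ γ
  refine Subtype.ext (funext fun x => ?_)
  change Ω.hamiltonianField
    (PowerSeries.coeff 0 ((PowerSeries.X : ℂ⟦X⟧) • c) : SmoothFn E M).1 x = 0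
  rw [coeff_zero_X_smul]
  exact Ω.hamiltonianField_const 0 x

/-- The isomorphism `h C̃^∞_h(M) ≃ h Γ_sym(M)⟦h⟧` for connected `M` with `H¹(M; ℝ) = 0`, sending a
formal function to its Hamiltonian vector fields. -/
def hamiltonianEquiv [PreconnectedSpace M] (hH : Subsingleton (DeRhamH1 E M)) :
    hFormalFnModConst E M ≃ₗ[ℂ] formalSymplecticFields Ω :=
  LinearEquiv.ofBijective
    ((hbr.modConstHamiltonianField ∘ₗ
      (hFormalFnModConst E M).subtype.restrictScalars ℂ).codRestrict (formalSymplecticFields Ω)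
        fun β => hbr.modConstHamiltonianField_mem β.2)
    ⟨fun _ _ h => Subtype.ext (hbr.modConstHamiltonianField_injective (congrArg Subtype.val h)),
      fun Y =>
        have ⟨β, hβ, hβY⟩ := hbr.exists_modConstHamiltonianField_eq hH Y.2
        ⟨⟨β, hβ⟩, Subtype.ext hβY⟩⟩

theorem isHamiltonianOn_hamiltonianEquiv [PreconnectedSpace M]
    (hH : Subsingleton (DeRhamH1 E M)) {β : hFormalFnModConst E M} {b : FormalFn E M}
    (hb : Submodule.Quotient.mk b = β.1) :
    IsHamiltonianOn (hbr.hamiltonianEquiv hH β).1 b Set.univ := by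
  have hβ : (hbr.hamiltonianEquiv hH β).1 = hbr.formalHamiltonianField b := by
    rw [← hbr.modConstHamiltonianField_mk, hb]
    rfl
  exact fun k x _ => congrFun (congrArg Subtype.val (congrFun hβ k)) x

theorem hamiltonianEquiv_symm_eq_mk [PreconnectedSpace M] (hH : Subsingleton (DeRhamH1 E M))
    {Y : formalSymplecticFields Ω} {g : FormalFn E M} (hg : IsHamiltonianOn Y.1 g Set.univ) :
    ((hbr.hamiltonianEquiv hH).symm Y).1 = Submodule.Quotient.mk g := by
  obtain ⟨b, hb⟩ := Submodule.Quotient.mk_surjective _ ((hbr.hamiltonianEquiv hH).symm Y).1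
  have hbY := hbr.isHamiltonianOn_hamiltonianEquiv hH hb
  rw [LinearEquiv.apply_symm_apply] at hbY
  exact hb.symm.trans (FormalFnModConst.mk_eq_mk_of_hamiltonianField_eq (Ω := Ω) fun k x => by
    rw [← hbY k x trivial, hg k x trivial])

end IsPoissonBracket

variable {F : Type*} [NormedAddCommGroup F] [NormedSpace ℝ F]
  {T : Type*} [TopologicalSpace T] [ChartedSpace F T]

omit [T2Space M] [IsManifold 𝓘(ℝ, E) ∞ M] in
theorem StarFamily.isSmoothFamily_hamiltonianField (S : StarFamily F T Ω) {g : T → FormalFn E M}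
    (hg : g ∈ Sections E M F T) (k : ℕ) : IsSmoothFamily F fun σ =>
      Ω.hamiltonianField (PowerSeries.coeff k (g σ) : SmoothFn E M).1 := by
  intro f
  have hgk : (fun σ => PowerSeries.C (PowerSeries.coeff k (g σ))) ∈ Sections E M F T := by
    rintro (_ | n)
    · simpa only [PowerSeries.coeff_zero_C] using hg k
    · simp only [PowerSeries.coeff_succ_C]
      exact contMDiff_const
  refine ((contDiff_const_smul (-Complex.I)).comp_contMDiff
    (S.quasiInner_mem_sections hgk (constSection F T (PowerSeries.C f)).2 0)).congr fun p => ?_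
  exact ((S.star p.1).bracket_apply (PowerSeries.coeff k (g p.1)) f p.2).symm

omit [T2Space M] [IsManifold 𝓘(ℝ, E) ∞ M] in
theorem SymplecticForm.exists_hamiltonian_vanishing_at (hH : Subsingleton (DeRhamH1 E M))
    {Y : (x : M) → ComplexTangent E x} (hY : Y ∈ Ω.symplecticFields) (x₁ : M) :
    ∃ b : SmoothFn E M, b.1 x₁ = 0 ∧ ∀ x, Y x = Ω.hamiltonianField b.1 x := by
  obtain ⟨b, hb⟩ := Ω.exists_hamiltonian_of_subsingleton hH hY
  refine ⟨b - algebraMap ℂ (SmoothFn E M) (b.1 x₁), sub_self _, fun x => ?_⟩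
  rw [Ω.hamiltonianField_sub, hb]
  exact ((congrArg (_ - ·) (Ω.hamiltonianField_const (b.1 x₁) x)).trans (sub_zero _)).symm

variable [FiniteDimensional ℝ F] [IsManifold 𝓘(ℝ, F) ∞ T] [PreconnectedSpace M]

theorem exists_isHamiltonianOn_univ_family (hH : Subsingleton (DeRhamH1 E M))
    {Y : T → ℕ → Ω.symplecticFields} (hY : ∀ k, IsSmoothFamily F fun σ => (Y σ k).1) :
    ∃ g : Sections E M F T, ∀ σ, IsHamiltonianOn (Y σ) (g.1 σ) Set.univ := by
  obtain hM | ⟨⟨x₁⟩⟩ := isEmpty_or_nonempty M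
  · exact ⟨0, fun σ k x => isEmptyElim x⟩
  choose b hb₁ hb using fun σ k => Ω.exists_hamiltonian_vanishing_at hH (Y σ k).2 x₁
  refine ⟨⟨fun σ => PowerSeries.mk (b σ), fun k => ?_⟩, fun σ k x _ => ?_⟩
  · simp only [PowerSeries.coeff_mk]
    refine Ω.contMDiff_hamiltonian_family (fun σ => (Y σ k).2) (hY k) (fun σ => hb σ k)
      (x₁ := x₁) ?_
    simpa only [hb₁] using contMDiff_const
  · rw [PowerSeries.coeff_mk]
    exact hb σ k x

namespace StarFamily

variable (S : StarFamily F T Ω) (hH : Subsingleton (DeRhamH1 E M))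

/-- The isomorphism `Ω¹(T, h C̃^∞_h(M)) ≃ Ω¹(T, h Γ_sym(M)⟦h⟧)` given by applying
`IsPoissonBracket.hamiltonianEquiv` pointwise. -/
def functionFormsEquiv : functionForms E M F T ≃ₗ[ℂ] symplecticForms F T Ω :=
  oneFormEquiv (fun σ => (S.star σ).isPoissonBracket_bracket.hamiltonianEquiv hH) _ _
    (fun β hβ V f k => by
      obtain ⟨g, hg⟩ := hβ V
      refine (S.isSmoothFamily_hamiltonianField g.2 k f).congr fun p => ?_
      exact congrArg (ComplexTangent.deriv · f.1)
        ((S.star p.1).isPoissonBracket_bracket.isHamiltonianOn_hamiltonianEquiv hH (hg p.1).symm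
          k p.2 trivial))
    (fun Y hY V => by
      obtain ⟨g, hg⟩ := exists_isHamiltonianOn_univ_family hH
        (Y := fun σ => (Y σ (V σ)).1) fun k f => hY V f k
      exact ⟨g, fun σ =>
        (S.star σ).isPoissonBracket_bracket.hamiltonianEquiv_symm_eq_mk hH (hg σ)⟩)

end StarFamily

end FunctionForms

end FormalConnections

end

theorem mainTheorem3_general
    {E : Type*} [NormedAddCommGroup E] [NormedSpace ℝ E] [FiniteDimensional ℝ E]
    {M : Type*} [TopologicalSpace M] [T2Space M] [ChartedSpace E M] [IsManifold 𝓘(ℝ, E) ∞ M]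
    {F : Type*} [NormedAddCommGroup F] [NormedSpace ℝ F] [FiniteDimensional ℝ F]
    {T : Type*} [TopologicalSpace T] [T2Space T] [ChartedSpace F T] [IsManifold 𝓘(ℝ, F) ∞ T]
    (Ω : FormalConnections.SymplecticForm E M) (S : FormalConnections.StarFamily F T Ω) :
    (∀ D₀ ∈ S.compatibleConnections,
      Set.BijOn (fun β : S.derivationForms => D₀ + S.toOp β) Set.univ S.compatibleConnections) ∧
    (∃ (φ : ∀ σ, FormalConnections.formalSymplecticFields Ω ≃ₗ[ℂ] (S.star σ).derivations)
        (Φ : FormalConnections.symplecticForms F T Ω ≃ₗ[ℂ] S.derivationForms),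
      (∀ σ Y, (S.star σ).Corresponds (φ σ Y).1 Y.1) ∧
      (∀ Y σ v, (Φ Y).1 σ v = φ σ (Y.1 σ v)) ∧
      ∀ D₀ ∈ S.compatibleConnections,
        Set.BijOn (fun Y => D₀ + S.toOp (Φ Y)) Set.univ S.compatibleConnections) ∧
    (PreconnectedSpace M → Subsingleton (FormalConnections.DeRhamH1 E M) →
      ∃ (ψ : ∀ σ, FormalConnections.hFormalFnModConst E M ≃ₗ[ℂ] (S.star σ).derivations)
        (Ψ : FormalConnections.functionForms E M F T ≃ₗ[ℂ] S.derivationForms),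
      (∀ σ (β : FormalConnections.hFormalFnModConst E M) (b f : FormalConnections.FormalFn E M),
        Submodule.Quotient.mk b = β.1 →
          PowerSeries.X * (ψ σ β).1 f = (S.star σ).mul b f - (S.star σ).mul f b) ∧
      (∀ β σ v, (Ψ β).1 σ v = ψ σ (β.1 σ v)) ∧
      ∀ D₀ ∈ S.compatibleConnections,
        Set.BijOn (fun β => D₀ + S.toOp (Ψ β)) Set.univ S.compatibleConnections) := by
  refine ⟨fun D₀ hD₀ => S.bijOn_toOp hD₀, ?_, fun _ hH => ?_⟩
  · exact ⟨fun σ => (S.star σ).symplecticEquiv, S.symplecticFormsEquiv,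
      fun σ => (S.star σ).corresponds_symplecticEquiv, fun _ _ _ => rfl, fun D₀ hD₀ =>
        (S.bijOn_toOp hD₀).comp (Set.bijOn_univ.2 S.symplecticFormsEquiv.bijective)⟩
  · let e σ := (S.star σ).isPoissonBracket_bracket.hamiltonianEquiv hH
    let Ψ := (S.functionFormsEquiv hH).trans S.symplecticFormsEquiv
    refine ⟨fun σ => (e σ).trans (S.star σ).symplecticEquiv, Ψ, fun σ β b f hb => ?_,
      fun _ _ _ => rfl, fun D₀ hD₀ => (S.bijOn_toOp hD₀).comp (Set.bijOn_univ.2 Ψ.bijective)⟩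
    have hβ := (S.star σ).isPoissonBracket_bracket.isHamiltonianOn_hamiltonianEquiv hH hb
    exact PowerSeries.ext fun k => Subtype.ext (funext fun x =>
      ((S.star σ).corresponds_symplecticEquiv (e σ β)).2 Set.univ b isOpen_univ hβ f k x trivial)

theorem mainTheorem3
    {E : Type*} [NormedAddCommGroup E] [NormedSpace ℝ E] [FiniteDimensional ℝ E]
    {M : Type*} [TopologicalSpace M] [T2Space M] [SecondCountableTopology M]
    [ChartedSpace E M] [IsManifold 𝓘(ℝ, E) ∞ M]
    {F : Type*} [NormedAddCommGroup F] [NormedSpace ℝ F] [FiniteDimensional ℝ F]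
    {T : Type*} [TopologicalSpace T] [T2Space T] [SecondCountableTopology T]
    [ChartedSpace F T] [IsManifold 𝓘(ℝ, F) ∞ T]
    (Ω : FormalConnections.SymplecticForm E M) (S : FormalConnections.StarFamily F T Ω) :
    -- `ℱ = D₀ + Ω¹(T, Der₀)`, every element being obtained exactly once
    (∀ D₀ ∈ S.compatibleConnections,
      Set.BijOn (fun β : S.derivationForms => D₀ + S.toOp β) Set.univ S.compatibleConnections) ∧
    -- `ℱ = D₀ + Ω¹(T, h Γ_sym(M)⟦h⟧)`, through the pointwise correspondence of formal symplectic
    -- vector fields and derivations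
    (∃ (φ : ∀ σ, FormalConnections.formalSymplecticFields Ω ≃ₗ[ℂ] (S.star σ).derivations)
        (Φ : FormalConnections.symplecticForms F T Ω ≃ₗ[ℂ] S.derivationForms),
      (∀ σ Y, (S.star σ).Corresponds (φ σ Y).1 Y.1) ∧
      (∀ Y σ v, (Φ Y).1 σ v = φ σ (Y.1 σ v)) ∧
      ∀ D₀ ∈ S.compatibleConnections,
        Set.BijOn (fun Y => D₀ + S.toOp (Φ Y)) Set.univ S.compatibleConnections) ∧
    -- if `H¹(M; ℝ) = 0`: `ℱ = D₀ + Ω¹(T, h C^∞(M)⟦h⟧ / ℂ⟦h⟧)`, through `b ↦ h⁻¹ (b ⋆ · - · ⋆ b)`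
    (PreconnectedSpace M → Subsingleton (FormalConnections.DeRhamH1 E M) →
      ∃ (ψ : ∀ σ, FormalConnections.hFormalFnModConst E M ≃ₗ[ℂ] (S.star σ).derivations)
        (Ψ : FormalConnections.functionForms E M F T ≃ₗ[ℂ] S.derivationForms),
      (∀ σ (β : FormalConnections.hFormalFnModConst E M) (b f : FormalConnections.FormalFn E M),
        Submodule.Quotient.mk b = β.1 →
          PowerSeries.X * (ψ σ β).1 f = (S.star σ).mul b f - (S.star σ).mul f b) ∧
      (∀ β σ v, (Ψ β).1 σ v = ψ σ (β.1 σ v)) ∧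
      ∀ D₀ ∈ S.compatibleConnections,
        Set.BijOn (fun β => D₀ + S.toOp (Ψ β)) Set.univ S.compatibleConnections) :=
  mainTheorem3_general Ω S
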